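/- Let $\Bbbk$ be an algebraically closed field of characteristic zero and let $q\in\Bbbk^*$ be not a root of unity. Let $D_q$ be the Heisenberg double of the quantum Euclidean group, i.e. the $\Bbbk$-algebra generated by $a,a^{-1},b,c,K,K^{-1},E,F$ with defining relations $$ab=qba,\quad ac=qca,\quad bc=cb,\quad aa^{-1}=a^{-1}a=1,\quad KE=q^2EK,\quad KF=q^{-2}FK,\quad EF=FE,\quad KK^{-1}=K^{-1}K=1,$$ $$Ka=q^{-1}aK,\quad Kb=qbK,\quad Kc=q^{-1}cK,\quad Ea=aE,\quad Eb=bE,\quad Ec=cE+a^{-1}K,\quad Fa=qaF,\quad Fb=q^{-1}bF+a,\quad Fc=qcF.$$ Put $\phi=(1-q^2)Fb+q^2a$ and $\psi=(1-q^{-2})Ec+q^{-2}a^{-1}K$, and write $(s,t,\dots)$ for the two-sided ideal of $D_q$ generated by $s,t,\dots$. For an $n\times n$ matrix $Q=(q_{ij})$ over $\Bbbk^*$ with $q_{ii}=q_{ij}q_{ji}=1$ and $0\le r\le n$, the quantum polynomial algebra $\Bbbk_Q[X_1^{\pm1},\dots,X_r^{\pm1},X_{r+1},\dots,X_n]$ is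 the $\Bbbk$-algebra generated by $X_1,\dots,X_n,X_1^{-1},\dots,X_r^{-1}$ with defining relations $X_iX_j=q_{ij}X_jX_i$ and $X_iX_i^{-1}=X_i^{-1}X_i=1$ ($i\le r$); it is called a quantum torus if $r=n$. Let $Q=(q^{d_{ij}})$ be the $6\times6$ matrix, with rows and columns indexed by $a,b,c,K,\psi,\phi$ in this order, whose exponents are $$(d_{ij})=\begin{pmatrix}0&1&1&1&1&0\\-1&0&0&-1&0&1\\-1&0&0&1&0&-1\\-1&1&-1&0&1&-1\\-1&0&0&-1&0&-1\\0&-1&1&1&1&0\end{pmatrix},$$ and let $Q_I$ be obtained from $Q$ by deleting the rows and columns with index in $I$ (so $Q_{36}$ has rows and columns $3$ and $6$ deleted). For a $\Bbbk$-algebra $R$ with endomorphisms $\sigma,\tau$ and an element $\mathtt a\in R$ such that $\tau\sigma(\mathtt a)=\mathtt a$, $\mathtt a r=\tau\sigma(r)\mathtt a$ and $\sigma(\mathtt a)r=\sigma\tau(r)\sigma(\mathtt a)$ for all $r\in R$, the GGWA (generalized generalized Weyl algebra) $R[x,y;\sigma,\tau,\mathtt a]$ is the algebra generated by $R$, $x$,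 $y$ with defining relations $xr=\sigma(r)x$, $yr=\tau(r)y$ ($r\in R$), $yx=\mathtt a$, $xy=\sigma(\mathtt a)$. In the following, each isomorphism is one of $\Bbbk$-algebras that sends the class of each generator $a,b,c,K,E,F,\phi,\psi$ that appears on the right-hand side to the element of the same name, and each $\sigma,\tau,\mathtt a$ satisfies the above conditions. 1. $(\phi)=D_q\phi$, and $D_q/(\phi)$ is a domain with $$D_q/(\phi)\simeq\Bbbk_{Q_{36}}[a^{\pm1},b^{\pm1},K^{\pm1},\psi][E,c;\sigma,\tau,\mathtt a],\qquad\mathtt a=(1-q^{-2})^{-1}(\psi-a^{-1}K),$$ where $\sigma,\tau$ are the automorphisms of the base ring with $\sigma(a)=a$, $\sigma(b)=b$, $\sigma(K)=q^{-2}K$, $\sigma(\psi)=\psi$ and $\tau(a)=q^{-1}a$, $\tau(b)=b$, $\tau(K)=qK$, $\tau(\psi)=\psi$. The element $b$ is invertible in $D_q/(\phi)$, and the centre of $D_q/(\phi)$ is the polynomial algebra $\Bbbk[\Theta]$ in one variable $\Theta=\psi b^{-1}$. 2. $(\psi)=D_q\psi$, and $D_q/(\psi)$ is a domain with $$D_q/(\psi)\simeq\Bbbk_{Q_{25}}[a^{\pm1},c^{\pm1},K^{\pm1},\phi][F,b;\sigma,\tau,\mathtt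 a],\qquad\mathtt a=(q^{-1}-q)^{-1}(\phi-a),$$ where $\sigma,\tau$ are the automorphisms of the base ring with $\sigma(a)=qa$, $\sigma(c)=qc$, $\sigma(K)=q^2K$, $\sigma(\phi)=q^{-1}\phi$ and $\tau(a)=q^{-1}a$, $\tau(c)=c$, $\tau(K)=q^{-1}K$, $\tau(\phi)=q\phi$. The element $c$ is invertible in $D_q/(\psi)$, and the centre of $D_q/(\psi)$ is the polynomial algebra $\Bbbk[\Omega]$ in one variable $\Omega=\phi Kc^{-1}$. 3. For every $\alpha\in\Bbbk$, the algebra $D_q/(\phi,\psi-\alpha b)$ is a simple domain with $$D_q/(\phi,\psi-\alpha b)\simeq\Bbbk_{Q_{356}}[a^{\pm1},b^{\pm1},K^{\pm1}][E,c;\sigma,\tau,\mathtt a],\qquad\mathtt a=(1-q^{-2})^{-1}(\alpha b-a^{-1}K),$$ where $\sigma,\tau$ are the automorphisms of the base ring with $\sigma(a)=a$, $\sigma(b)=b$, $\sigma(K)=q^{-2}K$ and $\tau(a)=q^{-1}a$, $\tau(b)=b$, $\tau(K)=qK$. In particular (the case $\alpha=0$), $(\phi,\psi)=D_q\phi+D_q\psi$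 and $D_q/(\phi,\psi)$ is a simple quantum torus $$D_q/(\phi,\psi)\simeq\Bbbk_{Q_{56}}[a^{\pm1},b^{\pm1},c^{\pm1},K^{\pm1}].$$ 4. For every $\beta\in\Bbbk$, the algebra $D_q/(\phi-\beta cK^{-1},\psi)$ is a simple domain with $$D_q/(\phi-\beta cK^{-1},\psi)\simeq\Bbbk_{Q_{256}}[a^{\pm1},c^{\pm1},K^{\pm1}][F,b;\sigma,\tau,\mathtt a],\qquad\mathtt a=(q^{-1}-q)^{-1}(\beta cK^{-1}-a),$$ where $\sigma,\tau$ are the automorphisms of the base ring with $\sigma(a)=qa$, $\sigma(c)=qc$, $\sigma(K)=q^2K$ and $\tau(a)=q^{-1}a$, $\tau(c)=c$, $\tau(K)=q^{-1}K$. -/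

import Mathlib

/-! ### Quantum polynomial algebras -/

/-- The defining relations of `k_Q[X₁^{±1}, …, X_r^{±1}, X_{r+1}, …, X_n]`. The generator `Sum.inl i`
is `X_i`, the generator `Sum.inr i` (for an index `i` among the first `r`) is `X_i⁻¹`. -/
inductive QuantumPolynomial.Rel {k : Type*} [Field k] {n : ℕ} (Q : Matrix (Fin n) (Fin n) k)
    (r : ℕ) :
    FreeAlgebra k (Fin n ⊕ {i : Fin n // i.val < r}) →
      FreeAlgebra k (Fin n ⊕ {i : Fin n // i.val < r}) → Prop
  | comm (i j : Fin n) : QuantumPolynomial.Rel Q r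
      (FreeAlgebra.ι k (Sum.inl i) * FreeAlgebra.ι k (Sum.inl j))
      (Q i j • (FreeAlgebra.ι k (Sum.inl j) * FreeAlgebra.ι k (Sum.inl i)))
  | mul_inv (i : {i : Fin n // i.val < r}) : QuantumPolynomial.Rel Q r
      (FreeAlgebra.ι k (Sum.inl i.1) * FreeAlgebra.ι k (Sum.inr i)) 1
  | inv_mul (i : {i : Fin n // i.val < r}) : QuantumPolynomial.Rel Q r
      (FreeAlgebra.ι k (Sum.inr i) * FreeAlgebra.ι k (Sum.inl i.1)) 1

/-- The quantum polynomial algebra `k_Q[X₁^{±1}, …, X_r^{±1}, X_{r+1}, …, X_n]`, for a matrix `Q`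
with `Q i i = 1` and `Q i j * Q j i = 1`. It is a quantum torus if `r = n`. -/
def QuantumPolynomial {k : Type*} [Field k] {n : ℕ} (Q : Matrix (Fin n) (Fin n) k) (r : ℕ) :=
  RingQuot (QuantumPolynomial.Rel Q r)

namespace QuantumPolynomial

variable {k : Type*} [Field k] {n : ℕ} (Q : Matrix (Fin n) (Fin n) k) (r : ℕ)

instance : Ring (QuantumPolynomial Q r) := inferInstanceAs (Ring (RingQuot (Rel Q r)))

instance : Algebra k (QuantumPolynomial Q r) := inferInstanceAs (Algebra k (RingQuot (Rel Q r)))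

/-- The indeterminate `X_i` (indices start at `0`). -/
def X (i : Fin n) : QuantumPolynomial Q r :=
  RingQuot.mkAlgHom k (Rel Q r) (FreeAlgebra.ι k (Sum.inl i))

/-- The inverse `X_i⁻¹` of one of the first `r` indeterminates. -/
def Xinv (i : Fin n) (hi : i.val < r) : QuantumPolynomial Q r :=
  RingQuot.mkAlgHom k (Rel Q r) (FreeAlgebra.ι k (Sum.inr ⟨i, hi⟩))

end QuantumPolynomial

/-! ### Generalized generalized Weyl algebras -/

/-- The conditions on `σ`, `τ`, `a` under which the GGWA `R[x, y; σ, τ, a]` is formed. -/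
structure IsGGWADatum {k R : Type*} [CommRing k] [Ring R] [Algebra k R]
    (σ τ : R →ₐ[k] R) (a : R) : Prop where
  apply_eq : τ (σ a) = a
  mul_eq : ∀ r : R, a * r = τ (σ r) * a
  map_mul_eq : ∀ r : R, σ a * r = σ (τ r) * σ a

/-- The defining relations of the GGWA `R[x, y; σ, τ, a]`. The generators are the elements of `R`
(`Sum.inl r`), `x` (`Sum.inr false`) and `y` (`Sum.inr true`); the first three families of
relations say that `R` maps to the quotient by a homomorphism of `k`-algebras. -/
inductive GGWA.Rel {k R : Type*} [CommRing k] [Ring R] [Algebra k R]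
    (σ τ : R →ₐ[k] R) (a : R) : FreeAlgebra k (R ⊕ Bool) → FreeAlgebra k (R ⊕ Bool) → Prop
  | of_scalar (t : k) : GGWA.Rel σ τ a
      (FreeAlgebra.ι k (Sum.inl (algebraMap k R t))) (algebraMap k _ t)
  | of_add (r s : R) : GGWA.Rel σ τ a
      (FreeAlgebra.ι k (Sum.inl (r + s)))
      (FreeAlgebra.ι k (Sum.inl r) + FreeAlgebra.ι k (Sum.inl s))
  | of_mul (r s : R) : GGWA.Rel σ τ a
      (FreeAlgebra.ι k (Sum.inl (r * s)))
      (FreeAlgebra.ι k (Sum.inl r) * FreeAlgebra.ι k (Sum.inl s))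
  | x_mul (r : R) : GGWA.Rel σ τ a
      (FreeAlgebra.ι k (Sum.inr false) * FreeAlgebra.ι k (Sum.inl r))
      (FreeAlgebra.ι k (Sum.inl (σ r)) * FreeAlgebra.ι k (Sum.inr false))
  | y_mul (r : R) : GGWA.Rel σ τ a
      (FreeAlgebra.ι k (Sum.inr true) * FreeAlgebra.ι k (Sum.inl r))
      (FreeAlgebra.ι k (Sum.inl (τ r)) * FreeAlgebra.ι k (Sum.inr true))
  | y_mul_x : GGWA.Rel σ τ a
      (FreeAlgebra.ι k (Sum.inr true) * FreeAlgebra.ι k (Sum.inr false))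
      (FreeAlgebra.ι k (Sum.inl a))
  | x_mul_y : GGWA.Rel σ τ a
      (FreeAlgebra.ι k (Sum.inr false) * FreeAlgebra.ι k (Sum.inr true))
      (FreeAlgebra.ι k (Sum.inl (σ a)))

/-- The GGWA `R[x, y; σ, τ, a]`: the algebra generated by `R`, `x`, `y` with defining relations
`x r = σ(r) x`, `y r = τ(r) y`, `y x = a`, `x y = σ(a)`. -/
def GGWA {k R : Type*} [CommRing k] [Ring R] [Algebra k R] (σ τ : R →ₐ[k] R) (a : R) :=
  RingQuot (GGWA.Rel σ τ a)

namespace GGWA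

variable {k R : Type*} [CommRing k] [Ring R] [Algebra k R] (σ τ : R →ₐ[k] R) (a : R)

instance : Ring (GGWA σ τ a) := inferInstanceAs (Ring (RingQuot (Rel σ τ a)))

instance : Algebra k (GGWA σ τ a) := inferInstanceAs (Algebra k (RingQuot (Rel σ τ a)))

/-- The image of an element of the base ring. -/
def of (r : R) : GGWA σ τ a := RingQuot.mkAlgHom k (Rel σ τ a) (FreeAlgebra.ι k (Sum.inl r))

/-- The generator `x`. -/
def x : GGWA σ τ a := RingQuot.mkAlgHom k (Rel σ τ a) (FreeAlgebra.ι k (Sum.inr false))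

/-- The generator `y`. -/
def y : GGWA σ τ a := RingQuot.mkAlgHom k (Rel σ τ a) (FreeAlgebra.ι k (Sum.inr true))

end GGWA

/-! ### The Heisenberg double of the quantum Euclidean group -/

/-- The generators of `D_q`. -/
inductive Dq.Gen : Type
  | a | ainv | b | c | K | Kinv | E | F

/-- The free algebra generator belonging to a generator of `D_q`. -/
abbrev Dq.gen (k : Type*) [Field k] (g : Dq.Gen) : FreeAlgebra k Dq.Gen := FreeAlgebra.ι k g

/-- The defining relations of `D_q`. -/
inductive Dq.Rel {k : Type*} [Field k] (q : k) :
    FreeAlgebra k Dq.Gen → FreeAlgebra k Dq.Gen → Prop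
  | ab : Dq.Rel q (gen k .a * gen k .b) (q • (gen k .b * gen k .a))
  | ac : Dq.Rel q (gen k .a * gen k .c) (q • (gen k .c * gen k .a))
  | bc : Dq.Rel q (gen k .b * gen k .c) (gen k .c * gen k .b)
  | a_ainv : Dq.Rel q (gen k .a * gen k .ainv) 1
  | ainv_a : Dq.Rel q (gen k .ainv * gen k .a) 1
  | KE : Dq.Rel q (gen k .K * gen k .E) (q ^ 2 • (gen k .E * gen k .K))
  | KF : Dq.Rel q (gen k .K * gen k .F) (q ^ (-2 : ℤ) • (gen k .F * gen k .K))
  | EF : Dq.Rel q (gen k .E * gen k .F) (gen k .F * gen k .E)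
  | K_Kinv : Dq.Rel q (gen k .K * gen k .Kinv) 1
  | Kinv_K : Dq.Rel q (gen k .Kinv * gen k .K) 1
  | Ka : Dq.Rel q (gen k .K * gen k .a) (q⁻¹ • (gen k .a * gen k .K))
  | Kb : Dq.Rel q (gen k .K * gen k .b) (q • (gen k .b * gen k .K))
  | Kc : Dq.Rel q (gen k .K * gen k .c) (q⁻¹ • (gen k .c * gen k .K))
  | Ea : Dq.Rel q (gen k .E * gen k .a) (gen k .a * gen k .E)
  | Eb : Dq.Rel q (gen k .E * gen k .b) (gen k .b * gen k .E)
  | Ec : Dq.Rel q (gen k .E * gen k .c) (gen k .c * gen k .E + gen k .ainv * gen k .K)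
  | Fa : Dq.Rel q (gen k .F * gen k .a) (q • (gen k .a * gen k .F))
  | Fb : Dq.Rel q (gen k .F * gen k .b) (q⁻¹ • (gen k .b * gen k .F) + gen k .a)
  | Fc : Dq.Rel q (gen k .F * gen k .c) (q • (gen k .c * gen k .F))

/-- The Heisenberg double `D_q = D_q(E₂)` of the quantum Euclidean group. -/
def Dq {k : Type*} [Field k] (q : k) := RingQuot (Dq.Rel q)

namespace Dq

variable {k : Type*} [Field k] (q : k)

instance : Ring (Dq q) := inferInstanceAs (Ring (RingQuot (Rel q)))

instance : Algebra k (Dq q) := inferInstanceAs (Algebra k (RingQuot (Rel q)))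

/-- The element of `D_q` given by a generator. -/
def of (g : Gen) : Dq q := RingQuot.mkAlgHom k (Rel q) (gen k g)

/-- The generator `a` of `D_q`. -/
abbrev a : Dq q := of q .a

/-- The generator `a⁻¹` of `D_q`. -/
abbrev ainv : Dq q := of q .ainv

/-- The generator `b` of `D_q`. -/
abbrev b : Dq q := of q .b

/-- The generator `c` of `D_q`. -/
abbrev c : Dq q := of q .c

/-- The generator `K` of `D_q`. -/
abbrev K : Dq q := of q .K

/-- The generator `K⁻¹` of `D_q`. -/
abbrev Kinv : Dq q := of q .Kinv

/-- The generator `E` of `D_q`. -/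
abbrev E : Dq q := of q .E

/-- The generator `F` of `D_q`. -/
abbrev F : Dq q := of q .F

/-- `φ = (1 - q²) F b + q² a`. -/
def phi : Dq q := (1 - q ^ 2) • (F q * b q) + q ^ 2 • a q

/-- `ψ = (1 - q⁻²) E c + q⁻² a⁻¹ K`. -/
def psi : Dq q :=
  (1 - q ^ (-2 : ℤ)) • (E q * c q) + q ^ (-2 : ℤ) • (ainv q * K q)

/-- The factor algebra of `D_q` by the two-sided ideal generated by a set. -/
abbrev Factor {q : k} (s : Set (Dq q)) := (TwoSidedIdeal.span s).ringCon.Quotient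

/-- The image of an element of `D_q` in a factor algebra. -/
def cl {q : k} (s : Set (Dq q)) (z : Dq q) : Factor s := (TwoSidedIdeal.span s).ringCon.mk' z

/-- The exponents `d_{ij}`, for the variables in the order `a, b, c, K, ψ, φ`. -/
def expMatrix : Matrix (Fin 6) (Fin 6) ℤ :=
  !![0, 1, 1, 1, 1, 0;
    -1, 0, 0, -1, 0, 1;
    -1, 0, 0, 1, 0, -1;
    -1, 1, -1, 0, 1, -1;
    -1, 0, 0, -1, 0, -1;
    0, -1, 1, 1, 1, 0]

/-- The matrix `Q = (q^{d_{ij}})`, for the variables in the order `a, b, c, K, ψ, φ`. -/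
def qMatrix : Matrix (Fin 6) (Fin 6) k := Matrix.of fun i j => q ^ expMatrix i j

/-- The quantum polynomial algebra on those of the variables `a, b, c, K, ψ, φ` (numbered from
`0` to `5`) that `v` lists; the first `r` of the listed variables are invertible. -/
abbrev QPoly {n : ℕ} (v : Fin n → Fin 6) (r : ℕ) :=
  QuantumPolynomial ((qMatrix q).submatrix v v) r

/-- `k_{Q₃₆}[a^{±1}, b^{±1}, K^{±1}, ψ]`. -/
abbrev R36 := QPoly q ![0, 1, 3, 4] 3

/-- `k_{Q₂₅}[a^{±1}, c^{±1}, K^{±1}, φ]`. -/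
abbrev R25 := QPoly q ![0, 2, 3, 5] 3

/-- `k_{Q₃₅₆}[a^{±1}, b^{±1}, K^{±1}]`. -/
abbrev R356 := QPoly q ![0, 1, 3] 3

/-- `k_{Q₂₅₆}[a^{±1}, c^{±1}, K^{±1}]`. -/
abbrev R256 := QPoly q ![0, 2, 3] 3

/-- The quantum torus `k_{Q₅₆}[a^{±1}, b^{±1}, c^{±1}, K^{±1}]`. -/
abbrev T := QPoly q ![0, 1, 2, 3] 4

namespace R36

/-- The variable `a`. -/
abbrev a : R36 q := QuantumPolynomial.X _ _ 0
/-- The variable `b`. -/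
abbrev b : R36 q := QuantumPolynomial.X _ _ 1
/-- The variable `K`. -/
abbrev K : R36 q := QuantumPolynomial.X _ _ 2
/-- The variable `ψ`. -/
abbrev psi : R36 q := QuantumPolynomial.X _ _ 3
/-- The inverse of `a`. -/
abbrev ainv : R36 q := QuantumPolynomial.Xinv _ _ 0 (by decide)
/-- `(1 - q⁻²)⁻¹ (ψ - a⁻¹ K)`. -/
def elt : R36 q := (1 - q ^ (-2 : ℤ))⁻¹ • (psi q - ainv q * K q)

end R36

namespace R25

/-- The variable `a`. -/
abbrev a : R25 q := QuantumPolynomial.X _ _ 0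
/-- The variable `c`. -/
abbrev c : R25 q := QuantumPolynomial.X _ _ 1
/-- The variable `K`. -/
abbrev K : R25 q := QuantumPolynomial.X _ _ 2
/-- The variable `φ`. -/
abbrev phi : R25 q := QuantumPolynomial.X _ _ 3
/-- `(q⁻¹ - q)⁻¹ (φ - a)`. -/
def elt : R25 q := (q⁻¹ - q)⁻¹ • (phi q - a q)

end R25

namespace R356

/-- The variable `a`. -/
abbrev a : R356 q := QuantumPolynomial.X _ _ 0
/-- The variable `b`. -/
abbrev b : R356 q := QuantumPolynomial.X _ _ 1
/-- The variable `K`. -/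
abbrev K : R356 q := QuantumPolynomial.X _ _ 2
/-- The inverse of `a`. -/
abbrev ainv : R356 q := QuantumPolynomial.Xinv _ _ 0 (by decide)
/-- `(1 - q⁻²)⁻¹ (α b - a⁻¹ K)`. -/
def elt (α : k) : R356 q := (1 - q ^ (-2 : ℤ))⁻¹ • (α • b q - ainv q * K q)

end R356

namespace R256

/-- The variable `a`. -/
abbrev a : R256 q := QuantumPolynomial.X _ _ 0
/-- The variable `c`. -/
abbrev c : R256 q := QuantumPolynomial.X _ _ 1
/-- The variable `K`. -/
abbrev K : R256 q := QuantumPolynomial.X _ _ 2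
/-- The inverse of `K`. -/
abbrev Kinv : R256 q := QuantumPolynomial.Xinv _ _ 2 (by decide)
/-- `(q⁻¹ - q)⁻¹ (β c K⁻¹ - a)`. -/
def elt (β : k) : R256 q := (q⁻¹ - q)⁻¹ • (β • (c q * Kinv q) - a q)

end R256

namespace T

/-- The variable `a`. -/
abbrev a : T q := QuantumPolynomial.X _ _ 0
/-- The variable `b`. -/
abbrev b : T q := QuantumPolynomial.X _ _ 1
/-- The variable `c`. -/
abbrev c : T q := QuantumPolynomial.X _ _ 2
/-- The variable `K`. -/
abbrev K : T q := QuantumPolynomial.X _ _ 3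

end T

end Dq

/-! Modulo φ, the two expressions φ = (1 - q²)Fb + q²a = (q⁻¹ - q)bF + a show that b is invertible
and that F is a scalar multiple of b⁻¹a, so F can be dropped as a generator. What remains are the
invertible, mutually q-commuting a, b, K, together with c and E. These two are tied by ψ = (1 -
q⁻²)cE + a⁻¹K, an element that q-commutes with every generator. The element Θ = ψb⁻¹ is central, and
the quotient resembles a Weyl algebra in E and c whose coefficients are Laurent monomials in a, b, K
over k[Θ].

The structural claims come from a faithful model. For a commutative k-algebra C and α ∈ C, the
quantum torus `QTorus` on a, b, c, K over C receives D_q by F ↦ (q - q⁻¹)⁻¹b⁻¹a and E ↦ (1 -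
q⁻²)⁻¹c⁻¹(αb - a⁻¹K); then φ ↦ 0 and ψ ↦ αb. For D_q/(φ) one takes C = k[X] and α = X; for D_q/(φ, ψ
- αb) one takes C = k. The quotient is spanned by products of a coefficient, a Laurent monomial in
a, b, K and a power of c or of E. The torus is graded by the exponent of c, and those powers have
nonzero homogeneous images of distinct degrees, so the model is faithful
(`IsTorusRealization.injective`).

The torus is a domain because ℤ⁴ has unique sums. As q has infinite order and the commutation form
on ℤ⁴ is nondegenerate, only elements of C commute with all four variables; this gives the centre
(`IsTorusRealization.mem_center_iff`). For C = k, the same nondegeneracy lets twisted commutators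
shrink an element of an ideal to one monomial, hence to a power of c, which commutators with E lower
to 1 (`IsTorusRealization.isSimpleRing`).

Statements about ψ follow from the symmetry `IsDqSystem.mirror`, under which ψ turns into φK. The
isomorphisms with GGWAs need no bases: both sides are presented by generators and relations, and the
generators absent from one side are determined by the others (`ScaleGGWA.exists_equiv`). Finally, φ
and ψ q-commute with all generators, hence are normal and generate principal left ideals. -/

/-! ### The quantum torus as a twisted group algebra of `ℤ⁴` -/

/-- The exponents of the monomials `a ^ i * b ^ j * c ^ l * K ^ m`. -/
abbrev TorusExp := ℤ × ℤ × ℤ × ℤ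

/-- The exponent of `q` that appears when two ordered monomials are multiplied. -/
def TorusExp.twist (g h : TorusExp) : ℤ :=
  -- Moving the b, c, K of the left monomial past the a of the right one costs q⁻¹ each; moving K
  -- past b costs q, and past c costs q⁻¹.
  -(g.2.1 + g.2.2.1 + g.2.2.2) * h.1 + g.2.2.2 * h.2.1 - g.2.2.2 * h.2.2.1

/-- Biadditivity makes q to the power `twist` a 2-cocycle on ℤ⁴, which is exactly associativity of
the torus. -/
theorem TorusExp.twist_add_left (g h l : TorusExp) :
    twist (g + h) l = twist g l + twist h l := by
  simp only [twist, Prod.fst_add, Prod.snd_add]; ring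

theorem TorusExp.twist_add_right (g h l : TorusExp) :
    twist g (h + l) = twist g h + twist g l := by
  simp only [twist, Prod.fst_add, Prod.snd_add]; ring

/-- The quantum torus over a commutative `k`-algebra `C` on variables `a, b, c, K`, realised on the
free `C`-module with the ordered monomials as basis. -/
def QTorus {k : Type*} [Field k] (_q : kˣ) (C : Type*) [CommRing C] [Algebra k C] :=
  TorusExp →₀ C

namespace QTorus

variable {k : Type*} [Field k] {q : kˣ} {C : Type*} [CommRing C] [Algebra k C]

noncomputable instance : AddCommGroup (QTorus q C) :=
  inferInstanceAs (AddCommGroup (TorusExp →₀ C))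

noncomputable instance : Module C (QTorus q C) := inferInstanceAs (Module C (TorusExp →₀ C))

/-- The monomial with exponent `g` and coefficient `t`. -/
noncomputable def single (g : TorusExp) (t : C) : QTorus q C := Finsupp.single g t

/-- The coefficient at the monomial with exponent `g`. -/
def coeff (x : QTorus q C) (g : TorusExp) : C :=
  DFunLike.coe (F := TorusExp →₀ C) x g

/-- The exponents of the monomials that occur in an element. -/
def support (x : QTorus q C) : Finset TorusExp := Finsupp.support x

theorem mem_support {x : QTorus q C} {g : TorusExp} : g ∈ x.support ↔ x.coeff g ≠ 0 :=
  Finsupp.mem_support_iff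

theorem coeff_single (g h : TorusExp) (t : C) :
    (single g t : QTorus q C).coeff h = if g = h then t else 0 := by
  classical exact Finsupp.single_apply (M := C)

@[ext] theorem ext {x y : QTorus q C} (h : ∀ g, x.coeff g = y.coeff g) : x = y :=
  Finsupp.ext h

@[simp] theorem coeff_add (x y : QTorus q C) (g : TorusExp) :
    (x + y).coeff g = x.coeff g + y.coeff g := rfl

@[simp] theorem coeff_sub (x y : QTorus q C) (g : TorusExp) :
    (x - y).coeff g = x.coeff g - y.coeff g := rfl

@[simp] theorem coeff_zero (g : TorusExp) : (0 : QTorus q C).coeff g = 0 := rfl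

@[simp] theorem coeff_smul (t : C) (x : QTorus q C) (g : TorusExp) :
    (t • x).coeff g = t * x.coeff g := rfl

theorem coeff_sum {ι : Type*} (s : Finset ι) (f : ι → QTorus q C) (g : TorusExp) :
    (∑ i ∈ s, f i).coeff g = ∑ i ∈ s, (f i).coeff g :=
  Finsupp.finsetSum_apply s f g

@[elab_as_elim]
theorem induction {p : QTorus q C → Prop} (x : QTorus q C) (zero : p 0)
    (add : ∀ x y, p x → p y → p (x + y)) (single : ∀ g t, p (single g t)) : p x :=
  Finsupp.induction_linear x zero add single

theorem smul_single (s : C) (g : TorusExp) (t : C) :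
    s • (single g t : QTorus q C) = single g (s * t) := Finsupp.smul_single s g t

/-- The scalar by which the product of two ordered monomials differs from an ordered monomial. -/
def cocycle (q : kˣ) (C : Type*) [CommRing C] [Algebra k C] (g h : TorusExp) : C :=
  algebraMap k C ↑(q ^ TorusExp.twist g h)

theorem cocycle_add_left (g h l : TorusExp) :
    cocycle q C (g + h) l = cocycle q C g l * cocycle q C h l := by
  simp [cocycle, TorusExp.twist_add_left, zpow_add]

theorem cocycle_add_right (g h l : TorusExp) :
    cocycle q C g (h + l) = cocycle q C g h * cocycle q C g l := by
  simp [cocycle, TorusExp.twist_add_right, zpow_add]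

@[simp] theorem cocycle_zero_left (g : TorusExp) : cocycle q C 0 g = 1 := by
  simp [cocycle, TorusExp.twist]

@[simp] theorem cocycle_zero_right (g : TorusExp) : cocycle q C g 0 = 1 := by
  simp [cocycle, TorusExp.twist]

theorem isUnit_cocycle (g h : TorusExp) : IsUnit (cocycle q C g h) :=
  (Units.isUnit _).map (algebraMap k C)

/-- Multiplication as a bilinear map. -/
noncomputable def mulHom (q : kˣ) (C : Type*) [CommRing C] [Algebra k C] :
    (TorusExp →₀ C) →ₗ[C] (TorusExp →₀ C) →ₗ[C] (TorusExp →₀ C) :=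
  Finsupp.lift ((TorusExp →₀ C) →ₗ[C] (TorusExp →₀ C)) C TorusExp fun g =>
    Finsupp.lift (TorusExp →₀ C) C TorusExp fun h => Finsupp.single (g + h) (cocycle q C g h)

theorem mulHom_single (g h : TorusExp) (s t : C) :
    mulHom q C (Finsupp.single g s) (Finsupp.single h t) =
      Finsupp.single (g + h) (s * t * cocycle q C g h) := by
  rw [mulHom, Finsupp.lift_apply, Finsupp.sum_single_index (by simp),
    LinearMap.smul_apply, Finsupp.lift_apply, Finsupp.sum_single_index (by simp),
    Finsupp.smul_single, Finsupp.smul_single, smul_eq_mul, smul_eq_mul, mul_assoc]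

noncomputable instance : Mul (QTorus q C) := ⟨fun x y => mulHom q C x y⟩

noncomputable instance : One (QTorus q C) := ⟨single 0 1⟩

theorem one_def : (1 : QTorus q C) = single 0 1 := rfl

theorem single_mul_single (g h : TorusExp) (s t : C) :
    (single g s * single h t : QTorus q C) = single (g + h) (s * t * cocycle q C g h) :=
  mulHom_single g h s t

theorem add_mul' (x y z : QTorus q C) : (x + y) * z = x * z + y * z :=
  LinearMap.map_add₂ (mulHom q C) x y z

theorem mul_add' (x y z : QTorus q C) : x * (y + z) = x * y + x * z :=
  map_add (mulHom q C x) y z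

theorem zero_mul' (x : QTorus q C) : 0 * x = 0 := LinearMap.map_zero₂ (mulHom q C) x

theorem mul_zero' (x : QTorus q C) : x * 0 = 0 := map_zero (mulHom q C x)

noncomputable instance : Ring (QTorus q C) where
  __ := (inferInstance : AddCommGroup (QTorus q C))
  left_distrib := mul_add'
  right_distrib := add_mul'
  zero_mul := zero_mul'
  mul_zero := mul_zero'
  mul_assoc x y z := by
    induction x using induction with
    | zero => simp only [zero_mul']
    | add x x' hx hx' => simp only [add_mul', hx, hx']
    | single g s =>
    induction y using induction with
    | zero => simp only [zero_mul', mul_zero']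
    | add x x' hx hx' => simp only [add_mul', mul_add', hx, hx']
    | single h t =>
    induction z using induction with
    | zero => simp only [mul_zero']
    | add x x' hx hx' => simp only [mul_add', hx, hx']
    | single l u =>
      simp only [single_mul_single, cocycle_add_left, cocycle_add_right, add_assoc]
      congr 1; ring
  one_mul x := by
    induction x using induction with
    | zero => simp only [mul_zero']
    | add x x' hx hx' => rw [mul_add', hx, hx']
    | single g s => simp [one_def, single_mul_single]
  mul_one x := by
    induction x using induction with
    | zero => simp only [zero_mul']
    | add x x' hx hx' => rw [add_mul', hx, hx']
    | single g s => simp [one_def, single_mul_single]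

noncomputable instance : Algebra C (QTorus q C) :=
  Algebra.ofModule (fun r x y => LinearMap.map_smul₂ (mulHom q C) r x y)
    (fun r x y => map_smul (mulHom q C x) r y)

noncomputable instance : Algebra k (QTorus q C) :=
  Algebra.compHom (QTorus q C) (algebraMap k C)

instance : IsScalarTower k C (QTorus q C) := IsScalarTower.of_algebraMap_eq' rfl

theorem algebraMap_eq_single (t : C) : algebraMap C (QTorus q C) t = single 0 t := by
  rw [Algebra.algebraMap_eq_smul_one, one_def, smul_single, mul_one]

theorem field_smul_single (s : k) (g : TorusExp) (t : C) :
    s • (single g t : QTorus q C) = single g (algebraMap k C s * t) := by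
  rw [← smul_single, algebraMap_smul]

theorem coeff_field_smul (s : k) (x : QTorus q C) (g : TorusExp) :
    (s • x).coeff g = algebraMap k C s * x.coeff g := by
  rw [← algebraMap_smul C s x, coeff_smul]

theorem coeff_single_mul (g h : TorusExp) (s : C) (x : QTorus q C) :
    (single g s * x).coeff (g + h) = s * x.coeff h * cocycle q C g h := by
  induction x using induction with
  | zero => simp
  | add x y hx hy => rw [mul_add, coeff_add, hx, hy, coeff_add]; ring
  | single l t =>
    rw [single_mul_single, coeff_single, coeff_single]
    by_cases h' : l = h <;> simp [h']

theorem coeff_mul_single (g h : TorusExp) (s : C) (x : QTorus q C) :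
    (x * single g s).coeff (g + h) = s * x.coeff h * cocycle q C h g := by
  induction x using induction with
  | zero => simp
  | add x y hx hy => rw [add_mul, coeff_add, hx, hy, coeff_add]; ring
  | single l t =>
    rw [single_mul_single, coeff_single, coeff_single, add_comm l g]
    by_cases h' : l = h <;> simp [h', mul_comm]

theorem eq_sum_single (x : QTorus q C) : x = ∑ g ∈ x.support, single g (x.coeff g) :=
  (Finsupp.sum_single x).symm

theorem support_nonempty {x : QTorus q C} : x.support.Nonempty ↔ x ≠ 0 := by
  exact Finsupp.support_nonempty_iff (M := C)

theorem coeff_mul_of_uniqueAdd {x y : QTorus q C} {g h : TorusExp} (hg : g ∈ x.support)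
    (hh : h ∈ y.support) (H : UniqueAdd x.support y.support g h) :
    (x * y).coeff (g + h) = x.coeff g * y.coeff h * cocycle q C g h := by
  conv_lhs => rw [eq_sum_single x, eq_sum_single y, Finset.sum_mul_sum]
  rw [coeff_sum, Finset.sum_eq_single_of_mem g hg, coeff_sum, Finset.sum_eq_single_of_mem h hh]
  · rw [single_mul_single, coeff_single, if_pos rfl]
  · intro h' hh' hne
    rw [single_mul_single, coeff_single, if_neg]
    exact fun e => hne (H hg hh' e).2
  · intro g' hg' hne
    rw [coeff_sum]
    refine Finset.sum_eq_zero fun h' hh' => ?_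
    rw [single_mul_single, coeff_single, if_neg]
    exact fun e => hne (H hg' hh' e).1

/-- In ℤ⁴ any two nonempty finite sets have a sum attained only once. At that exponent the
coefficient of the product is a product of two nonzero coefficients and a unit. -/
instance [IsDomain C] : NoZeroDivisors (QTorus q C) where
  eq_zero_or_eq_zero_of_mul_eq_zero {x y} hxy := by
    contrapose! hxy
    obtain ⟨g, hg, h, hh, H⟩ := UniqueSums.uniqueAdd_of_nonempty
      (support_nonempty.2 hxy.1) (support_nonempty.2 hxy.2)
    intro h0
    have := coeff_mul_of_uniqueAdd hg hh H
    rw [h0, coeff_zero] at this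
    exact mul_ne_zero (mul_ne_zero (mem_support.1 hg) (mem_support.1 hh))
      (isUnit_cocycle g h).ne_zero this.symm

instance [Nontrivial C] : Nontrivial (QTorus q C) :=
  ⟨1, 0, fun h => one_ne_zero (α := C) <| by
    simpa [one_def, coeff_single] using congrArg (fun x => coeff x 0) h⟩

/-! #### The grading by the exponent of `c` -/

/-- Elements all of whose monomials have `c`-exponent `d`. -/
def IsHomog (d : ℤ) (x : QTorus q C) : Prop := ∀ g, x.coeff g ≠ 0 → g.2.2.1 = d

theorem IsHomog.single (g : TorusExp) (t : C) : IsHomog g.2.2.1 (single g t : QTorus q C) := by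
  intro h hh
  rw [coeff_single] at hh
  by_cases e : g = h
  · rw [e]
  · simp [e] at hh

theorem IsHomog.zero (d : ℤ) : IsHomog d (0 : QTorus q C) := fun _ hg => absurd rfl hg

theorem IsHomog.add {d : ℤ} {x y : QTorus q C} (hx : IsHomog d x) (hy : IsHomog d y) :
    IsHomog d (x + y) := by
  intro g hg
  by_cases h : x.coeff g = 0
  · exact hy g (by simpa [h] using hg)
  · exact hx g h

theorem IsHomog.smul {d : ℤ} {x : QTorus q C} (t : C) (hx : IsHomog d x) :
    IsHomog d (t • x) :=
  fun g hg => hx g fun h => hg (by simp [h])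

theorem IsHomog.sum {ι : Type*} {d : ℤ} (s : Finset ι) (f : ι → QTorus q C)
    (h : ∀ i ∈ s, IsHomog d (f i)) : IsHomog d (∑ i ∈ s, f i) :=
  Finset.sum_induction f (IsHomog d) (fun _ _ => IsHomog.add) (IsHomog.zero d) h

theorem IsHomog.mul {d e : ℤ} {x y : QTorus q C} (hx : IsHomog d x) (hy : IsHomog e y) :
    IsHomog (d + e) (x * y) := by
  rw [eq_sum_single x, eq_sum_single y, Finset.sum_mul_sum]
  refine IsHomog.sum _ _ fun g hg => IsHomog.sum _ _ fun h hh => ?_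
  rw [single_mul_single]
  have := IsHomog.single (q := q) (g + h) (x.coeff g * y.coeff h * cocycle q C g h)
  rwa [Prod.snd_add, Prod.snd_add, Prod.fst_add, hx g (mem_support.1 hg),
    hy h (mem_support.1 hh)] at this

theorem IsHomog.pow {d : ℤ} {x : QTorus q C} (hx : IsHomog d x) (n : ℕ) :
    IsHomog (n * d) (x ^ n) := by
  induction n with
  | zero =>
    rw [pow_zero, one_def, Nat.cast_zero, zero_mul]
    exact IsHomog.single 0 1
  | succ n ih =>
    rw [pow_succ]
    convert ih.mul hx using 1
    push_cast; ring

/-- Elements of different degrees have disjoint supports, so no cancellation can occur between them.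
-/
theorem eq_zero_of_sum_isHomog {s : Finset ℤ} {x : ℤ → QTorus q C} (hx : ∀ d, IsHomog d (x d))
    (h : ∑ d ∈ s, x d = 0) {d : ℤ} (hd : d ∈ s) : x d = 0 := by
  ext g
  by_contra hg
  rw [coeff_zero] at hg
  have := congrArg (fun x => coeff x g) h
  simp only [coeff_sum, coeff_zero] at this
  rw [Finset.sum_eq_single_of_mem d hd] at this
  · exact hg this
  · intro e _ hne
    by_contra he
    exact hne ((hx e g he).symm.trans (hx d g hg))

/-! #### Commutation -/

/-- The exponent of `q` in the commutation relation of two monomials. -/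
def comm (g h : TorusExp) : ℤ := TorusExp.twist g h - TorusExp.twist h g

/-- The commutation form is nondegenerate. -/
theorem comm_injective {g h : TorusExp} (ha : comm (1, 0, 0, 0) g = comm (1, 0, 0, 0) h)
    (hb : comm (0, 1, 0, 0) g = comm (0, 1, 0, 0) h)
    (hc : comm (0, 0, 1, 0) g = comm (0, 0, 1, 0) h)
    (hK : comm (0, 0, 0, 1) g = comm (0, 0, 0, 1) h) : g = h := by
  obtain ⟨i, j, l, m⟩ := g
  obtain ⟨i', j', l', m'⟩ := h
  simp only [comm, TorusExp.twist] at ha hb hc hK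
  simp only [Prod.mk.injEq]
  -- With g = (i, j, l, m) the four forms are j + l + m, -i - m, m - i and j - l - i. The middle two
  -- give i and m, and the others then give j and l, in each case after division by 2, which is
  -- harmless over ℤ.
  omega

/-- The twisted commutator of a monomial with `x`, made to vanish at the exponent `h`. -/
theorem coeff_twisted_commutator (g h l : TorusExp) (x : QTorus q C) :
    (single g 1 * x - ((q ^ comm g h : kˣ) : k) • (x * single g 1)).coeff (g + l) =
      (cocycle q C g l - algebraMap k C ↑(q ^ comm g h) * cocycle q C l g) * x.coeff l := by
  rw [coeff_sub, coeff_field_smul, coeff_single_mul, coeff_mul_single]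
  ring

theorem zpow_injective (hq : ∀ n : ℕ, 0 < n → (q : k) ^ n ≠ 1) {m n : ℤ} (h : q ^ m = q ^ n) :
    m = n := by
  have key : ∀ j : ℤ, q ^ j = 1 → j = 0 := by
    intro j hj
    by_contra hne
    refine hq j.natAbs (Int.natAbs_pos.2 hne) ?_
    have : q ^ j.natAbs = 1 := by
      rcases Int.natAbs_eq j with h | h
      · rw [h, zpow_natCast] at hj; exact hj
      · rw [h, zpow_neg, zpow_natCast, inv_eq_one] at hj; exact hj
    rw [← Units.val_pow_eq_pow_val, this, Units.val_one]
  have := key (m - n) (by rw [zpow_sub, h, mul_inv_cancel])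
  omega

/-- Both terms are powers of q, and q has infinite order, so their equality is an equality of
exponents. -/
theorem cocycle_sub_eq_zero_iff [Nontrivial C] (hq : ∀ n : ℕ, 0 < n → (q : k) ^ n ≠ 1)
    (g h l : TorusExp) :
    cocycle q C g l - algebraMap k C ↑(q ^ comm g h) * cocycle q C l g = 0 ↔
      comm g l = comm g h := by
  rw [cocycle, cocycle, ← map_mul, sub_eq_zero, (algebraMap k C).injective.eq_iff,
    ← Units.val_mul, Units.val_inj, ← zpow_add]
  refine ⟨fun h' => ?_, fun h' => ?_⟩
  · have := zpow_injective hq h'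
    simp only [comm] at this ⊢
    omega
  · congr 1
    simp only [comm] at h' ⊢
    omega

/-- An element commuting with the four variables is a scalar. -/
theorem eq_algebraMap_of_commute [IsDomain C] (hq : ∀ n : ℕ, 0 < n → (q : k) ^ n ≠ 1)
    {x : QTorus q C} (ha : Commute (single (1, 0, 0, 0) 1) x)
    (hb : Commute (single (0, 1, 0, 0) 1) x) (hc : Commute (single (0, 0, 1, 0) 1) x)
    (hK : Commute (single (0, 0, 0, 1) 1) x) : x = algebraMap C _ (x.coeff 0) := by
  have key : ∀ g l, Commute (single g 1) x → x.coeff l ≠ 0 → comm g l = comm g 0 := by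
    intro g l hg hl
    -- With second exponent 0 the twist is trivial, so the twisted commutator is the ordinary one
    -- and vanishes.
    have := coeff_twisted_commutator g 0 l x
    rw [show comm g 0 = 0 by simp [comm, TorusExp.twist], zpow_zero, Units.val_one, one_smul,
      hg.eq, sub_self, coeff_zero, eq_comm, mul_eq_zero] at this
    refine (cocycle_sub_eq_zero_iff (C := C) hq g 0 l).1 ?_
    rw [show comm g 0 = 0 by simp [comm, TorusExp.twist], zpow_zero, Units.val_one]
    exact this.resolve_right hl
  rw [algebraMap_eq_single]
  ext l
  rw [coeff_single]
  split_ifs with h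
  · rw [h]
  · by_contra hl
    exact h (comm_injective (key _ l ha hl) (key _ l hb hl) (key _ l hc hl) (key _ l hK hl)).symm

end QTorus

/-! ### Elements that commute up to a scalar -/

/-- `x * y = s • (y * x)`. -/
def QComm {k A : Type*} [Field k] [Ring A] [Algebra k A] (s : k) (x y : A) : Prop :=
  x * y = s • (y * x)

namespace QComm

variable {k A B : Type*} [Field k] [Ring A] [Algebra k A] [Ring B] [Algebra k B] {s t : k}
  {x y z x' y' : A}

theorem eq (h : QComm s x y) : x * y = s • (y * x) := h

theorem congr (h : QComm s x y) (e : s = t) : QComm t x y := e ▸ h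

theorem refl (x : A) : QComm (1 : k) x x := by rw [QComm, one_smul]

theorem map (f : A →ₐ[k] B) (h : QComm s x y) : QComm s (f x) (f y) := by
  rw [QComm, ← map_mul, h.eq, map_smul, map_mul]

theorem mul_left (hx : QComm s x z) (hy : QComm t y z) : QComm (s * t) (x * y) z := by
  rw [QComm, mul_assoc, hy.eq, mul_smul_comm, ← mul_assoc, hx.eq, smul_mul_assoc, smul_smul,
    mul_comm t s, mul_assoc]

theorem mul_right (hy : QComm s x y) (hz : QComm t x z) : QComm (s * t) x (y * z) := by
  rw [QComm, ← mul_assoc, hy.eq, smul_mul_assoc, mul_assoc, hz.eq, mul_smul_comm, smul_smul,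
    ← mul_assoc]

theorem symm (hs : s ≠ 0) (h : QComm s x y) : QComm s⁻¹ y x := by
  rw [QComm, h.eq, smul_smul, inv_mul_cancel₀ hs, one_smul]

theorem inv_left (hs : s ≠ 0) (h : x * x' = 1) (h' : x' * x = 1) (hxy : QComm s x y) :
    QComm s⁻¹ x' y := by
  have e : y * x = s⁻¹ • (x * y) := (hxy.symm hs).eq
  calc x' * y = x' * (y * x) * x' := by rw [mul_assoc, mul_assoc y, h, mul_one]
    _ = s⁻¹ • (y * x') := by
      rw [e, mul_smul_comm, smul_mul_assoc, ← mul_assoc, h', one_mul]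

theorem inv_right (hs : s ≠ 0) (h : y * y' = 1) (h' : y' * y = 1) (hxy : QComm s x y) :
    QComm s⁻¹ x y' := by
  simpa using ((hxy.symm hs).inv_left (inv_ne_zero hs) h h').symm (inv_ne_zero (inv_ne_zero hs))

theorem smul_left (r : k) (h : QComm s x y) : QComm s (r • x) y := by
  rw [QComm, smul_mul_assoc, h.eq, mul_smul_comm, smul_comm]

theorem smul_right (r : k) (h : QComm s x y) : QComm s x (r • y) := by
  rw [QComm, smul_mul_assoc, mul_smul_comm, h.eq, smul_comm]

theorem add_right (hy : QComm s x y) (hz : QComm s x z) : QComm s x (y + z) := by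
  rw [QComm, add_mul, mul_add, hy.eq, hz.eq, smul_add]

theorem sub_left (hx : QComm s x z) (hy : QComm s y z) : QComm s (x - y) z := by
  rw [QComm, sub_mul, mul_sub, hx.eq, hy.eq, smul_sub]

theorem sub_right (hy : QComm s x y) (hz : QComm s x z) : QComm s x (y - z) := by
  rw [QComm, sub_mul, mul_sub, hy.eq, hz.eq, smul_sub]

theorem commute (h : QComm (1 : k) x y) : Commute x y := by
  have := h.eq
  rwa [one_smul] at this

theorem of_commute (h : Commute x y) : QComm (1 : k) x y := by
  rw [QComm, one_smul, h.eq]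

end QComm

/-! ### Systems of elements satisfying the relations of `D_q` -/

section Systems

variable {k A B : Type*} [Field k] [Ring A] [Algebra k A] [Ring B] [Algebra k B]

/-- The relations of `D_q` that do not involve `F`. -/
structure IsEcSystem (q : k) (a ainv b c K Kinv E : A) : Prop where
  a_ainv : a * ainv = 1
  ainv_a : ainv * a = 1
  K_Kinv : K * Kinv = 1
  Kinv_K : Kinv * K = 1
  ab : QComm q a b
  ac : QComm q a c
  bc : QComm (1 : k) b c
  Ka : QComm q⁻¹ K a
  Kb : QComm q K b
  Kc : QComm q⁻¹ K c
  KE : QComm (q ^ 2) K E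
  Ea : QComm (1 : k) E a
  Eb : QComm (1 : k) E b
  Ec : E * c = c * E + ainv * K

/-- The relations of `D_q`. -/
structure IsDqSystem (q : k) (a ainv b c K Kinv E F : A) : Prop
    extends IsEcSystem q a ainv b c K Kinv E where
  KF : QComm (q ^ (-2 : ℤ)) K F
  EF : QComm (1 : k) E F
  Fa : QComm q F a
  Fb : F * b = q⁻¹ • (b * F) + a
  Fc : QComm q F c

/-- The relations of `D_q` that do not involve `F`, with `b` invertible. -/
structure IsPhiSystem (q : k) (a ainv b binv c K Kinv E : A) : Prop
    extends IsEcSystem q a ainv b c K Kinv E where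
  b_binv : b * binv = 1
  binv_b : binv * b = 1

/-- The expression of `φ` in the generators. -/
def phiElt (q : k) (a b F : A) : A := (1 - q ^ 2) • (F * b) + q ^ 2 • a

/-- The expression of `ψ` in the generators. -/
def psiElt (q : k) (ainv c K E : A) : A :=
  (1 - q ^ (-2 : ℤ)) • (E * c) + q ^ (-2 : ℤ) • (ainv * K)

variable {q : k} {a ainv b binv c K Kinv E F : A}

theorem IsEcSystem.map (h : IsEcSystem q a ainv b c K Kinv E) (f : A →ₐ[k] B) :
    IsEcSystem q (f a) (f ainv) (f b) (f c) (f K) (f Kinv) (f E) where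
  a_ainv := by rw [← map_mul, h.a_ainv, map_one]
  ainv_a := by rw [← map_mul, h.ainv_a, map_one]
  K_Kinv := by rw [← map_mul, h.K_Kinv, map_one]
  Kinv_K := by rw [← map_mul, h.Kinv_K, map_one]
  ab := h.ab.map f
  ac := h.ac.map f
  bc := h.bc.map f
  Ka := h.Ka.map f
  Kb := h.Kb.map f
  Kc := h.Kc.map f
  KE := h.KE.map f
  Ea := h.Ea.map f
  Eb := h.Eb.map f
  Ec := by rw [← map_mul, h.Ec, map_add, map_mul, map_mul]

theorem IsDqSystem.map (h : IsDqSystem q a ainv b c K Kinv E F) (f : A →ₐ[k] B) :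
    IsDqSystem q (f a) (f ainv) (f b) (f c) (f K) (f Kinv) (f E) (f F) where
  __ := h.toIsEcSystem.map f
  KF := h.KF.map f
  EF := h.EF.map f
  Fa := h.Fa.map f
  Fb := by rw [← map_mul, h.Fb, map_add, map_smul, map_mul]
  Fc := h.Fc.map f

theorem map_phiElt (f : A →ₐ[k] B) (q : k) (a b F : A) :
    f (phiElt q a b F) = phiElt q (f a) (f b) (f F) := by
  simp only [phiElt, map_add, map_smul, map_mul]

theorem map_psiElt (f : A →ₐ[k] B) (q : k) (ainv c K E : A) :
    f (psiElt q ainv c K E) = psiElt q (f ainv) (f c) (f K) (f E) := by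
  simp only [psiElt, map_add, map_smul, map_mul]

/-- The symmetry of the relations that exchanges `b` and `c` and inverts `q`. -/
theorem IsDqSystem.mirror (hq : q ≠ 0) (h : IsDqSystem q a ainv b c K Kinv E F) :
    IsDqSystem q⁻¹ ainv a c b K Kinv (q⁻¹ • (F * K)) (q⁻¹ • (E * Kinv)) where
  a_ainv := h.ainv_a
  ainv_a := h.a_ainv
  K_Kinv := h.K_Kinv
  Kinv_K := h.Kinv_K
  ab := h.ac.inv_left hq h.a_ainv h.ainv_a
  ac := h.ab.inv_left hq h.a_ainv h.ainv_a
  bc := (h.bc.symm one_ne_zero).congr inv_one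
  Ka := h.Ka.inv_right (inv_ne_zero hq) h.a_ainv h.ainv_a
  Kb := h.Kc
  Kc := h.Kb.congr (inv_inv q).symm
  KE := ((h.KF.mul_right (QComm.refl K)).smul_right _).congr (by simp [zpow_neg])
  Ea := (((h.Fa.inv_right hq h.a_ainv h.ainv_a).mul_left
    (h.Ka.inv_right (inv_ne_zero hq) h.a_ainv h.ainv_a)).smul_left _).congr (by field_simp)
  Eb := ((h.Fc.mul_left h.Kc).smul_left _).congr (by field_simp)
  Ec := by
    rw [smul_mul_assoc, mul_assoc, h.Kb.eq, mul_smul_comm, ← mul_assoc, h.Fb, add_mul,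
      smul_mul_assoc, smul_smul, inv_mul_cancel₀ hq, one_smul, mul_smul_comm, mul_assoc]
  KF := ((h.KE.mul_right ((QComm.refl K).inv_right one_ne_zero h.K_Kinv h.Kinv_K)).smul_right
    _).congr (by simp [zpow_neg])
  EF := by
    refine ((((h.EF.symm one_ne_zero).mul_right
      (h.KF.symm (zpow_ne_zero _ hq) |>.inv_right (inv_ne_zero (zpow_ne_zero _ hq)) h.K_Kinv
        h.Kinv_K)).mul_left (h.KE.mul_right ((QComm.refl K).inv_right one_ne_zero h.K_Kinv
          h.Kinv_K))).smul_left _ |>.smul_right _).congr ?_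
    simp [zpow_neg]
    field_simp
  Fa := ((((h.Ea.mul_left (h.Ka.inv_left (inv_ne_zero hq) h.K_Kinv h.Kinv_K)).smul_left
    q⁻¹).inv_right (by simpa using hq) h.a_ainv h.ainv_a)).congr (by simp)
  Fb := by
    have e := (h.Kc.inv_left (inv_ne_zero hq) h.K_Kinv h.Kinv_K).eq
    rw [inv_inv] at e
    rw [smul_mul_assoc, mul_assoc, e, mul_smul_comm, ← mul_assoc, h.Ec, add_mul, smul_smul,
      inv_mul_cancel₀ hq, one_smul, mul_assoc ainv, h.K_Kinv, mul_one, inv_inv, mul_smul_comm,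
      smul_smul, mul_inv_cancel₀ hq, one_smul, mul_assoc]
  Fc := ((h.Eb.mul_left (h.Kb.inv_left hq h.K_Kinv h.Kinv_K)).smul_left _).congr (by simp)

/-- In (q⁻¹FK)b, moving K past b gives a factor q that cancels q⁻¹, and q⁻² becomes q² when q is
inverted. This is how facts about ψ become facts about φ. -/
theorem psiElt_mirror (hq : q ≠ 0) (hKb : QComm q K b) :
    psiElt q⁻¹ a b K (q⁻¹ • (F * K)) = phiElt q a b F * K := by
  rw [psiElt, phiElt, smul_mul_assoc, mul_assoc, hKb.eq, mul_smul_comm,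
    inv_smul_smul₀ hq, add_mul, smul_mul_assoc, smul_mul_assoc, mul_assoc]
  simp [zpow_neg]

/-- Applying the symmetry a second time returns E, so the previous identity for the mirrored system
yields ψ itself. -/
theorem IsDqSystem.phiElt_mirror (hq : q ≠ 0) (h : IsDqSystem q a ainv b c K Kinv E F) :
    phiElt q⁻¹ ainv c (q⁻¹ • (E * Kinv)) * K = psiElt q ainv c K E := by
  have := psiElt_mirror (inv_ne_zero hq) (h.mirror hq).Kb (F := q⁻¹ • (E * Kinv)) (a := ainv)
  rw [← this, smul_mul_assoc, smul_smul, mul_assoc, h.Kinv_K, mul_one, inv_inv,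
    mul_inv_cancel₀ hq, one_smul]

/-! ### Commutation of ψ and φ with the generators -/

namespace IsEcSystem

/-- Exchanging E and c produces one a⁻¹K, and (1 - q⁻²) + q⁻² = 1. Having ψ with either order of E
and c is what makes it q-commute with both. -/
theorem psiElt_eq (h : IsEcSystem q a ainv b c K Kinv E) :
    psiElt q ainv c K E = (1 - q ^ (-2 : ℤ)) • (c * E) + ainv * K := by
  rw [psiElt, h.Ec, smul_add, add_assoc, ← add_smul, sub_add_cancel, one_smul]

variable (hq : q ≠ 0) (h : IsEcSystem q a ainv b c K Kinv E)
include hq h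

theorem a_psiElt : QComm q a (psiElt q ainv c K E) := by
  rw [h.psiElt_eq]
  refine (((h.ac.mul_right (h.Ea.symm one_ne_zero)).smul_right _).congr (by simp)).add_right ?_
  exact (((QComm.refl a).inv_right one_ne_zero h.a_ainv h.ainv_a).mul_right
    (h.Ka.symm (inv_ne_zero hq))).congr (by simp)

theorem b_psiElt : QComm (1 : k) b (psiElt q ainv c K E) := by
  rw [h.psiElt_eq]
  refine (((h.bc.mul_right (h.Eb.symm one_ne_zero)).smul_right _).congr (by simp)).add_right ?_
  exact (((h.ab.symm hq).inv_right (inv_ne_zero hq) h.a_ainv h.ainv_a).mul_right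
    (h.Kb.symm hq)).congr (by simp [hq])

/-- Expanding ψ with Ec on one side and with cE on the other makes both cubic terms equal to cEc;
the remaining terms agree because c and a⁻¹K commute up to q². The same device handles E with ψ and
F with φ. -/
theorem c_psiElt : QComm (1 : k) c (psiElt q ainv c K E) := by
  have e : QComm (q ^ 2) c (ainv * K) := (((h.ac.symm hq).inv_right (inv_ne_zero hq) h.a_ainv
    h.ainv_a).mul_right (h.Kc.symm (inv_ne_zero hq))).congr (by simp [sq])
  rw [QComm, one_smul]
  conv_rhs => rw [h.psiElt_eq]
  rw [psiElt, mul_add, add_mul, mul_smul_comm, mul_smul_comm, smul_mul_assoc, e.eq, smul_smul,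
    mul_assoc]
  simp [zpow_neg, hq, mul_assoc]

theorem K_psiElt : QComm q K (psiElt q ainv c K E) := by
  rw [h.psiElt_eq]
  refine (((h.Kc.mul_right h.KE).smul_right _).congr (by field_simp)).add_right ?_
  exact ((h.Ka.inv_right (inv_ne_zero hq) h.a_ainv h.ainv_a).mul_right
    (QComm.refl K)).congr (by simp)

theorem E_ainvK : QComm (q ^ (-2 : ℤ)) E (ainv * K) :=
  ((h.Ea.inv_right one_ne_zero h.a_ainv h.ainv_a).mul_right
    (h.KE.symm (pow_ne_zero 2 hq))).congr (by simp [zpow_neg])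

theorem E_psiElt : QComm (1 : k) E (psiElt q ainv c K E) := by
  rw [QComm, one_smul]
  conv_lhs => rw [h.psiElt_eq]
  rw [psiElt, mul_add, add_mul, mul_smul_comm, smul_mul_assoc, (h.E_ainvK hq).eq, smul_mul_assoc]
  simp only [mul_assoc]

end IsEcSystem

namespace IsDqSystem

variable (hq : q ≠ 0) (h : IsDqSystem q a ainv b c K Kinv E F)
include hq h

theorem F_psiElt : QComm q F (psiElt q ainv c K E) := by
  rw [h.psiElt_eq]
  refine (((h.Fc.mul_right (h.EF.symm one_ne_zero)).smul_right _).congr (by simp)).add_right ?_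
  refine ((h.Fa.inv_right hq h.a_ainv h.ainv_a).mul_right
    (h.KF.symm (zpow_ne_zero _ hq))).congr ?_
  simp [zpow_neg]
  field_simp

/-- Exhibits φ as the mirrored ψ times K⁻¹, so that its commutation with a, b, c and K is inherited
from ψ. -/
theorem phiElt_eq_mul : phiElt q a b F = psiElt q⁻¹ a b K (q⁻¹ • (F * K)) * Kinv := by
  rw [psiElt_mirror hq h.Kb, mul_assoc, h.K_Kinv, mul_one]

theorem phiElt_eq : phiElt q a b F = (q⁻¹ - q) • (b * F) + a := by
  rw [phiElt, h.Fb, smul_add, smul_smul, add_assoc, ← add_smul, sub_add_cancel, one_smul,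
    sub_mul, one_mul, sq, mul_assoc, mul_inv_cancel₀ hq, mul_one]

theorem a_phiElt : QComm (1 : k) a (phiElt q a b F) := by
  rw [h.phiElt_eq_mul hq]
  exact ((((h.mirror hq).a_psiElt (inv_ne_zero hq)).inv_left (inv_ne_zero hq) h.ainv_a
    h.a_ainv).mul_right ((h.Ka.symm (inv_ne_zero hq)).inv_right (by simpa using hq) h.K_Kinv
      h.Kinv_K)).congr (by simp [hq])

theorem b_phiElt : QComm q b (phiElt q a b F) := by
  rw [h.phiElt_eq_mul hq]
  exact (((h.mirror hq).c_psiElt (inv_ne_zero hq)).mul_right ((h.Kb.symm hq).inv_right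
    (inv_ne_zero hq) h.K_Kinv h.Kinv_K)).congr (by simp)

theorem c_phiElt : QComm q⁻¹ c (phiElt q a b F) := by
  rw [h.phiElt_eq_mul hq]
  exact (((h.mirror hq).b_psiElt (inv_ne_zero hq)).mul_right ((h.Kc.symm
    (inv_ne_zero hq)).inv_right (by simpa using hq) h.K_Kinv h.Kinv_K)).congr (by simp)

theorem K_phiElt : QComm q⁻¹ K (phiElt q a b F) := by
  rw [h.phiElt_eq_mul hq]
  exact (((h.mirror hq).K_psiElt (inv_ne_zero hq)).mul_right ((QComm.refl K).inv_right
    one_ne_zero h.K_Kinv h.Kinv_K)).congr (by simp)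

theorem F_phiElt : QComm q⁻¹ F (phiElt q a b F) := by
  have e : QComm q⁻¹ F (phiElt q a b F) ↔
      F * phiElt q a b F = q⁻¹ • (phiElt q a b F * F) := Iff.rfl
  rw [e]
  conv_lhs => rw [h.phiElt_eq hq]
  rw [phiElt, mul_add, add_mul, mul_smul_comm, smul_mul_assoc, h.Fa.eq, smul_mul_assoc, smul_add,
    smul_smul, smul_smul, mul_assoc]
  congr 2 <;> field_simp

theorem E_phiElt : QComm (1 : k) E (phiElt q a b F) := by
  rw [h.phiElt_eq hq]
  refine (((h.Eb.mul_right h.EF).smul_right _).congr (by simp)).add_right h.Ea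

end IsDqSystem

/-! ### Systems in which φ vanishes -/

/-- The form of φ containing bF yields a right inverse of b. The form containing Fb, after moving
a⁻¹ past b, shows that the same element is a left inverse. -/
theorem isPhiSystem_of_phiElt_eq_zero (hq : q ≠ 0) (hq2 : q ^ 2 ≠ 1)
    (h : IsDqSystem q a ainv b c K Kinv E F) (h0 : phiElt q a b F = 0) :
    IsPhiSystem q a ainv b ((q - q⁻¹) • (F * ainv)) c K Kinv E where
  __ := h.toIsEcSystem
  b_binv := by
    rw [h.phiElt_eq hq, add_comm] at h0
    rw [mul_smul_comm, ← mul_assoc, ← smul_mul_assoc, ← neg_sub q⁻¹ q, neg_smul,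
      ← eq_neg_of_add_eq_zero_left h0, h.a_ainv]
  binv_b := by
    rw [phiElt, add_comm] at h0
    have e := (h.ab.inv_left hq h.a_ainv h.ainv_a).eq
    have e2 : F * b = ((q ^ 2 - 1)⁻¹ * q ^ 2) • a := by
      rw [mul_smul, eq_neg_of_add_eq_zero_left h0, ← neg_smul, neg_sub, smul_smul,
        inv_mul_cancel₀ (sub_ne_zero.2 hq2), one_smul]
    rw [smul_mul_assoc, mul_assoc, e, mul_smul_comm, ← mul_assoc, e2, smul_mul_assoc, h.a_ainv,
      smul_smul, smul_smul]
    have := sub_ne_zero.2 hq2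
    convert one_smul k (1 : A) using 2
    field_simp

/-- In a system with `b` invertible there is a unique choice of `F` with `φ = 0`. -/
theorem IsPhiSystem.isDqSystem (hq : q ≠ 0) (hq2 : q ^ 2 ≠ 1)
    (h : IsPhiSystem q a ainv b binv c K Kinv E) :
    IsDqSystem q a ainv b c K Kinv E ((q - q⁻¹)⁻¹ • (binv * a)) where
  __ := h.toIsEcSystem
  KF := (((h.Kb.inv_right hq h.b_binv h.binv_b).mul_right h.Ka).smul_right _).congr
    (by simp [zpow_neg, sq])
  EF := (((h.Eb.inv_right one_ne_zero h.b_binv h.binv_b).mul_right h.Ea).smul_right _).congr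
    (by simp)
  Fa := (((((h.ab.symm hq).inv_left (inv_ne_zero hq) h.b_binv h.binv_b).mul_left
    (QComm.refl a))).smul_left _).congr (by simp)
  Fb := by
    rw [smul_mul_assoc, mul_assoc, h.ab.eq, mul_smul_comm, ← mul_assoc, h.binv_b, one_mul,
      mul_smul_comm, ← mul_assoc, h.b_binv, one_mul, smul_smul, smul_smul]
    nth_rewrite 3 [← one_smul k a]
    rw [← add_smul]
    congr 1
    have : q - q⁻¹ ≠ 0 := by
      intro e
      apply hq2
      field_simp at e
      linear_combination e
    field_simp
    ring
  Fc := (((h.bc.inv_left one_ne_zero h.b_binv h.binv_b).mul_left h.ac).smul_left _).congr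
    (by simp)

theorem IsPhiSystem.phiElt_eq_zero (hq : q ≠ 0) (hq2 : q ^ 2 ≠ 1)
    (h : IsPhiSystem q a ainv b binv c K Kinv E) :
    phiElt q a b ((q - q⁻¹)⁻¹ • (binv * a)) = 0 := by
  rw [(h.isDqSystem hq hq2).phiElt_eq hq, mul_smul_comm, ← mul_assoc, h.b_binv, one_mul, smul_smul]
  nth_rewrite 2 [← one_smul k a]
  rw [← add_smul]
  have : q - q⁻¹ ≠ 0 := by
    intro e
    apply hq2
    field_simp at e
    linear_combination e
  rw [← neg_sub q q⁻¹, neg_mul, mul_inv_cancel₀ this, neg_add_cancel, zero_smul]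

/-- In a quantum torus on `a, b, c, K` a system is obtained from a central element. -/
theorem isPhiSystem_of_torus {cinv t : A} (hq : q ≠ 0) (hq2 : q ^ 2 ≠ 1) (a_ainv : a * ainv = 1)
    (ainv_a : ainv * a = 1) (b_binv : b * binv = 1) (binv_b : binv * b = 1)
    (c_cinv : c * cinv = 1) (cinv_c : cinv * c = 1)
    (K_Kinv : K * Kinv = 1) (Kinv_K : Kinv * K = 1) (ab : QComm q a b)
    (ac : QComm q a c) (bc : QComm (1 : k) b c) (Ka : QComm q⁻¹ K a) (Kb : QComm q K b)
    (Kc : QComm q⁻¹ K c) (ht : ∀ x, Commute x t) :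
    IsPhiSystem q a ainv b binv c K Kinv
      ((1 - q ^ (-2 : ℤ))⁻¹ • (cinv * (t * b - ainv * K))) where
  a_ainv := a_ainv
  ainv_a := ainv_a
  K_Kinv := K_Kinv
  Kinv_K := Kinv_K
  b_binv := b_binv
  binv_b := binv_b
  ab := ab
  ac := ac
  bc := bc
  Ka := Ka
  Kb := Kb
  Kc := Kc
  KE := by
    refine (((Kc.inv_right (inv_ne_zero hq) c_cinv cinv_c).mul_right (s := q⁻¹⁻¹) (t := q)
      (QComm.sub_right ?_ ?_)).smul_right _).congr (by rw [inv_inv, sq])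
    · exact ((QComm.of_commute (ht K)).mul_right Kb).congr (one_mul q)
    · exact ((Ka.inv_right (inv_ne_zero hq) a_ainv ainv_a).mul_right (QComm.refl K)).congr
        (by simp)
  Ea := by
    refine QComm.congr (((ac.symm hq).inv_left (inv_ne_zero hq) c_cinv cinv_c |>.mul_left
      (t := q⁻¹) (QComm.sub_left ?_ ?_)).smul_left _) (by simp [hq])
    · exact ((QComm.of_commute (ht a).symm).mul_left (ab.symm hq)).congr (one_mul _)
    · exact (((QComm.refl a).inv_left one_ne_zero a_ainv ainv_a).mul_left Ka).congr (by simp)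
  Eb := by
    refine QComm.congr (((bc.symm one_ne_zero).inv_left (inv_ne_zero one_ne_zero) c_cinv
      cinv_c |>.mul_left (t := 1) (QComm.sub_left ?_ ?_)).smul_left _) (by simp)
    · exact ((QComm.of_commute (ht b).symm).mul_left (QComm.refl b)).congr (one_mul _)
    · exact ((ab.inv_left hq a_ainv ainv_a).mul_left Kb).congr (by simp [hq])
  -- Here tb commutes with c while a⁻¹K passes it with factor q⁻², so Ec - cE retains (1 - q⁻²)a⁻¹K,
  -- and the scalar in front of E cancels that factor.
  Ec := by
    have e : QComm (1 : k) (t * b) c :=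
      ((QComm.of_commute (ht c).symm).mul_left bc).congr (one_mul _)
    have e' : QComm (q ^ (-2 : ℤ)) (ainv * K) c :=
      ((ac.inv_left hq a_ainv ainv_a).mul_left Kc).congr (by simp [zpow_neg, sq])
    have hne : (1 - q ^ (-2 : ℤ)) ≠ 0 := by
      intro h
      apply hq2
      simp [zpow_neg] at h
      field_simp at h
      linear_combination h
    rw [smul_mul_assoc, mul_smul_comm, mul_assoc, sub_mul, e.eq, e'.eq, one_smul,
      ← mul_smul_comm (q ^ (-2 : ℤ)) c, ← mul_sub, ← mul_assoc, ← mul_assoc, cinv_c, c_cinv,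
      one_mul, one_mul]
    nth_rewrite 3 [← inv_smul_smul₀ hne (ainv * K)]
    rw [← smul_add, sub_smul, one_smul]
    congr 1
    abel

/-- This is the reason for the choice of E: in the form of ψ containing cE, the c⁻¹ in E cancels and
a⁻¹K drops out. -/
theorem psiElt_of_torus {cinv t : A} (hq : q ≠ 0) (hq2 : q ^ 2 ≠ 1)
    (c_cinv : c * cinv = 1)
    (h : IsEcSystem q a ainv b c K Kinv ((1 - q ^ (-2 : ℤ))⁻¹ • (cinv * (t * b - ainv * K)))) :
    psiElt q ainv c K ((1 - q ^ (-2 : ℤ))⁻¹ • (cinv * (t * b - ainv * K))) = t * b := by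
  have hne : (1 - q ^ (-2 : ℤ)) ≠ 0 := by
    intro h
    apply hq2
    simp [zpow_neg] at h
    field_simp at h
    linear_combination h
  rw [h.psiElt_eq, mul_smul_comm, smul_inv_smul₀ hne, ← mul_assoc, c_cinv, one_mul,
    sub_add_cancel]

end Systems

/-! ### Powers of elements that commute up to a scalar -/

namespace QComm

variable {k A : Type*} [Field k] [Ring A] [Algebra k A] {s : k} {x : A}

theorem pow_right {y : A} (h : QComm s x y) (n : ℕ) : QComm (s ^ n) x (y ^ n) := by
  induction n with
  | zero => simp [QComm]
  | succ n ih => rw [pow_succ, pow_succ]; exact ih.mul_right h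

theorem zpow_right {y : Aˣ} (hs : s ≠ 0) (h : QComm s x y) (n : ℤ) :
    QComm (s ^ n) x ((y ^ n : Aˣ) : A) := by
  cases n with
  | ofNat n => simpa using h.pow_right n
  | negSucc n =>
    rw [zpow_negSucc, zpow_negSucc]
    refine QComm.inv_right (pow_ne_zero _ hs) (Units.mul_inv _) (Units.inv_mul _) ?_
    rw [Units.val_pow_eq_pow_val]
    exact h.pow_right _

theorem exists_zpow_zpow {x y : Aˣ} (hs : s ≠ 0) (h : QComm s (x : A) (y : A)) (m n : ℤ) :
    ∃ t : k, QComm t ((x ^ m : Aˣ) : A) ((y ^ n : Aˣ) : A) :=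
  ⟨_, (((h.zpow_right hs n).symm (zpow_ne_zero _ hs)).zpow_right
    (inv_ne_zero (zpow_ne_zero _ hs)) m).symm
    (zpow_ne_zero _ (inv_ne_zero (zpow_ne_zero _ hs)))⟩

end QComm

/-! ### Realisations in a quantum torus -/

theorem one_sub_zpow_neg_two_ne_zero {k : Type*} [Field k] {q : k} (hq : q ^ 2 ≠ 1) :
    1 - q ^ (-2 : ℤ) ≠ 0 := by
  intro e
  refine hq ?_
  rw [sub_eq_zero, zpow_neg] at e
  exact_mod_cast inv_eq_one.1 e.symm

/-- A system of generators of an algebra `A` with `b` invertible and `ψ = ρ(α) b` for a central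
subalgebra `ρ(C)`, together with a homomorphism to the quantum torus over `C`. -/
structure IsTorusRealization {k A C : Type*} [Field k] [Ring A] [Algebra k A] [CommRing C]
    [Algebra k C] (q : kˣ) (ρ : C →ₐ[k] A) (f : A →ₐ[k] QTorus q C) (α : C)
    (a ainv b binv c K Kinv E : A) : Prop
    extends IsPhiSystem (q : k) a ainv b binv c K Kinv E where
  central : ∀ t x, Commute (ρ t) x
  psi_eq : psiElt (q : k) ainv c K E = ρ α * b
  adjoin_eq_top : Algebra.adjoin k {a, ainv, b, binv, c, K, Kinv, E} = ⊤
  map_a : f a = QTorus.single (1, 0, 0, 0) 1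
  map_b : f b = QTorus.single (0, 1, 0, 0) 1
  map_c : f c = QTorus.single (0, 0, 1, 0) 1
  map_K : f K = QTorus.single (0, 0, 0, 1) 1
  map_rho : ∀ t, f (ρ t) = algebraMap C _ t

/-! ### Laurent monomials in a, b, K -/

namespace IsPhiSystem

variable {k A : Type*} [Field k] [Ring A] [Algebra k A] {q : k}
  {a ainv b binv c K Kinv E : A}

/-- The Laurent monomial `a ^ i * b ^ j * K ^ l`. -/
def mon (h : IsPhiSystem q a ainv b binv c K Kinv E) (i j l : ℤ) : A :=
  (((⟨a, ainv, h.a_ainv, h.ainv_a⟩ : Aˣ) ^ i * (⟨b, binv, h.b_binv, h.binv_b⟩ : Aˣ) ^ j *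
    (⟨K, Kinv, h.K_Kinv, h.Kinv_K⟩ : Aˣ) ^ l : Aˣ) : A)

variable (h : IsPhiSystem q a ainv b binv c K Kinv E)

theorem mon_zero : h.mon 0 0 0 = 1 := by simp [mon]
theorem mon_a : h.mon 1 0 0 = a := by simp [mon]
theorem mon_ainv : h.mon (-1) 0 0 = ainv := by simp [mon]
theorem mon_b : h.mon 0 1 0 = b := by simp [mon]
theorem mon_binv : h.mon 0 (-1) 0 = binv := by simp [mon]
theorem mon_K : h.mon 0 0 1 = K := by simp [mon]
theorem mon_Kinv : h.mon 0 0 (-1) = Kinv := by simp [mon]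
theorem mon_ainvK : h.mon (-1) 0 1 = ainv * K := by simp [mon]

/-- Only the spanning of normal forms depends on this, so the value of the scalar is irrelevant and
is kept existential. -/
theorem mon_mul_mon (hq : q ≠ 0) (i j l i' j' l' : ℤ) :
    ∃ s : k, h.mon i j l * h.mon i' j' l' = s • h.mon (i + i') (j + j') (l + l') := by
  obtain ⟨s, hs⟩ := QComm.exists_zpow_zpow (x := ⟨K, Kinv, h.K_Kinv, h.Kinv_K⟩)
    (y := ⟨a, ainv, h.a_ainv, h.ainv_a⟩) (inv_ne_zero hq) h.Ka l i'
  obtain ⟨t, ht⟩ := QComm.exists_zpow_zpow (x := ⟨K, Kinv, h.K_Kinv, h.Kinv_K⟩)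
    (y := ⟨b, binv, h.b_binv, h.binv_b⟩) hq h.Kb l j'
  obtain ⟨u, hu⟩ := QComm.exists_zpow_zpow (x := ⟨b, binv, h.b_binv, h.binv_b⟩)
    (y := ⟨a, ainv, h.a_ainv, h.ainv_a⟩) (inv_ne_zero hq) (h.ab.symm hq) j i'
  refine ⟨s * t * u, ?_⟩
  simp only [mon, zpow_add, Units.val_mul]
  generalize (((⟨a, ainv, h.a_ainv, h.ainv_a⟩ : Aˣ) ^ i : Aˣ) : A) = x at *
  generalize (((⟨a, ainv, h.a_ainv, h.ainv_a⟩ : Aˣ) ^ i' : Aˣ) : A) = x' at *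
  generalize (((⟨b, binv, h.b_binv, h.binv_b⟩ : Aˣ) ^ j : Aˣ) : A) = y at *
  generalize (((⟨b, binv, h.b_binv, h.binv_b⟩ : Aˣ) ^ j' : Aˣ) : A) = y' at *
  generalize (((⟨K, Kinv, h.K_Kinv, h.Kinv_K⟩ : Aˣ) ^ l : Aˣ) : A) = z at *
  generalize (((⟨K, Kinv, h.K_Kinv, h.Kinv_K⟩ : Aˣ) ^ l' : Aˣ) : A) = z' at *
  calc x * y * z * (x' * y' * z') = x * y * (z * (x' * y')) * z' := by simp only [mul_assoc]
    _ = (s * t) • (x * (y * x') * y' * z * z') := by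
      rw [(hs.mul_right ht).eq, mul_smul_comm, smul_mul_assoc]; simp only [mul_assoc]
    _ = _ := by
      rw [hu.eq]
      simp only [mul_smul_comm, smul_mul_assoc, smul_smul, mul_assoc]

theorem qcomm_mon {x : A} {s t u : k} (hs : s ≠ 0) (ht : t ≠ 0) (hu : u ≠ 0)
    (ha : QComm s x a) (hb : QComm t x b) (hK : QComm u x K) (i j l : ℤ) :
    ∃ v : k, x * h.mon i j l = v • (h.mon i j l * x) := by
  refine ⟨s ^ i * t ^ j * u ^ l, ?_⟩
  rw [mon, Units.val_mul, Units.val_mul]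
  exact ((QComm.zpow_right (y := ⟨a, ainv, h.a_ainv, h.ainv_a⟩) hs ha i).mul_right
    (QComm.zpow_right (y := ⟨b, binv, h.b_binv, h.binv_b⟩) ht hb j)).mul_right
    (QComm.zpow_right (y := ⟨K, Kinv, h.K_Kinv, h.Kinv_K⟩) hu hK l)

theorem c_mul_mon (hq : q ≠ 0) (i j l : ℤ) :
    ∃ v : k, c * h.mon i j l = v • (h.mon i j l * c) :=
  h.qcomm_mon (inv_ne_zero hq) (inv_ne_zero one_ne_zero) (inv_ne_zero (inv_ne_zero hq))
    (h.ac.symm hq) (h.bc.symm one_ne_zero) (h.Kc.symm (inv_ne_zero hq)) i j l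

theorem E_mul_mon (hq : q ≠ 0) (i j l : ℤ) :
    ∃ v : k, E * h.mon i j l = v • (h.mon i j l * E) :=
  h.qcomm_mon one_ne_zero one_ne_zero (inv_ne_zero (pow_ne_zero 2 hq))
    h.Ea h.Eb (h.KE.symm (pow_ne_zero 2 hq)) i j l

end IsPhiSystem

/-- The `m`-th power of `c` if `m ≥ 0`, and the `(-m)`-th power of `E` otherwise. -/
def weylPow {A : Type*} [Monoid A] (c E : A) : ℤ → A
  | Int.ofNat n => c ^ n
  | Int.negSucc n => E ^ (n + 1)

/-! ### Spanning by normal forms, and its consequences -/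

namespace IsTorusRealization

variable {k A C : Type*} [Field k] [Ring A] [Algebra k A] [CommRing C] [Algebra k C] {q : kˣ}
  {ρ : C →ₐ[k] A} {f : A →ₐ[k] QTorus q C} {α : C} {a ainv b binv c K Kinv E : A}
  (h : IsTorusRealization q ρ f α a ainv b binv c K Kinv E)

/-- The elements `Σ ρ(t) a ^ i b ^ j K ^ l`. -/
def laurent : AddSubmonoid A :=
  AddSubmonoid.closure {w | ∃ t i j l, w = ρ t * h.mon i j l}

/-- The elements `Σ ρ(t) a ^ i b ^ j K ^ l z_m`, where `z_m` is a power of `c` or of `E`. -/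
def normalForms : AddSubmonoid A :=
  AddSubmonoid.closure {w | ∃ t i j l m, w = ρ t * h.mon i j l * weylPow c E m}

theorem mem_normalForms (t : C) (i j l m : ℤ) :
    ρ t * h.mon i j l * weylPow c E m ∈ h.normalForms :=
  AddSubmonoid.subset_closure ⟨t, i, j, l, m, rfl⟩

theorem mul_mem_of_forall {N : AddSubmonoid A} {x : A}
    (H : ∀ t i j l m, x * (ρ t * h.mon i j l * weylPow c E m) ∈ N) {w : A}
    (hw : w ∈ h.normalForms) : x * w ∈ N := by
  induction hw using AddSubmonoid.closure_induction with
  | mem w hw => obtain ⟨t, i, j, l, m, rfl⟩ := hw; exact H t i j l m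
  | zero => rw [mul_zero]; exact N.zero_mem
  | add x y _ _ hx hy => rw [mul_add]; exact N.add_mem hx hy

theorem mon_mul_mem {w : A} (hw : w ∈ h.normalForms) (i j l : ℤ) :
    h.mon i j l * w ∈ h.normalForms := by
  refine h.mul_mem_of_forall (fun t i' j' l' m => ?_) hw
  obtain ⟨s, hs⟩ := h.mon_mul_mon q.ne_zero i j l i' j' l'
  rw [← mul_assoc, ← mul_assoc, ← (h.central t _).eq, mul_assoc (ρ t), hs, mul_smul_comm,
    ← smul_mul_assoc, ← map_smul]
  exact h.mem_normalForms _ _ _ _ _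

theorem rho_mul_mem {w : A} (hw : w ∈ h.normalForms) (t : C) : ρ t * w ∈ h.normalForms := by
  refine h.mul_mem_of_forall (fun t' i' j' l' m => ?_) hw
  rw [← mul_assoc, ← mul_assoc, ← map_mul]
  exact h.mem_normalForms _ _ _ _ _

theorem smul_mem {w : A} (hw : w ∈ h.normalForms) (t : k) : t • w ∈ h.normalForms := by
  rw [← one_mul w, ← smul_mul_assoc, ← map_one ρ, ← map_smul]
  exact h.rho_mul_mem hw _

theorem weylPow_mem (m : ℤ) : weylPow c E m ∈ h.normalForms := by
  have := h.mem_normalForms 1 0 0 0 m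
  rwa [map_one, h.mon_zero, one_mul, one_mul] at this

theorem one_mem : (1 : A) ∈ h.normalForms := by
  have := h.weylPow_mem (Int.ofNat 0)
  rwa [weylPow, pow_zero] at this

variable (hq : ∀ n : ℕ, 0 < n → (q : k) ^ n ≠ 1)

-- Solves ψ = (1 - q⁻²)cE + a⁻¹K for cE. Mixed words in c and E thereby collapse into coefficients,
-- leaving pure powers.
include h hq in
theorem c_mul_E : c * E = (1 - (q : k) ^ (-2 : ℤ))⁻¹ • (ρ α * b - ainv * K) := by
  rw [← h.psi_eq, h.psiElt_eq, add_sub_cancel_right, inv_smul_smul₀ (one_sub_zpow_neg_two_ne_zero (hq 2 two_pos))]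

include hq in
theorem c_mul_E_mul_mem {w : A} (hw : w ∈ h.normalForms) : c * E * w ∈ h.normalForms := by
  rw [h.c_mul_E hq, smul_mul_assoc, sub_mul, sub_eq_add_neg (ρ α * b * w), ← neg_one_smul k (ainv * K * w),
    mul_assoc (ρ α)]
  have hb := h.mon_mul_mem hw 0 1 0
  have hK := h.mon_mul_mem hw (-1) 0 1
  rw [h.mon_b] at hb
  rw [h.mon_ainvK] at hK
  exact h.smul_mem (add_mem (h.rho_mul_mem hb _) (h.smul_mem hK _)) _

include hq in
theorem E_mul_c_mul_mem {w : A} (hw : w ∈ h.normalForms) : E * c * w ∈ h.normalForms := by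
  rw [h.Ec, add_mul]
  have hK := h.mon_mul_mem hw (-1) 0 1
  rw [h.mon_ainvK] at hK
  exact add_mem (h.c_mul_E_mul_mem hq hw) hK

include hq in
theorem c_mul_mem {w : A} (hw : w ∈ h.normalForms) : c * w ∈ h.normalForms := by
  refine h.mul_mem_of_forall (fun t i j l m => ?_) hw
  obtain ⟨s, hs⟩ := h.c_mul_mon q.ne_zero i j l
  rw [← mul_assoc, ← mul_assoc, ← (h.central t c).eq, mul_assoc (ρ t), hs, mul_smul_comm,
    smul_mul_assoc, mul_assoc, mul_assoc]
  refine h.smul_mem (h.rho_mul_mem (h.mon_mul_mem ?_ _ _ _) _) _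
  cases m with
  | ofNat n => rw [weylPow, ← pow_succ']; exact h.weylPow_mem (Int.ofNat (n + 1))
  -- The power here is Eⁿ⁺¹: c and its first factor E are absorbed together, leaving Eⁿ. For n = 0
  -- this is the nonnegative power 1, hence the case split.
  | negSucc n =>
    rw [weylPow, pow_succ', ← mul_assoc]
    refine h.c_mul_E_mul_mem hq ?_
    cases n with
    | zero => rw [pow_zero]; exact h.one_mem
    | succ n => exact h.weylPow_mem (Int.negSucc n)

include hq in
theorem E_mul_mem {w : A} (hw : w ∈ h.normalForms) : E * w ∈ h.normalForms := by
  refine h.mul_mem_of_forall (fun t i j l m => ?_) hw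
  obtain ⟨s, hs⟩ := h.E_mul_mon q.ne_zero i j l
  rw [← mul_assoc, ← mul_assoc, ← (h.central t E).eq, mul_assoc (ρ t), hs, mul_smul_comm,
    smul_mul_assoc, mul_assoc, mul_assoc]
  refine h.smul_mem (h.rho_mul_mem (h.mon_mul_mem ?_ _ _ _) _) _
  cases m with
  | ofNat n =>
    cases n with
    | zero =>
      have := h.weylPow_mem (Int.negSucc 0)
      rw [weylPow, zero_add, pow_one] at this
      rwa [weylPow, pow_zero, mul_one]
    | succ n =>
      rw [weylPow, pow_succ', ← mul_assoc]
      exact h.E_mul_c_mul_mem hq (h.weylPow_mem (Int.ofNat n))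
  | negSucc n => rw [weylPow, ← pow_succ']; exact h.weylPow_mem (Int.negSucc (n + 1))

-- The normal forms contain 1 and are stable under left multiplication by every generator, hence by
-- the whole algebra.
include hq in
theorem mem_normalForms_of_top (w : A) : w ∈ h.normalForms := by
  have key : ∀ x ∈ Algebra.adjoin k {a, ainv, b, binv, c, K, Kinv, E},
      ∀ w ∈ h.normalForms, x * w ∈ h.normalForms := by
    intro x hx
    induction hx using Algebra.adjoin_induction with
    | mem x hx =>
      intro w hw
      simp only [Set.mem_insert_iff, Set.mem_singleton_iff] at hx
      rcases hx with rfl | rfl | rfl | rfl | rfl | rfl | rfl | rfl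
      · have := h.mon_mul_mem hw 1 0 0; rwa [h.mon_a] at this
      · have := h.mon_mul_mem hw (-1) 0 0; rwa [h.mon_ainv] at this
      · have := h.mon_mul_mem hw 0 1 0; rwa [h.mon_b] at this
      · have := h.mon_mul_mem hw 0 (-1) 0; rwa [h.mon_binv] at this
      · exact h.c_mul_mem hq hw
      · have := h.mon_mul_mem hw 0 0 1; rwa [h.mon_K] at this
      · have := h.mon_mul_mem hw 0 0 (-1); rwa [h.mon_Kinv] at this
      · exact h.E_mul_mem hq hw
    | algebraMap r => intro w hw; rw [← Algebra.smul_def]; exact h.smul_mem hw r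
    | add x y _ _ hx hy => intro w hw; rw [add_mul]; exact add_mem (hx w hw) (hy w hw)
    | mul x y _ _ hx hy => intro w hw; rw [mul_assoc]; exact hx _ (hy w hw)
  have := key w (h.adjoin_eq_top ▸ Algebra.mem_top) 1 h.one_mem
  rwa [mul_one] at this

/-- Collecting terms by the power of c or E prepares the separation by degree in the torus. -/
theorem exists_sum_of_mem_normalForms {w : A} (hw : w ∈ h.normalForms) :
    ∃ r : ℤ →₀ A, (∀ m, r m ∈ h.laurent) ∧ w = r.sum fun m x => x * weylPow c E m := by
  induction hw using AddSubmonoid.closure_induction with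
  | mem w hw =>
    obtain ⟨t, i, j, l, m, rfl⟩ := hw
    refine ⟨Finsupp.single m (ρ t * h.mon i j l), fun m' => ?_, ?_⟩
    · rw [Finsupp.single_apply]
      split_ifs
      · exact AddSubmonoid.subset_closure ⟨t, i, j, l, rfl⟩
      · exact zero_mem _
    · rw [Finsupp.sum_single_index (zero_mul _)]
  | zero => exact ⟨0, fun _ => zero_mem _, by simp⟩
  | add x y _ _ hx hy =>
    obtain ⟨r, hr, rfl⟩ := hx
    obtain ⟨r', hr', rfl⟩ := hy
    refine ⟨r + r', fun m => add_mem (hr m) (hr' m), ?_⟩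
    rw [Finsupp.sum_add_index' (fun _ => zero_mul _) (fun _ _ _ => add_mul _ _ _)]

/-! #### Injectivity -/

/-- When the exponent has zero twist with itself, powers of the monomial acquire no scalar. Negative
powers follow from uniqueness of inverses. -/
theorem single_zpow {u : Aˣ} {g : TorusExp} (hg : TorusExp.twist g g = 0)
    (hu : f u = QTorus.single g 1) (n : ℤ) : f ((u ^ n : Aˣ) : A) = QTorus.single (n • g) 1 := by
  have hpow : ∀ n : ℕ, f ((u ^ n : Aˣ) : A) = QTorus.single ((n : ℤ) • g) 1 := by
    intro n
    induction n with
    | zero => simp [QTorus.one_def]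
    | succ n ih =>
      have ht : TorusExp.twist ((n : ℤ) • g) g = 0 := by
        have : TorusExp.twist ((n : ℤ) • g) g = n * TorusExp.twist g g := by
          simp only [TorusExp.twist, Prod.smul_fst, Prod.smul_snd, smul_eq_mul]; ring
        rw [this, hg, mul_zero]
      rw [pow_succ, Units.val_mul, map_mul, ih, hu, QTorus.single_mul_single, QTorus.cocycle, ht]
      simp [add_smul]
  cases n with
  | ofNat n => simpa using hpow n
  | negSucc n =>
    rw [zpow_negSucc]
    have e : f ((u ^ (n + 1) : Aˣ) : A) * f (((u ^ (n + 1))⁻¹ : Aˣ) : A) = 1 := by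
      rw [← map_mul, Units.mul_inv, map_one]
    have e' : QTorus.single (Int.negSucc n • g) 1 * f ((u ^ (n + 1) : Aˣ) : A) = 1 := by
      have ht : TorusExp.twist (Int.negSucc n • g) (((n + 1 : ℕ) : ℤ) • g) = 0 := by
        have : TorusExp.twist (Int.negSucc n • g) (((n + 1 : ℕ) : ℤ) • g) =
            Int.negSucc n * (n + 1 : ℕ) * TorusExp.twist g g := by
          simp only [TorusExp.twist, Prod.smul_fst, Prod.smul_snd, smul_eq_mul]; ring
        rw [this, hg, mul_zero]
      rw [hpow, QTorus.single_mul_single, QTorus.cocycle, ht, ← add_smul, Int.negSucc_eq]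
      simp [QTorus.one_def]
    exact (left_inv_eq_right_inv e' e).symm

theorem map_mon (i j l : ℤ) : f (h.mon i j l) = QTorus.single (i, j, 0, l) 1 := by
  rw [IsPhiSystem.mon, Units.val_mul, Units.val_mul, map_mul, map_mul,
    single_zpow (by simp [TorusExp.twist]) h.map_a, single_zpow (by simp [TorusExp.twist]) h.map_b,
    single_zpow (by simp [TorusExp.twist]) h.map_K, QTorus.single_mul_single,
    QTorus.single_mul_single]
  simp [QTorus.cocycle, TorusExp.twist]

theorem map_rho_mul_mon (t : C) (i j l : ℤ) :
    f (ρ t * h.mon i j l) = QTorus.single (i, j, 0, l) t := by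
  rw [map_mul, h.map_rho, h.map_mon, ← Algebra.smul_def, QTorus.smul_single, mul_one]

/-- The additive map that lifts monomials without `c` back to `A`. -/
noncomputable def lift : QTorus q C →+ A :=
  Finsupp.liftAddHom fun g : TorusExp =>
    (AddMonoidHom.mulRight (h.mon g.1 g.2.1 g.2.2.2)).comp (ρ : C →+ A)

theorem lift_single (g : TorusExp) (t : C) :
    h.lift (QTorus.single g t) = ρ t * h.mon g.1 g.2.1 g.2.2.2 := by
  exact Finsupp.liftAddHom_apply_single _ g t

/-- The generators ρ(t)aⁱbʲKˡ map to basis monomials with coefficient t, from which t, i, j, l can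
be read off. Hence no independence in A has to be known beforehand: a left inverse on this part is
explicit. -/
theorem lift_map {r : A} (hr : r ∈ h.laurent) : h.lift (f r) = r := by
  induction hr using AddSubmonoid.closure_induction with
  | mem w hw => obtain ⟨t, i, j, l, rfl⟩ := hw; rw [h.map_rho_mul_mon, h.lift_single]
  | zero => rw [map_zero, map_zero]
  | add x y _ _ hx hy => rw [map_add, map_add, hx, hy]

theorem isHomog_map {r : A} (hr : r ∈ h.laurent) : QTorus.IsHomog 0 (f r) := by
  induction hr using AddSubmonoid.closure_induction with
  | mem w hw =>
    obtain ⟨t, i, j, l, rfl⟩ := hw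
    rw [h.map_rho_mul_mon]
    exact QTorus.IsHomog.single _ _
  | zero => rw [map_zero]; exact QTorus.IsHomog.zero 0
  | add x y _ _ hx hy => rw [map_add]; exact hx.add hy

include h in
theorem map_c_pow (n : ℕ) : f (c ^ n) = QTorus.single (0, 0, (n : ℤ), 0) 1 := by
  rw [map_pow, h.map_c]
  induction n with
  | zero => rfl
  | succ n ih =>
    rw [pow_succ, ih, QTorus.single_mul_single]
    simp [QTorus.cocycle, TorusExp.twist]

include h in
theorem map_psi_sub : f (ρ α * b - ainv * K) =
    QTorus.single (0, 1, 0, 0) α - QTorus.single (-1, 0, 0, 1) 1 := by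
  rw [map_sub, ← h.mon_ainvK, h.map_mon]
  nth_rewrite 1 [← h.mon_b]
  rw [h.map_rho_mul_mon]

-- The image of E need not be prescribed: the image of c is invertible in the torus, and cE is
-- known.
include h hq in
theorem map_E : f E = QTorus.single (0, 0, -1, 0) 1 *
    f ((1 - (q : k) ^ (-2 : ℤ))⁻¹ • (ρ α * b - ainv * K)) := by
  rw [← h.c_mul_E hq, map_mul, h.map_c, ← mul_assoc, QTorus.single_mul_single]
  simp [QTorus.cocycle, TorusExp.twist, ← Prod.zero_eq_mk, ← QTorus.one_def]

include h hq in
theorem isHomog_map_E : QTorus.IsHomog (-1) (f E) := by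
  rw [h.map_E hq, map_smul, h.map_psi_sub]
  refine QTorus.IsHomog.mul (d := -1) (e := 0)
    (QTorus.IsHomog.single (0, 0, -1, 0) 1) ?_
  rw [← algebraMap_smul C, sub_eq_add_neg (QTorus.single _ α), ← neg_one_smul C (QTorus.single (-1, 0, 0, 1) 1)]
  have h1 : QTorus.IsHomog 0 (QTorus.single (0, 1, 0, 0) α : QTorus q C) :=
    QTorus.IsHomog.single (0, 1, 0, 0) α
  have h2 : QTorus.IsHomog 0 (QTorus.single (-1, 0, 0, 1) 1 : QTorus q C) :=
    QTorus.IsHomog.single (-1, 0, 0, 1) 1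
  exact (h1.add (h2.smul _)).smul _

include h hq in
theorem map_E_ne_zero [IsDomain C] : f E ≠ 0 := by
  rw [h.map_E hq]
  refine mul_ne_zero ?_ ?_
  · intro e
    have := congrArg (fun x => QTorus.coeff x (0, 0, -1, 0)) e
    simp [QTorus.coeff_single] at this
  · rw [map_smul, h.map_psi_sub]
    refine smul_ne_zero (inv_ne_zero (one_sub_zpow_neg_two_ne_zero (hq 2 two_pos))) ?_
    intro e
    -- The coefficient of a⁻¹K is -1 whatever α is, so α = 0 is covered as well.
    have := congrArg (fun x => QTorus.coeff x (-1, 0, 0, 1)) e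
    simp [QTorus.coeff_single] at this

include h hq in
theorem isHomog_map_weylPow (m : ℤ) : QTorus.IsHomog m (f (weylPow c E m)) := by
  cases m with
  | ofNat n =>
    rw [weylPow, h.map_c_pow]
    exact QTorus.IsHomog.single _ _
  | negSucc n =>
    rw [weylPow, map_pow]
    convert (h.isHomog_map_E hq).pow (n + 1) using 1
    rw [Int.negSucc_eq]
    push_cast; ring

include h hq in
theorem map_weylPow_ne_zero [IsDomain C] (m : ℤ) : f (weylPow c E m) ≠ 0 := by
  cases m with
  | ofNat n =>
    rw [weylPow, h.map_c_pow]
    intro e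
    have := congrArg (fun x => QTorus.coeff x (0, 0, (n : ℤ), 0)) e
    simp [QTorus.coeff_single] at this
  | negSucc n =>
    rw [weylPow, map_pow]
    exact pow_ne_zero _ (h.map_E_ne_zero hq)

-- Write an element of the kernel as a sum of r_m z_m with z_m a power of c or E. The image of r_m
-- z_m has degree m, so each one vanishes separately. The torus is a domain and z_m has nonzero
-- image, so r_m maps to 0 and is therefore 0.
include h hq in
theorem injective [IsDomain C] : Function.Injective f := by
  rw [injective_iff_map_eq_zero]
  intro w hw
  obtain ⟨r, hr, rfl⟩ := h.exists_sum_of_mem_normalForms (h.mem_normalForms_of_top hq w)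
  rw [Finsupp.sum, map_sum] at hw
  rw [Finsupp.sum]
  refine Finset.sum_eq_zero fun m hm => ?_
  have e := QTorus.eq_zero_of_sum_isHomog (x := fun m => f (r m * weylPow c E m)) (fun m => ?_)
    hw hm
  · rw [map_mul] at e
    have := (mul_eq_zero.1 e).resolve_right (h.map_weylPow_ne_zero hq m)
    rw [← h.lift_map (hr m), this, map_zero, zero_mul]
  · rw [map_mul]
    have := (h.isHomog_map (hr m)).mul (h.isHomog_map_weylPow hq m)
    rwa [zero_add] at this

include h hq in
theorem isDomain [IsDomain C] : IsDomain A := by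
  have : IsDomain (QTorus q C) := NoZeroDivisors.to_isDomain _
  exact (h.injective hq).isDomain (f : A →+* QTorus q C)

-- A central element has an image commuting with the four variables, hence a scalar of C; that
-- scalar is the image of an element of ρ(C), and the realization is injective.
include h hq in
theorem mem_center_iff [IsDomain C] {w : A} :
    w ∈ Subalgebra.center k A ↔ ∃ t, ρ t = w := by
  rw [Subalgebra.mem_center_iff]
  constructor
  · intro hw
    have key : ∀ x, Commute (f x) (f w) := fun x => by
      rw [Commute, SemiconjBy, ← map_mul, hw, map_mul]
    refine ⟨(f w).coeff 0, h.injective hq ?_⟩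
    rw [h.map_rho]
    exact (QTorus.eq_algebraMap_of_commute hq (h.map_a ▸ key a) (h.map_b ▸ key b)
      (h.map_c ▸ key c) (h.map_K ▸ key K)).symm
  · rintro ⟨t, rfl⟩ x
    exact (h.central t x).eq.symm

/-! #### Simplicity -/

-- Expand the commutator with cⁿ⁺² as [E, cⁿ⁺¹]c + cⁿ⁺¹[E, c]. Each passage of a⁻¹K across c costs
-- q⁻², which builds the geometric sum.
include h in
theorem E_mul_c_pow (n : ℕ) : E * c ^ (n + 1) - c ^ (n + 1) * E =
    (∑ i ∈ Finset.range (n + 1), ((q : k) ^ (-2 : ℤ)) ^ i) • (c ^ n * (ainv * K)) := by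
  have e : QComm ((q : k) ^ (-2 : ℤ)) (ainv * K) c :=
    ((h.ac.inv_left q.ne_zero h.a_ainv h.ainv_a).mul_left h.Kc).congr (by simp [zpow_neg, sq])
  induction n with
  | zero => simp [h.Ec]
  | succ n ih =>
    calc E * c ^ (n + 1 + 1) - c ^ (n + 1 + 1) * E
        = (E * c ^ (n + 1) - c ^ (n + 1) * E) * c + c ^ (n + 1) * (E * c - c * E) := by
          rw [pow_succ c (n + 1)]; noncomm_ring
      _ = _ := by
        rw [ih, h.Ec, add_sub_cancel_left, Finset.sum_range_succ' _ (n + 1), smul_mul_assoc,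
          mul_assoc, e.eq, mul_smul_comm, smul_smul, ← mul_assoc (c ^ n), ← pow_succ, pow_zero,
          add_smul, one_smul, Finset.sum_mul]
        simp only [pow_succ]

/-- A nonzero ideal contains an element that is realised by a monomial. -/
theorem exists_single_mem [IsDomain C] (hq : ∀ n : ℕ, 0 < n → (q : k) ^ n ≠ 1)
    (h : IsTorusRealization q ρ f α a ainv b binv c K Kinv E) (I : TwoSidedIdeal A) (n : ℕ) :
    ∀ w ∈ I, f w ≠ 0 → (f w).support.card = n →
      ∃ w ∈ I, ∃ g t, t ≠ 0 ∧ f w = QTorus.single g t := by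
  induction n using Nat.strong_induction_on with
  | _ n ih =>
  intro w hw hne hn
  by_cases hs : ∀ g ∈ (f w).support, ∀ g' ∈ (f w).support, g = g'
  · obtain ⟨g, hg⟩ := QTorus.support_nonempty.2 hne
    refine ⟨w, hw, g, (f w).coeff g, QTorus.mem_support.1 hg, ?_⟩
    conv_lhs => rw [QTorus.eq_sum_single (f w)]
    refine Finset.sum_eq_single_of_mem g hg fun g' hg' hne' => absurd (hs g' hg' g hg) hne'
  · push Not at hs
    obtain ⟨g, hg, g', hg', hgg⟩ := hs
    -- Nondegeneracy of the commutation form: one of the four variables distinguishes the exponents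
    -- g and g'.
    have hv : ∃ (x : A) (v : TorusExp), f x = QTorus.single v 1 ∧
        QTorus.comm v g' ≠ QTorus.comm v g := by
      by_contra hcon
      push Not at hcon
      exact hgg (QTorus.comm_injective (hcon a _ h.map_a) (hcon b _ h.map_b)
        (hcon c _ h.map_c) (hcon K _ h.map_K)).symm
    obtain ⟨x, v, hx, hvg⟩ := hv
    -- The scalar is the one with which x commutes past the monomial g. That term is killed, while
    -- the g' term survives.
    set w' := x * w - ((q ^ QTorus.comm v g : kˣ) : k) • (w * x) with hw'
    have hcoeff : ∀ l, (f w').coeff (v + l) = (QTorus.cocycle q C v l -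
        algebraMap k C ↑(q ^ QTorus.comm v g) * QTorus.cocycle q C l v) * (f w).coeff l := by
      intro l
      rw [hw', map_sub, map_smul, map_mul, map_mul, hx]
      exact QTorus.coeff_twisted_commutator v g l (f w)
    have hmem : w' ∈ I := by
      refine I.sub_mem (I.mul_mem_left _ _ hw) ?_
      rw [Algebra.smul_def]
      exact I.mul_mem_left _ _ (I.mul_mem_right _ _ hw)
    have hne' : f w' ≠ 0 := by
      intro e
      have := hcoeff g'
      rw [e, QTorus.coeff_zero, eq_comm, mul_eq_zero, QTorus.cocycle_sub_eq_zero_iff hq] at this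
      exact this.elim hvg (QTorus.mem_support.1 hg')
    -- The new support lies in the translate of the old one by v and misses v + g.
    have hcard : (f w').support.card < n := by
      rw [← hn, ← Finset.card_map (s := (f w).support) (addLeftEmbedding v)]
      refine Finset.card_lt_card ?_
      rw [Finset.ssubset_iff_of_subset]
      · refine ⟨v + g, Finset.mem_map.2 ⟨g, hg, rfl⟩, ?_⟩
        rw [QTorus.mem_support, not_not, hcoeff,
          (QTorus.cocycle_sub_eq_zero_iff hq v g g).2 rfl, zero_mul]
      · intro l hl
        obtain ⟨l, rfl⟩ : ∃ l', l = v + l' := ⟨-v + l, by abel⟩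
        rw [QTorus.mem_support, hcoeff] at hl
        exact Finset.mem_map.2 ⟨l, QTorus.mem_support.2 (right_ne_zero_of_mul hl), rfl⟩
    exact ih _ hcard w' hmem hne' rfl

-- A nonzero ideal contains an element realised by a monomial. Multiplication by inverse monomials,
-- and by c if needed, gives a power of c, and commutators with E then lower that power to 1. The
-- units of C serve to clear the coefficient.
include h hq in
theorem isSimpleRing [IsDomain C] (hC : ∀ t : C, t ≠ 0 → IsUnit t) : IsSimpleRing A := by
  have := h.isDomain hq
  refine ⟨⟨fun I => or_iff_not_imp_left.2 fun hI => ?_⟩⟩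
  obtain ⟨w, hw, hne⟩ : ∃ w ∈ I, w ≠ 0 := by
    by_contra hcon
    push Not at hcon
    refine hI (eq_bot_iff.2 fun w hw => ?_)
    rw [TwoSidedIdeal.mem_bot]
    exact hcon w hw
  obtain ⟨w, hw, ⟨i, j, m, l⟩, t, ht, hwt⟩ := exists_single_mem hq h I _ w hw
    ((map_ne_zero_iff f (h.injective hq)).2 hne) rfl
  obtain ⟨N, hN⟩ : ∃ N : ℕ, c ^ N ∈ I := by
    -- In A the element c need not be invertible, so a negative exponent m is raised to 0 by
    -- multiplying with c⁻ᵐ, and a nonnegative one is left alone.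
    set N := m.toNat
    set M := (-m).toNat
    have hMN : (M : ℤ) + m = N := by omega
    have hu : f (c ^ M * (h.mon (-i) (-j) (-l) * w)) = QTorus.single (0, 0, (N : ℤ), 0)
        (t * QTorus.cocycle q C (-i, -j, 0, -l) (i, j, m, l) *
          QTorus.cocycle q C (0, 0, (M : ℤ), 0) (0, 0, m, 0)) := by
      rw [map_mul, map_mul, hwt, h.map_mon, h.map_c_pow, QTorus.single_mul_single,
        QTorus.single_mul_single]
      simp [hMN]
    have hunit := ((hC t ht).mul (QTorus.isUnit_cocycle (q := q) (C := C)
      (-i, -j, 0, -l) (i, j, m, l))).mul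
        (QTorus.isUnit_cocycle (q := q) (C := C) (0, 0, (M : ℤ), 0) (0, 0, m, 0))
    obtain ⟨u, hu'⟩ := hunit
    refine ⟨N, ?_⟩
    have : c ^ N = ρ ↑u⁻¹ * (c ^ M * (h.mon (-i) (-j) (-l) * w)) := by
      apply h.injective hq
      rw [map_mul, hu, h.map_c_pow, h.map_rho, ← Algebra.smul_def, QTorus.smul_single, ← hu',
        Units.inv_mul]
    rw [this]
    exact I.mul_mem_left _ _ (I.mul_mem_left _ _ (I.mul_mem_left _ _ hw))
  have hone : (1 : A) ∈ I := by
    induction N with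
    | zero => rwa [pow_zero] at hN
    | succ n ih =>
      refine ih ?_
      have hx : (q : k) ^ (-2 : ℤ) - 1 ≠ 0 := by
        rw [← neg_sub]; exact neg_ne_zero.2 (one_sub_zpow_neg_two_ne_zero (hq 2 two_pos))
      -- A vanishing geometric sum would give q⁻²⁽ⁿ⁺¹⁾ = 1, and q is not a root of unity.
      have hs : (∑ i ∈ Finset.range (n + 1), ((q : k) ^ (-2 : ℤ)) ^ i) ≠ 0 := by
        intro e
        have e' := geom_sum_mul ((q : k) ^ (-2 : ℤ)) (n + 1)
        rw [e, zero_mul, eq_comm, sub_eq_zero, ← zpow_natCast, ← zpow_mul,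
          show (-2 : ℤ) * ((n + 1 : ℕ) : ℤ) = -((2 * (n + 1) : ℕ) : ℤ) by push_cast; ring,
          zpow_neg, inv_eq_one, zpow_natCast] at e'
        exact hq _ (by omega) e'
      have e := h.E_mul_c_pow n
      -- The commutator is a nonzero multiple of cⁿa⁻¹K, and K⁻¹a removes the unit a⁻¹K.
      have : c ^ n = (∑ i ∈ Finset.range (n + 1), ((q : k) ^ (-2 : ℤ)) ^ i)⁻¹ •
          ((E * c ^ (n + 1) - c ^ (n + 1) * E) * (Kinv * a)) := by
        rw [e, smul_mul_assoc, inv_smul_smul₀ hs, mul_assoc (c ^ n), mul_assoc ainv,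
          ← mul_assoc K, h.K_Kinv, one_mul, h.ainv_a, mul_one]
      rw [this, Algebra.smul_def]
      exact I.mul_mem_left _ _ (I.mul_mem_right _ _
        (I.sub_mem (I.mul_mem_left _ _ hN) (I.mul_mem_right _ _ hN)))
  rw [eq_top_iff]
  intro x _
  rw [← mul_one x]
  exact I.mul_mem_left _ _ hone

end IsTorusRealization

/-! ### Homomorphisms from `D_q` and from its factor algebras -/

namespace Dq

variable {k A P : Type*} [Field k] [Ring A] [Algebra k A] [Ring P] [Algebra k P] {q : k}
  {a' ainv' b' c' K' Kinv' E' F' : P}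

theorem isDqSystem (q : k) :
    IsDqSystem q (a q) (ainv q) (b q) (c q) (K q) (Kinv q) (E q) (F q) := by
  have key : ∀ {x y : FreeAlgebra k Gen}, Rel q x y →
      (RingQuot.mkAlgHom k (Rel q) x : Dq q) = (RingQuot.mkAlgHom k (Rel q) y : Dq q) :=
    fun h => RingQuot.mkAlgHom_rel k h
  have mul : ∀ x y : FreeAlgebra k Gen, (RingQuot.mkAlgHom k (Rel q) (x * y) : Dq q) =
      ((RingQuot.mkAlgHom k (Rel q) x : Dq q) * (RingQuot.mkAlgHom k (Rel q) y : Dq q) : Dq q) :=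
    fun x y => map_mul (RingQuot.mkAlgHom k (Rel q)) x y
  have add : ∀ x y : FreeAlgebra k Gen, (RingQuot.mkAlgHom k (Rel q) (x + y) : Dq q) =
      ((RingQuot.mkAlgHom k (Rel q) x : Dq q) + (RingQuot.mkAlgHom k (Rel q) y : Dq q) : Dq q) :=
    fun x y => map_add (RingQuot.mkAlgHom k (Rel q)) x y
  have smul : ∀ (s : k) (x : FreeAlgebra k Gen), (RingQuot.mkAlgHom k (Rel q) (s • x) : Dq q) =
      (s • (RingQuot.mkAlgHom k (Rel q) x : Dq q) : Dq q) :=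
    fun s x => map_smul (RingQuot.mkAlgHom k (Rel q)) s x
  have one : (RingQuot.mkAlgHom k (Rel q) 1 : Dq q) = (1 : Dq q) :=
    map_one (RingQuot.mkAlgHom k (Rel q))
  have bc := key Rel.bc
  have EF := key Rel.EF
  have Ea := key Rel.Ea
  have Eb := key Rel.Eb
  have ab := key Rel.ab
  have ac := key Rel.ac
  have a_ainv := key Rel.a_ainv
  have ainv_a := key Rel.ainv_a
  have KE := key Rel.KE
  have KF := key Rel.KF
  have K_Kinv := key Rel.K_Kinv
  have Kinv_K := key Rel.Kinv_K
  have Ka := key Rel.Ka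
  have Kb := key Rel.Kb
  have Kc := key Rel.Kc
  have Ec := key Rel.Ec
  have Fa := key Rel.Fa
  have Fb := key Rel.Fb
  have Fc := key Rel.Fc
  simp only [mul, add, smul, one] at *
  exact
  { a_ainv := a_ainv
    ainv_a := ainv_a
    K_Kinv := K_Kinv
    Kinv_K := Kinv_K
    ab := ab
    ac := ac
    bc := QComm.of_commute bc
    Ka := Ka
    Kb := Kb
    Kc := Kc
    KE := KE
    Ea := QComm.of_commute Ea
    Eb := QComm.of_commute Eb
    Ec := Ec
    KF := KF
    EF := QComm.of_commute EF
    Fa := Fa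
    Fb := Fb
    Fc := Fc }

/-- The values on the generators of the homomorphism belonging to a system of elements. -/
def genMap (a' ainv' b' c' K' Kinv' E' F' : P) : Gen → P
  | .a => a'
  | .ainv => ainv'
  | .b => b'
  | .c => c'
  | .K => K'
  | .Kinv => Kinv'
  | .E => E'
  | .F => F'

/-- The universal property of `D_q`. -/
def lift (h : IsDqSystem q a' ainv' b' c' K' Kinv' E' F') : Dq q →ₐ[k] P :=
  RingQuot.liftAlgHom k ⟨FreeAlgebra.lift k (genMap a' ainv' b' c' K' Kinv' E' F'), by
    intro x y hxy
    cases hxy <;>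
      simp only [map_mul, map_add, map_smul, map_one, gen, FreeAlgebra.lift_ι_apply, genMap]
    exacts [h.ab, h.ac, h.bc.commute, h.a_ainv, h.ainv_a, h.KE, h.KF, h.EF.commute, h.K_Kinv,
      h.Kinv_K, h.Ka, h.Kb, h.Kc, h.Ea.commute, h.Eb.commute, h.Ec, h.Fa, h.Fb, h.Fc]⟩

theorem lift_of (h : IsDqSystem q a' ainv' b' c' K' Kinv' E' F') (g : Gen) :
    lift h (of q g) = genMap a' ainv' b' c' K' Kinv' E' F' g := by
  refine (RingQuot.liftAlgHom_mkAlgHom_apply k _ _ _).trans ?_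
  exact FreeAlgebra.lift_ι_apply _ _

theorem lift_phi (h : IsDqSystem q a' ainv' b' c' K' Kinv' E' F') :
    lift h (phi q) = phiElt q a' b' F' := by
  change lift h (phiElt q (a q) (b q) (F q)) = _
  rw [map_phiElt, lift_of, lift_of, lift_of]
  rfl

theorem lift_psi (h : IsDqSystem q a' ainv' b' c' K' Kinv' E' F') :
    lift h (psi q) = psiElt q ainv' c' K' E' := by
  change lift h (psiElt q (ainv q) (c q) (K q) (E q)) = _
  rw [map_psiElt, lift_of, lift_of, lift_of, lift_of]
  rfl

theorem adjoin_range_of (q : k) : Algebra.adjoin k (Set.range (of q)) = ⊤ := by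
  rw [eq_top_iff]
  rintro x -
  obtain ⟨y, rfl⟩ := RingQuot.mkAlgHom_surjective k (Rel q) x
  induction y using FreeAlgebra.induction with
  | grade0 r =>
    rw [AlgHom.commutes]
    exact Subalgebra.algebraMap_mem _ r
  | grade1 g => exact Algebra.subset_adjoin ⟨g, rfl⟩
  | mul x y hx hy => rw [map_mul]; exact mul_mem hx hy
  | add x y hx hy => rw [map_add]; exact add_mem hx hy

theorem range_of (q : k) :
    Set.range (of q) = {a q, ainv q, b q, c q, K q, Kinv q, E q, F q} := by
  ext x
  simp only [Set.mem_range, Set.mem_insert_iff, Set.mem_singleton_iff]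
  constructor
  · rintro ⟨g, rfl⟩
    cases g <;> simp
  · rintro (rfl | rfl | rfl | rfl | rfl | rfl | rfl | rfl) <;> exact ⟨_, rfl⟩

/-- The projection to a factor algebra. -/
def proj (s : Set (Dq q)) : Dq q →ₐ[k] Factor s := (TwoSidedIdeal.span s).ringCon.mkₐ k

theorem proj_surjective (s : Set (Dq q)) : Function.Surjective (proj s) :=
  (TwoSidedIdeal.span s).ringCon.mk'_surjective

theorem proj_eq_zero {s : Set (Dq q)} {z : Dq q} (hz : z ∈ s) : proj s z = 0 := by
  have : z ∈ TwoSidedIdeal.span s := TwoSidedIdeal.subset_span hz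
  rw [TwoSidedIdeal.mem_iff] at this
  exact (RingCon.eq _).2 this

/-- Homomorphisms from a factor algebra. -/
def factorLift (s : Set (Dq q)) (g : Dq q →ₐ[k] P) (hg : ∀ z ∈ s, g z = 0) : Factor s →ₐ[k] P :=
  RingCon.liftₐ _ g (by
    have : TwoSidedIdeal.span s ≤ TwoSidedIdeal.ker (g : Dq q →+* P) :=
      TwoSidedIdeal.span_le.2 fun z hz => (TwoSidedIdeal.mem_ker _).2 (hg z hz)
    exact TwoSidedIdeal.ringCon_le_iff.1 this)

theorem factorLift_proj (s : Set (Dq q)) (g : Dq q →ₐ[k] P) (hg : ∀ z ∈ s, g z = 0) (z : Dq q) :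
    factorLift s g hg (proj s z) = g z := rfl

theorem adjoin_factor (s : Set (Dq q)) : Algebra.adjoin k {proj s (a q), proj s (ainv q),
    proj s (b q), proj s (c q), proj s (K q), proj s (Kinv q), proj s (E q), proj s (F q)} = ⊤ := by
  have := congrArg (Subalgebra.map (proj s)) (adjoin_range_of q)
  rw [Algebra.map_top, (AlgHom.range_eq_top _).2 (proj_surjective s), AlgHom.map_adjoin,
    range_of] at this
  simpa only [Set.image_insert_eq, Set.image_singleton] using this

theorem isDqSystem_factor (s : Set (Dq q)) : IsDqSystem q (proj s (a q)) (proj s (ainv q))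
    (proj s (b q)) (proj s (c q)) (proj s (K q)) (proj s (Kinv q)) (proj s (E q))
    (proj s (F q)) :=
  (isDqSystem q).map (proj s)

theorem proj_phi (s : Set (Dq q)) :
    proj s (phi q) = phiElt q (proj s (a q)) (proj s (b q)) (proj s (F q)) :=
  map_phiElt (proj s) q (a q) (b q) (F q)

theorem proj_psi (s : Set (Dq q)) : proj s (psi q) =
    psiElt q (proj s (ainv q)) (proj s (c q)) (proj s (K q)) (proj s (E q)) :=
  map_psiElt (proj s) q (ainv q) (c q) (K q) (E q)

end Dq

/-! ### The torus as a system -/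

namespace QTorus

variable {k C : Type*} [Field k] [CommRing C] [Algebra k C]

theorem single_mul_single_eq_one {q : kˣ} {g h : TorusExp} (e : g + h = 0)
    (e' : TorusExp.twist g h = 0) : (single g 1 * single h 1 : QTorus q C) = 1 := by
  rw [single_mul_single, e, cocycle, e', zpow_zero, Units.val_one, map_one, mul_one, mul_one,
    one_def]

theorem qcomm_single {q : kˣ} {g h : TorusExp} (n : ℤ)
    (e : TorusExp.twist g h = n + TorusExp.twist h g) :
    QComm ((q : k) ^ n) (single g 1 : QTorus q C) (single h 1) := by
  rw [QComm, single_mul_single, single_mul_single, field_smul_single, add_comm h g, cocycle,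
    cocycle, e, zpow_add]
  simp

/-- The parameter α ∈ C is central in the torus over C. An indeterminate makes ψ generic, and a
scalar specializes it. -/
theorem exists_isDqSystem (q : kˣ) (hq2 : (q : k) ^ 2 ≠ 1) (α : C) :
    ∃ ainv Kinv E F : QTorus q C, IsDqSystem (q : k) (single (1, 0, 0, 0) 1) ainv
      (single (0, 1, 0, 0) 1) (single (0, 0, 1, 0) 1) (single (0, 0, 0, 1) 1) Kinv E F ∧
      phiElt (q : k) (single (1, 0, 0, 0) 1) (single (0, 1, 0, 0) 1) F = 0 ∧
      psiElt (q : k) ainv (single (0, 0, 1, 0) 1) (single (0, 0, 0, 1) 1) E =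
        algebraMap C _ α * single (0, 1, 0, 0) 1 := by
  have h := isPhiSystem_of_torus (A := QTorus q C) (q := (q : k)) (a := single (1, 0, 0, 0) 1)
    (ainv := single (-1, 0, 0, 0) 1) (b := single (0, 1, 0, 0) 1)
    (binv := single (0, -1, 0, 0) 1) (c := single (0, 0, 1, 0) 1)
    (cinv := single (0, 0, -1, 0) 1) (K := single (0, 0, 0, 1) 1)
    (Kinv := single (0, 0, 0, -1) 1) (t := algebraMap C _ α) q.ne_zero hq2
    (single_mul_single_eq_one rfl rfl)
    (single_mul_single_eq_one rfl rfl)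
    (single_mul_single_eq_one rfl rfl)
    (single_mul_single_eq_one rfl rfl)
    (single_mul_single_eq_one rfl rfl)
    (single_mul_single_eq_one rfl rfl)
    (single_mul_single_eq_one rfl rfl)
    (single_mul_single_eq_one rfl rfl)
    ((qcomm_single 1 rfl).congr (zpow_one _))
    ((qcomm_single 1 rfl).congr (zpow_one _))
    ((qcomm_single 0 rfl).congr (zpow_zero _))
    ((qcomm_single (-1) rfl).congr (zpow_neg_one _))
    ((qcomm_single 1 rfl).congr (zpow_one _))
    ((qcomm_single (-1) rfl).congr (zpow_neg_one _))
    (fun x => (Algebra.commutes α x).symm)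
  refine ⟨_, _, _, _, h.isDqSystem q.ne_zero hq2, h.phiElt_eq_zero q.ne_zero hq2, ?_⟩
  exact psiElt_of_torus q.ne_zero hq2 (single_mul_single_eq_one rfl rfl) h.toIsEcSystem

theorem algebraMap_injective (q : kˣ) : Function.Injective (algebraMap C (QTorus q C)) := by
  intro s t h
  rw [algebraMap_eq_single, algebraMap_eq_single] at h
  simpa [coeff_single] using congrArg (fun x => coeff x 0) h

end QTorus

/-! ### Consequences for generated systems -/

section Packages

variable {k A : Type*} [Field k] [Ring A] [Algebra k A] {q : kˣ}
  {a ainv b c K Kinv E F : A}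

theorem sub_inv_ne_zero {q : k} (hq : q ≠ 0) (hq2 : q ^ 2 ≠ 1) : q - q⁻¹ ≠ 0 := by
  intro e
  apply hq2
  field_simp at e
  linear_combination e

/-- F and the inverse of b are interchangeable as generators, since F = (q - q⁻¹)⁻¹b⁻¹a. -/
theorem adjoin_binv_eq_top (hq2 : (q : k) ^ 2 ≠ 1)
    (h : IsDqSystem (q : k) a ainv b c K Kinv E F)
    (hgen : Algebra.adjoin k {a, ainv, b, c, K, Kinv, E, F} = ⊤) :
    Algebra.adjoin k {a, ainv, b, ((q : k) - (q : k)⁻¹) • (F * ainv), c, K, Kinv, E} = ⊤ := by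
  rw [eq_top_iff, ← hgen, Algebra.adjoin_le_iff]
  set S := Algebra.adjoin k {a, ainv, b, ((q : k) - (q : k)⁻¹) • (F * ainv), c, K, Kinv, E}
  have hs := Algebra.subset_adjoin (R := k)
    (s := {a, ainv, b, ((q : k) - (q : k)⁻¹) • (F * ainv), c, K, Kinv, E})
  have hF : F ∈ S := by
    have : F = ((q : k) - (q : k)⁻¹)⁻¹ • ((((q : k) - (q : k)⁻¹) • (F * ainv)) * a) := by
      rw [smul_mul_assoc, inv_smul_smul₀ (sub_inv_ne_zero q.ne_zero hq2), mul_assoc, h.ainv_a,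
        mul_one]
    rw [this]
    exact S.smul_mem (S.mul_mem (hs (by simp)) (hs (by simp))) _
  intro x hx
  simp only [Set.mem_insert_iff, Set.mem_singleton_iff] at hx
  rcases hx with rfl | rfl | rfl | rfl | rfl | rfl | rfl | rfl
  all_goals first | exact hF | exact hs (by simp)

/-- K is invertible, so E and F are recovered from the mirrored generators. -/
theorem adjoin_mirror_eq_top (h : IsDqSystem (q : k) a ainv b c K Kinv E F)
    (hgen : Algebra.adjoin k {a, ainv, b, c, K, Kinv, E, F} = ⊤) :
    Algebra.adjoin k {ainv, a, c, b, K, Kinv, (q : k)⁻¹ • (F * K), (q : k)⁻¹ • (E * Kinv)} = ⊤ := by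
  rw [eq_top_iff, ← hgen, Algebra.adjoin_le_iff]
  set S := Algebra.adjoin k
    {ainv, a, c, b, K, Kinv, (q : k)⁻¹ • (F * K), (q : k)⁻¹ • (E * Kinv)}
  have hs := Algebra.subset_adjoin (R := k)
    (s := {ainv, a, c, b, K, Kinv, (q : k)⁻¹ • (F * K), (q : k)⁻¹ • (E * Kinv)})
  have hF : F ∈ S := by
    have : F = (q : k) • (((q : k)⁻¹ • (F * K)) * Kinv) := by
      rw [smul_mul_assoc, smul_inv_smul₀ q.ne_zero, mul_assoc, h.K_Kinv, mul_one]
    rw [this]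
    exact S.smul_mem (S.mul_mem (hs (by simp)) (hs (by simp))) _
  have hE : E ∈ S := by
    have : E = (q : k) • (((q : k)⁻¹ • (E * Kinv)) * K) := by
      rw [smul_mul_assoc, smul_inv_smul₀ q.ne_zero, mul_assoc, h.Kinv_K, mul_one]
    rw [this]
    exact S.smul_mem (S.mul_mem (hs (by simp)) (hs (by simp))) _
  intro x hx
  simp only [Set.mem_insert_iff, Set.mem_singleton_iff] at hx
  rcases hx with rfl | rfl | rfl | rfl | rfl | rfl | rfl | rfl
  all_goals first | exact hF | exact hE | exact hs (by simp)

/-- If `φ = 0` and `ψ = α b` for a scalar `α`, then the algebra is a simple domain. -/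
theorem isDomain_and_isSimpleRing (hq : ∀ n : ℕ, 0 < n → (q : k) ^ n ≠ 1)
    (h : IsDqSystem (q : k) a ainv b c K Kinv E F)
    (hgen : Algebra.adjoin k {a, ainv, b, c, K, Kinv, E, F} = ⊤)
    (hphi : phiElt (q : k) a b F = 0) {α : k} (hpsi : psiElt (q : k) ainv c K E = α • b)
    (f : A →ₐ[k] QTorus q k) (fa : f a = QTorus.single (1, 0, 0, 0) 1)
    (fb : f b = QTorus.single (0, 1, 0, 0) 1) (fc : f c = QTorus.single (0, 0, 1, 0) 1)
    (fK : f K = QTorus.single (0, 0, 0, 1) 1) : IsDomain A ∧ IsSimpleRing A := by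
  have hr : IsTorusRealization q (Algebra.ofId k A) f α a ainv b
      (((q : k) - (q : k)⁻¹) • (F * ainv)) c K Kinv E :=
    { isPhiSystem_of_phiElt_eq_zero q.ne_zero (hq 2 two_pos) h hphi with
      central := fun t x => Algebra.commutes t x
      psi_eq := by rw [hpsi, Algebra.ofId_apply, ← Algebra.smul_def]
      adjoin_eq_top := adjoin_binv_eq_top (hq 2 two_pos) h hgen
      map_a := fa
      map_b := fb
      map_c := fc
      map_K := fK
      map_rho := fun t => by
        rw [Algebra.ofId_apply, f.commutes] }
  exact ⟨hr.isDomain hq, hr.isSimpleRing hq fun t ht => isUnit_iff_ne_zero.2 ht⟩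

open Polynomial in
/-- If `φ = 0` and `ψ` is generic, then the algebra is a domain with centre `k[ψ b⁻¹]`. -/
theorem isDomain_and_center (hq : ∀ n : ℕ, 0 < n → (q : k) ^ n ≠ 1)
    (h : IsDqSystem (q : k) a ainv b c K Kinv E F)
    (hgen : Algebra.adjoin k {a, ainv, b, c, K, Kinv, E, F} = ⊤)
    (hphi : phiElt (q : k) a b F = 0)
    (f : A →ₐ[k] QTorus q k[X]) (fa : f a = QTorus.single (1, 0, 0, 0) 1)
    (fb : f b = QTorus.single (0, 1, 0, 0) 1) (fc : f c = QTorus.single (0, 0, 1, 0) 1)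
    (fK : f K = QTorus.single (0, 0, 0, 1) 1)
    (fpsi : f (psiElt (q : k) ainv c K E) =
      algebraMap k[X] _ X * QTorus.single (0, 1, 0, 0) 1) :
    IsDomain A ∧ ∃ (u : Aˣ) (Θ : A), (u : A) = b ∧ Θ = psiElt (q : k) ainv c K E * ↑u⁻¹ ∧
      Subalgebra.center k A = Algebra.adjoin k {Θ} ∧ Transcendental k Θ := by
  have hs := isPhiSystem_of_phiElt_eq_zero q.ne_zero (hq 2 two_pos) h hphi
  have hgen' := adjoin_binv_eq_top (hq 2 two_pos) h hgen
  set binv := ((q : k) - (q : k)⁻¹) • (F * ainv)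
  set ψ := psiElt (q : k) ainv c K E
  set Θ := ψ * binv with hΘ
  have hq0 := q.ne_zero
  have comm_inv : ∀ {x y : A}, x * y = 1 → y * x = 1 → Commute x Θ → Commute y Θ := by
    intro x y h1 h2 hx
    exact ((QComm.of_commute (k := k) hx).inv_left one_ne_zero h1 h2 |>.congr inv_one).commute
  -- With each of the generators a, b, c, K, E, the elements ψ and b have the same commutation
  -- scalar, so the quotient Θ commutes with it.
  have ca : Commute a Θ := (((h.a_psiElt hq0).mul_right
    (h.ab.inv_right hq0 hs.b_binv hs.binv_b)).congr (by simp)).commute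
  have cb : Commute b Θ := (((h.b_psiElt hq0).mul_right
    ((QComm.refl b).inv_right one_ne_zero hs.b_binv hs.binv_b)).congr (by simp)).commute
  have cc : Commute c Θ := (((h.c_psiElt hq0).mul_right
    ((h.bc.symm one_ne_zero).inv_right (by simp) hs.b_binv hs.binv_b)).congr (by simp)).commute
  have cK : Commute K Θ := (((h.K_psiElt hq0).mul_right
    (h.Kb.inv_right hq0 hs.b_binv hs.binv_b)).congr (by simp)).commute
  have cE : Commute E Θ := (((h.E_psiElt hq0).mul_right
    (h.Eb.inv_right one_ne_zero hs.b_binv hs.binv_b)).congr (by simp)).commute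
  have hcen : ∀ x, Commute x Θ := by
    intro x
    have hx : x ∈ Algebra.adjoin k {a, ainv, b, binv, c, K, Kinv, E} := hgen' ▸ Algebra.mem_top
    induction hx using Algebra.adjoin_induction with
    | mem x hx =>
      simp only [Set.mem_insert_iff, Set.mem_singleton_iff] at hx
      rcases hx with rfl | rfl | rfl | rfl | rfl | rfl | rfl | rfl
      exacts [ca, comm_inv h.a_ainv h.ainv_a ca, cb, comm_inv hs.b_binv hs.binv_b cb, cc, cK,
        comm_inv h.K_Kinv h.Kinv_K cK, cE]
    | algebraMap r => exact Algebra.commutes r _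
    | add x y _ _ hx hy => exact hx.add_left hy
    | mul x y _ _ hx hy => exact hx.mul_left hy
  have hadj : Algebra.adjoin k {Θ} ≤ Subalgebra.center k A := by
    rw [Algebra.adjoin_le_iff, Set.singleton_subset_iff, SetLike.mem_coe,
      Subalgebra.mem_center_iff]
    exact fun x => (hcen x).eq
  have hcen' : ∀ (p : k[X]) x, Commute (aeval Θ p) x := fun p x =>
    (Subalgebra.mem_center_iff.1 (hadj (aeval_mem_adjoin_singleton k Θ)) x).symm
  -- The map sends ψ to X times the image of b, so Θ goes to the indeterminate itself.
  have fΘ : f Θ = algebraMap k[X] _ X := by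
    rw [hΘ, map_mul, fpsi, ← fb, mul_assoc, ← map_mul, hs.b_binv, map_one, mul_one]
  have frho : ∀ p : k[X], f (aeval Θ p) = algebraMap k[X] _ p := by
    intro p
    rw [← aeval_algHom_apply, fΘ, aeval_algebraMap_apply, aeval_X_left_apply]
  have hr : IsTorusRealization q (aeval Θ) f X a ainv b binv c K Kinv E :=
    { hs with
      central := hcen'
      psi_eq := by rw [aeval_X, hΘ, mul_assoc, hs.binv_b, mul_one]
      adjoin_eq_top := hgen'
      map_a := fa
      map_b := fb
      map_c := fc
      map_K := fK
      map_rho := frho }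
  refine ⟨hr.isDomain hq, ⟨b, binv, hs.b_binv, hs.binv_b⟩, Θ, rfl, rfl, ?_, ?_⟩
  · ext w
    rw [hr.mem_center_iff hq, Algebra.adjoin_singleton_eq_range_aeval]
    rfl
  -- A polynomial p in Θ is sent to p itself, seen as a scalar of the torus over k[X].
  · rw [transcendental_iff]
    intro p hp
    have := frho p
    rw [hp, map_zero] at this
    exact (map_eq_zero_iff _ (QTorus.algebraMap_injective q)).1 this.symm

end Packages

/-! ### Quantum polynomial algebras -/

namespace QuantumPolynomial

variable {k : Type*} [Field k] {n : ℕ} {Q : Matrix (Fin n) (Fin n) k} {r : ℕ}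
  {P : Type*} [Ring P] [Algebra k P]

/-- The projection from the free algebra. -/
def mk (Q : Matrix (Fin n) (Fin n) k) (r : ℕ) :
    FreeAlgebra k (Fin n ⊕ {i : Fin n // i.val < r}) →ₐ[k] QuantumPolynomial Q r :=
  RingQuot.mkAlgHom k (Rel Q r)

theorem mk_rel {x y : FreeAlgebra k (Fin n ⊕ {i : Fin n // i.val < r})} (h : Rel Q r x y) :
    mk Q r x = mk Q r y := RingQuot.mkAlgHom_rel k h

theorem qcomm_X (i j : Fin n) : QComm (Q i j) (X Q r i) (X Q r j) := by
  have := mk_rel (Rel.comm (Q := Q) (r := r) i j)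
  rwa [map_mul, map_smul, map_mul] at this

theorem X_mul_Xinv (i : Fin n) (hi : i.val < r) : X Q r i * Xinv Q r i hi = 1 := by
  have := mk_rel (Rel.mul_inv (Q := Q) (r := r) ⟨i, hi⟩)
  rwa [map_mul, map_one] at this

theorem Xinv_mul_X (i : Fin n) (hi : i.val < r) : Xinv Q r i hi * X Q r i = 1 := by
  have := mk_rel (Rel.inv_mul (Q := Q) (r := r) ⟨i, hi⟩)
  rwa [map_mul, map_one] at this

/-- The universal property of a quantum polynomial algebra. -/
def lift (t tinv : Fin n → P) (comm : ∀ i j, QComm (Q i j) (t i) (t j))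
    (mul_inv : ∀ i, i.val < r → t i * tinv i = 1)
    (inv_mul : ∀ i, i.val < r → tinv i * t i = 1) : QuantumPolynomial Q r →ₐ[k] P :=
  RingQuot.liftAlgHom k ⟨FreeAlgebra.lift k (Sum.elim t fun i => tinv i.1), by
    intro x y hxy
    cases hxy with
    | comm i j => simpa using (comm i j).eq
    | mul_inv i => simpa using mul_inv i.1 i.2
    | inv_mul i => simpa using inv_mul i.1 i.2⟩

section

variable (t tinv : Fin n → P) (comm : ∀ i j, QComm (Q i j) (t i) (t j))
  (mul_inv : ∀ i, i.val < r → t i * tinv i = 1) (inv_mul : ∀ i, i.val < r → tinv i * t i = 1)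

theorem lift_X (i : Fin n) : lift t tinv comm mul_inv inv_mul (X Q r i) = t i := by
  refine (RingQuot.liftAlgHom_mkAlgHom_apply k _ _ _).trans ?_
  exact FreeAlgebra.lift_ι_apply _ _

theorem lift_Xinv (i : Fin n) (hi : i.val < r) :
    lift t tinv comm mul_inv inv_mul (Xinv Q r i hi) = tinv i := by
  refine (RingQuot.liftAlgHom_mkAlgHom_apply k _ _ _).trans ?_
  exact FreeAlgebra.lift_ι_apply _ _

end

@[elab_as_elim]
theorem induction {p : QuantumPolynomial Q r → Prop} (x : QuantumPolynomial Q r)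
    (algebraMap : ∀ s, p (algebraMap k _ s)) (X : ∀ i, p (X Q r i))
    (Xinv : ∀ i hi, p (Xinv Q r i hi)) (add : ∀ x y, p x → p y → p (x + y))
    (mul : ∀ x y, p x → p y → p (x * y)) : p x := by
  obtain ⟨y, rfl⟩ : ∃ y, mk Q r y = x := RingQuot.mkAlgHom_surjective k (Rel Q r) x
  induction y using FreeAlgebra.induction with
  | grade0 s => rw [AlgHom.commutes]; exact algebraMap s
  | grade1 g =>
    rcases g with i | ⟨i, hi⟩
    · exact X i
    · exact Xinv i hi
  | mul x y hx hy => rw [map_mul]; exact mul _ _ hx hy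
  | add x y hx hy => rw [map_add]; exact add _ _ hx hy

/-- A commutation rule need only be checked on the indeterminates. -/
theorem semiconj_of_X {f g : QuantumPolynomial Q r →ₐ[k] P} {z : P}
    (h : ∀ i, z * f (X Q r i) = g (X Q r i) * z) (x : QuantumPolynomial Q r) :
    z * f x = g x * z := by
  induction x using induction with
  | algebraMap s => rw [AlgHom.commutes, AlgHom.commutes, Algebra.commutes]
  | X i => exact h i
  | Xinv i hi =>
    calc z * f (Xinv Q r i hi)
        = g (Xinv Q r i hi) * (g (X Q r i) * z) * f (Xinv Q r i hi) := by
          rw [← mul_assoc (g _), ← map_mul, Xinv_mul_X, map_one, one_mul]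
      _ = g (Xinv Q r i hi) * z := by
          rw [← h, mul_assoc, mul_assoc, ← map_mul, X_mul_Xinv, map_one, mul_one]
  | add x y hx hy => rw [map_add, map_add, mul_add, add_mul, hx, hy]
  | mul x y hx hy => rw [map_mul, map_mul, ← mul_assoc, hx, mul_assoc, hy, mul_assoc]

/-- The case z = 1 of the commutation rule: the images of the inverses X_i⁻¹ are forced. -/
theorem algHom_ext {f g : QuantumPolynomial Q r →ₐ[k] P}
    (h : ∀ i, f (X Q r i) = g (X Q r i)) : f = g := by
  ext x
  have := semiconj_of_X (f := f) (g := g) (z := 1) (fun i => by rw [h, one_mul, mul_one]) x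
  rwa [one_mul, mul_one] at this

/-- The homomorphism that multiplies the indeterminates by scalars. -/
def scaleHom (w : Fin n → kˣ) : QuantumPolynomial Q r →ₐ[k] QuantumPolynomial Q r :=
  lift (fun i => (w i : k) • X Q r i)
    (fun i => if hi : i.val < r then ((w i)⁻¹ : kˣ) • Xinv Q r i hi else 0)
    (fun i j => ((qcomm_X i j).smul_left _).smul_right _)
    (fun i hi => by
      simp only [hi, dif_pos]
      rw [Units.smul_def, smul_mul_smul_comm, X_mul_Xinv, ← Units.val_mul, mul_inv_cancel,
        Units.val_one, one_smul])
    (fun i hi => by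
      simp only [hi, dif_pos]
      rw [Units.smul_def, smul_mul_smul_comm, Xinv_mul_X, ← Units.val_mul, inv_mul_cancel,
        Units.val_one, one_smul])

theorem scaleHom_X (w : Fin n → kˣ) (i : Fin n) :
    scaleHom w (X Q r i) = (w i : k) • X Q r i := lift_X _ _ _ _ _ i

/-- The automorphism that multiplies the indeterminates by scalars. -/
def scale (w : Fin n → kˣ) : QuantumPolynomial Q r ≃ₐ[k] QuantumPolynomial Q r :=
  AlgEquiv.ofAlgHom (scaleHom w) (scaleHom w⁻¹)
    (algHom_ext fun i => by
      rw [AlgHom.comp_apply, scaleHom_X, map_smul, scaleHom_X, smul_smul, Pi.inv_apply,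
        ← Units.val_mul, inv_mul_cancel, Units.val_one, one_smul, AlgHom.id_apply])
    (algHom_ext fun i => by
      rw [AlgHom.comp_apply, scaleHom_X, map_smul, scaleHom_X, smul_smul, Pi.inv_apply,
        ← Units.val_mul, mul_inv_cancel, Units.val_one, one_smul, AlgHom.id_apply])

theorem scale_X (w : Fin n → kˣ) (i : Fin n) :
    scale w (X Q r i) = (w i : k) • X Q r i := scaleHom_X w i

theorem scale_Xinv (w : Fin n → kˣ) (i : Fin n) (hi : i.val < r) :
    scale w (Xinv Q r i hi) = (w i : k)⁻¹ • Xinv Q r i hi := by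
  have h1 : scale w (X Q r i) * scale w (Xinv Q r i hi) = 1 := by
    rw [← map_mul, X_mul_Xinv, map_one]
  have h2 : ((w i : k)⁻¹ • Xinv Q r i hi) * scale w (X Q r i) = 1 := by
    rw [scale_X, smul_mul_smul_comm, Xinv_mul_X, inv_mul_cancel₀ (w i).ne_zero, one_smul]
  exact (left_inv_eq_right_inv h2 h1).symm

/-- The conditions for a GGWA over a quantum polynomial algebra with scaling automorphisms. -/
theorem isGGWADatum_scale {u w : Fin n → kˣ} {x : QuantumPolynomial Q r}
    (h : scale w (scale u x) = x) (hx : ∀ i, QComm ((u i : k) * w i) x (X Q r i)) :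
    IsGGWADatum (scale (Q := Q) (r := r) u : QuantumPolynomial Q r →ₐ[k] QuantumPolynomial Q r)
      (scale (Q := Q) (r := r) w : QuantumPolynomial Q r →ₐ[k] QuantumPolynomial Q r) x := by
  have key : ∀ y, x * y = scale w (scale u y) * x := by
    intro y
    refine semiconj_of_X (f := AlgHom.id k _)
      (g := ((scale w : QuantumPolynomial Q r ≃ₐ[k] _) :
        QuantumPolynomial Q r →ₐ[k] _).comp (scale u : QuantumPolynomial Q r ≃ₐ[k] _))
      (fun i => ?_) y
    change x * X Q r i = scale w (scale u (X Q r i)) * x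
    rw [(hx i).eq, scale_X, map_smul, scale_X, smul_smul, smul_mul_assoc]
  refine ⟨h, key, fun y => ?_⟩
  -- As σ is surjective, the condition on σ(x) is the image under σ of the condition on x.
  obtain ⟨y, rfl⟩ := (scale (Q := Q) (r := r) u).surjective y
  change scale u x * scale u y = scale u (scale w (scale u y)) * scale u x
  rw [← map_mul, key, map_mul]

end QuantumPolynomial

/-! ### Generalized generalized Weyl algebras -/

namespace GGWA

variable {k R : Type*} [Field k] [Ring R] [Algebra k R] {σ τ : R →ₐ[k] R} {e : R}
  {P : Type*} [Ring P] [Algebra k P]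

/-- The projection from the free algebra. -/
def mk (σ τ : R →ₐ[k] R) (e : R) : FreeAlgebra k (R ⊕ Bool) →ₐ[k] GGWA σ τ e :=
  RingQuot.mkAlgHom k (Rel σ τ e)

theorem mk_rel {x y : FreeAlgebra k (R ⊕ Bool)} (h : Rel σ τ e x y) :
    mk σ τ e x = mk σ τ e y := RingQuot.mkAlgHom_rel k h

/-- The homomorphism from the base ring. -/
def ofHom (σ τ : R →ₐ[k] R) (e : R) : R →ₐ[k] GGWA σ τ e where
  toFun := of σ τ e
  map_one' := by
    have := mk_rel (Rel.of_scalar (σ := σ) (τ := τ) (a := e) (1 : k))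
    rwa [map_one, map_one, map_one] at this
  map_zero' := by
    have := mk_rel (Rel.of_scalar (σ := σ) (τ := τ) (a := e) (0 : k))
    rwa [map_zero, map_zero, map_zero] at this
  map_mul' x y := by
    have := mk_rel (Rel.of_mul (σ := σ) (τ := τ) (a := e) x y)
    rwa [map_mul] at this
  map_add' x y := by
    have := mk_rel (Rel.of_add (σ := σ) (τ := τ) (a := e) x y)
    rwa [map_add] at this
  commutes' s := by
    have := mk_rel (Rel.of_scalar (σ := σ) (τ := τ) (a := e) s)
    rwa [AlgHom.commutes] at this

theorem x_mul_of (s : R) : x σ τ e * ofHom σ τ e s = ofHom σ τ e (σ s) * x σ τ e := by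
  have := mk_rel (Rel.x_mul (σ := σ) (τ := τ) (a := e) s)
  rwa [map_mul, map_mul] at this

theorem y_mul_of (s : R) : y σ τ e * ofHom σ τ e s = ofHom σ τ e (τ s) * y σ τ e := by
  have := mk_rel (Rel.y_mul (σ := σ) (τ := τ) (a := e) s)
  rwa [map_mul, map_mul] at this

theorem y_mul_x : y σ τ e * x σ τ e = ofHom σ τ e e := by
  have := mk_rel (Rel.y_mul_x (σ := σ) (τ := τ) (a := e))
  rwa [map_mul] at this

theorem x_mul_y : x σ τ e * y σ τ e = ofHom σ τ e (σ e) := by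
  have := mk_rel (Rel.x_mul_y (σ := σ) (τ := τ) (a := e))
  rwa [map_mul] at this

/-- The universal property of a GGWA. -/
def lift (g : R →ₐ[k] P) (X Y : P) (hX : ∀ s, X * g s = g (σ s) * X)
    (hY : ∀ s, Y * g s = g (τ s) * Y) (hYX : Y * X = g e) (hXY : X * Y = g (σ e)) :
    GGWA σ τ e →ₐ[k] P :=
  RingQuot.liftAlgHom k ⟨FreeAlgebra.lift k (Sum.elim g fun i => bif i then Y else X), by
    intro x y hxy
    cases hxy with
    | of_scalar t => simp
    | of_add r s => simp
    | of_mul r s => simp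
    | x_mul r => simpa using hX r
    | y_mul r => simpa using hY r
    | y_mul_x => simpa using hYX
    | x_mul_y => simpa using hXY⟩

section

variable (g : R →ₐ[k] P) (X Y : P) (hX : ∀ s, X * g s = g (σ s) * X)
  (hY : ∀ s, Y * g s = g (τ s) * Y) (hYX : Y * X = g e) (hXY : X * Y = g (σ e))

theorem lift_of (s : R) : lift g X Y hX hY hYX hXY (ofHom σ τ e s) = g s := by
  refine (RingQuot.liftAlgHom_mkAlgHom_apply k _ _ _).trans ?_
  exact FreeAlgebra.lift_ι_apply _ _

theorem lift_x : lift g X Y hX hY hYX hXY (x σ τ e) = X := by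
  refine (RingQuot.liftAlgHom_mkAlgHom_apply k _ _ _).trans ?_
  exact FreeAlgebra.lift_ι_apply _ _

theorem lift_y : lift g X Y hX hY hYX hXY (y σ τ e) = Y := by
  refine (RingQuot.liftAlgHom_mkAlgHom_apply k _ _ _).trans ?_
  exact FreeAlgebra.lift_ι_apply _ _

end

theorem algHom_ext {f g : GGWA σ τ e →ₐ[k] P}
    (h : f.comp (ofHom σ τ e) = g.comp (ofHom σ τ e)) (hx : f (x σ τ e) = g (x σ τ e))
    (hy : f (y σ τ e) = g (y σ τ e)) : f = g := by
  ext z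
  obtain ⟨w, rfl⟩ : ∃ w, mk σ τ e w = z := RingQuot.mkAlgHom_surjective k (Rel σ τ e) z
  induction w using FreeAlgebra.induction with
  | grade0 s => rw [AlgHom.commutes, AlgHom.commutes, AlgHom.commutes]
  | grade1 i =>
    rcases i with s | _ | _
    · exact DFunLike.congr_fun h s
    · exact hx
    · exact hy
  | mul x y hx hy => rw [map_mul, map_mul, map_mul, hx, hy]
  | add x y hx hy => rw [map_add, map_add, map_add, hx, hy]

end GGWA

/-! ### GGWAs whose endomorphisms scale the indeterminates -/

section ScaleGGWA

open QuantumPolynomial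

variable {k : Type*} [Field k] {n : ℕ} {Q : Matrix (Fin n) (Fin n) k} {r : ℕ}
  {A : Type*} [Ring A] [Algebra k A] {u w : Fin n → kˣ} {e : QuantumPolynomial Q r}

/-- The GGWA over a quantum polynomial algebra with scaling automorphisms. -/
abbrev ScaleGGWA (u w : Fin n → kˣ) (e : QuantumPolynomial Q r) :=
  GGWA (scale (Q := Q) (r := r) u : QuantumPolynomial Q r →ₐ[k] QuantumPolynomial Q r)
    (scale (Q := Q) (r := r) w : QuantumPolynomial Q r →ₐ[k] QuantumPolynomial Q r) e

namespace ScaleGGWA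

/-- The homomorphism from the base ring. -/
abbrev base (u w : Fin n → kˣ) (e : QuantumPolynomial Q r) :
    QuantumPolynomial Q r →ₐ[k] ScaleGGWA u w e := GGWA.ofHom _ _ _

/-- The generator `x`. -/
abbrev x (u w : Fin n → kˣ) (e : QuantumPolynomial Q r) : ScaleGGWA u w e := GGWA.x _ _ _

/-- The generator `y`. -/
abbrev y (u w : Fin n → kˣ) (e : QuantumPolynomial Q r) : ScaleGGWA u w e := GGWA.y _ _ _

theorem qcomm_x (i : Fin n) : QComm (u i : k) (x u w e) (base u w e (X Q r i)) := by
  rw [QComm, GGWA.x_mul_of]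
  change GGWA.ofHom _ _ _ (scale u (X Q r i)) * _ = _
  rw [scale_X, map_smul, smul_mul_assoc]

theorem qcomm_y (i : Fin n) : QComm (w i : k) (y u w e) (base u w e (X Q r i)) := by
  rw [QComm, GGWA.y_mul_of]
  change GGWA.ofHom _ _ _ (scale w (X Q r i)) * _ = _
  rw [scale_X, map_smul, smul_mul_assoc]

theorem y_mul_x : y u w e * x u w e = base u w e e := GGWA.y_mul_x

theorem x_mul_y : x u w e * y u w e = base u w e (scale u e) := GGWA.x_mul_y

/-- A criterion for a homomorphism to a GGWA to be an isomorphism. -/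
theorem exists_equiv (h : A →ₐ[k] ScaleGGWA u w e) (g : QuantumPolynomial Q r →ₐ[k] A)
    (x' y' : A) (hx : ∀ i, QComm (u i : k) x' (g (X Q r i)))
    (hy : ∀ i, QComm (w i : k) y' (g (X Q r i)))
    (hyx : y' * x' = g e) (hxy : x' * y' = g (scale u e))
    (hgX : ∀ i, h (g (X Q r i)) = base u w e (X Q r i))
    (hhx : h x' = x u w e) (hhy : h y' = y u w e)
    (hext : ∀ f : A →ₐ[k] A, (∀ i, f (g (X Q r i)) = g (X Q r i)) → f x' = x' → f y' = y' →
      f = AlgHom.id k A) :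
    ∃ E : A ≃ₐ[k] ScaleGGWA u w e, ∀ z, E z = h z := by
  have key : ∀ (v : Fin n → kˣ) (z : A), (∀ i, QComm (v i : k) z (g (X Q r i))) →
      ∀ s, z * g s = g (scale v s) * z := by
    intro v z hz s
    refine semiconj_of_X (f := g)
      (g := g.comp ((scale v : QuantumPolynomial Q r ≃ₐ[k] _) :
        QuantumPolynomial Q r →ₐ[k] _)) (fun i => ?_) s
    change z * g (X Q r i) = g (scale v (X Q r i)) * z
    rw [(hz i).eq, scale_X, map_smul, smul_mul_assoc]
  -- The candidate inverse, provided by the universal property of the GGWA. `hext` is the assertion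
  -- that an endomorphism of A is determined by the elements in question.
  set back : ScaleGGWA u w e →ₐ[k] A :=
    GGWA.lift g x' y' (key u x' hx) (key w y' hy) hyx hxy
  have bof : ∀ s, back (base u w e s) = g s := GGWA.lift_of _ _ _ _ _ _ _
  have bx : back (x u w e) = x' := GGWA.lift_x _ _ _ _ _ _ _
  have bY : back (y u w e) = y' := GGWA.lift_y _ _ _ _ _ _ _
  refine ⟨AlgEquiv.ofAlgHom h back ?_ ?_, fun z => rfl⟩
  · refine GGWA.algHom_ext (QuantumPolynomial.algHom_ext fun i => ?_) ?_ ?_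
    · change h (back (base u w e (X Q r i))) = base u w e (X Q r i)
      rw [bof, hgX]
    · change h (back (x u w e)) = x u w e
      rw [bx, hhx]
    · change h (back (y u w e)) = y u w e
      rw [bY, hhy]
  · refine hext _ (fun i => ?_) ?_ ?_
    · rw [AlgHom.comp_apply, hgX, bof]
    · rw [AlgHom.comp_apply, hhx, bx]
    · rw [AlgHom.comp_apply, hhy, bY]

end ScaleGGWA

end ScaleGGWA

/-! ### Factor algebras of `D_q` as GGWAs -/

section Ext

variable {k A P : Type*} [Field k] [Ring A] [Algebra k A] [Ring P] [Algebra k P]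

theorem AlgHom.eq_of_mul_eq_one {f g : A →ₐ[k] P} {x y : A} (h : x * y = 1) (h' : y * x = 1)
    (hx : f x = g x) : f y = g y := by
  refine left_inv_eq_right_inv (a := f x) ?_ ?_
  · rw [← map_mul, h', map_one]
  · rw [hx, ← map_mul, h, map_one]

theorem IsPhiSystem.algHom_ext {q : k} {a ainv b binv c K Kinv E : A}
    (h : IsPhiSystem q a ainv b binv c K Kinv E)
    (hgen : Algebra.adjoin k {a, ainv, b, binv, c, K, Kinv, E} = ⊤) {f g : A →ₐ[k] P}
    (ha : f a = g a) (hb : f b = g b) (hc : f c = g c) (hK : f K = g K) (hE : f E = g E) :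
    f = g := by
  refine AlgHom.ext_of_adjoin_eq_top hgen fun x hx => ?_
  simp only [Set.mem_insert_iff, Set.mem_singleton_iff] at hx
  rcases hx with rfl | rfl | rfl | rfl | rfl | rfl | rfl | rfl
  exacts [ha, AlgHom.eq_of_mul_eq_one h.a_ainv h.ainv_a ha, hb,
    AlgHom.eq_of_mul_eq_one h.b_binv h.binv_b hb, hc, hK,
    AlgHom.eq_of_mul_eq_one h.K_Kinv h.Kinv_K hK, hE]

/-- The inverse of `IsDqSystem.mirror`. -/
theorem IsDqSystem.of_mirror {q : k} {a ainv b c K Kinv F F' : A} (hq : q ≠ 0)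
    (h : IsDqSystem q⁻¹ ainv a c b K Kinv (q⁻¹ • (F * K)) F') :
    IsDqSystem q a ainv b c K Kinv (q • (F' * K)) F := by
  have := h.mirror (inv_ne_zero hq)
  rwa [inv_inv, smul_mul_assoc, smul_inv_smul₀ hq, mul_assoc, h.K_Kinv, mul_one] at this

/-- From a system with `c` invertible one obtains a system with `ψ = 0`. -/
theorem IsPhiSystem.exists_isDqSystem_psi {q : k} {a ainv b c cinv K Kinv F : A} (hq : q ≠ 0)
    (hq2 : q ^ 2 ≠ 1) (h : IsPhiSystem q⁻¹ ainv a c cinv b K Kinv (q⁻¹ • (F * K))) :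
    ∃ E, IsDqSystem q a ainv b c K Kinv E F ∧ psiElt q ainv c K E = 0 := by
  have hq2' : q⁻¹ ^ 2 ≠ 1 := by rwa [inv_pow, ne_eq, inv_eq_one]
  have hd := h.isDqSystem (inv_ne_zero hq) hq2'
  refine ⟨_, hd.of_mirror hq, ?_⟩
  have := psiElt_mirror (a := ainv) (F := (q⁻¹ - q⁻¹⁻¹)⁻¹ • (cinv * ainv)) (inv_ne_zero hq) hd.Kb
  rw [h.phiElt_eq_zero (inv_ne_zero hq) hq2', zero_mul, inv_inv] at this
  rw [inv_inv]
  exact this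

end Ext

/-! ### Systems of generators inside a GGWA -/

namespace ScaleGGWA

open QuantumPolynomial

variable {k : Type*} [Field k] {n : ℕ} {Q : Matrix (Fin n) (Fin n) k} {r : ℕ}
  {u w : Fin n → kˣ} {e : QuantumPolynomial Q r} {q : k} {ia ib ic iK : Fin n}

/-- With x = E and y = c, the only relation that is not a q-commutation, Ec = cE + a⁻¹K, becomes the
condition σ(e) = e + a⁻¹K on the base element. -/
theorem isPhiSystem (ha : ia.val < r) (hb : ib.val < r) (hK : iK.val < r)
    (Qab : Q ia ib = q) (QKa : Q iK ia = q⁻¹) (QKb : Q iK ib = q) (ua : (u ia : k) = 1)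
    (ub : (u ib : k) = 1) (uK : (u iK : k) = q ^ (-2 : ℤ)) (wa : (w ia : k) = q⁻¹)
    (wb : (w ib : k) = 1) (wK : (w iK : k) = q)
    (he : scale u e = e + Xinv Q r ia ha * X Q r iK) :
    IsPhiSystem q (base u w e (X Q r ia)) (base u w e (Xinv Q r ia ha))
      (base u w e (X Q r ib)) (base u w e (Xinv Q r ib hb)) (y u w e)
      (base u w e (X Q r iK)) (base u w e (Xinv Q r iK hK)) (x u w e) where
  a_ainv := by rw [← map_mul, X_mul_Xinv, map_one]
  ainv_a := by rw [← map_mul, Xinv_mul_X, map_one]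
  K_Kinv := by rw [← map_mul, X_mul_Xinv, map_one]
  Kinv_K := by rw [← map_mul, Xinv_mul_X, map_one]
  b_binv := by rw [← map_mul, X_mul_Xinv, map_one]
  binv_b := by rw [← map_mul, Xinv_mul_X, map_one]
  ab := ((qcomm_X ia ib).map _).congr Qab
  ac := ((qcomm_y ia).symm (w ia).ne_zero).congr (by rw [wa, inv_inv])
  bc := ((qcomm_y ib).symm (w ib).ne_zero).congr (by rw [wb, inv_one])
  Ka := ((qcomm_X iK ia).map _).congr QKa
  Kb := ((qcomm_X iK ib).map _).congr QKb
  Kc := ((qcomm_y iK).symm (w iK).ne_zero).congr (by rw [wK])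
  KE := ((qcomm_x iK).symm (u iK).ne_zero).congr (by simp [uK, zpow_neg])
  Ea := (qcomm_x ia).congr ua
  Eb := (qcomm_x ib).congr ub
  Ec := by rw [x_mul_y, y_mul_x, he, map_add, map_mul]

/-- With x = F and y = b, the relation Fb = q⁻¹bF + a becomes σ(e) = q⁻¹e + a. The system is stated
in mirrored form because c is the invertible variable here and takes the place of b. -/
theorem isPhiSystem_mirror (hq : q ≠ 0) (ha : ia.val < r) (hc : ic.val < r) (hK : iK.val < r)
    (Qac : Q ia ic = q) (QKa : Q iK ia = q⁻¹) (QKc : Q iK ic = q⁻¹) (ua : (u ia : k) = q)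
    (uc : (u ic : k) = q) (uK : (u iK : k) = q ^ 2) (wa : (w ia : k) = q⁻¹)
    (wc : (w ic : k) = 1) (wK : (w iK : k) = q⁻¹)
    (he : scale u e = q⁻¹ • e + X Q r ia) :
    IsPhiSystem q⁻¹ (base u w e (Xinv Q r ia ha)) (base u w e (X Q r ia))
      (base u w e (X Q r ic)) (base u w e (Xinv Q r ic hc)) (y u w e)
      (base u w e (X Q r iK)) (base u w e (Xinv Q r iK hK))
      (q⁻¹ • (x u w e * base u w e (X Q r iK))) := by
  have a_ainv : base u w e (X Q r ia) * base u w e (Xinv Q r ia ha) = 1 := by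
    rw [← map_mul, X_mul_Xinv, map_one]
  have ainv_a : base u w e (Xinv Q r ia ha) * base u w e (X Q r ia) = 1 := by
    rw [← map_mul, Xinv_mul_X, map_one]
  have ac : QComm q (base u w e (X Q r ia)) (base u w e (X Q r ic)) :=
    ((qcomm_X ia ic).map _).congr Qac
  have ab : QComm q (base u w e (X Q r ia)) (y u w e) :=
    ((qcomm_y ia).symm (w ia).ne_zero).congr (by rw [wa, inv_inv])
  have Ka : QComm q⁻¹ (base u w e (X Q r iK)) (base u w e (X Q r ia)) :=
    ((qcomm_X iK ia).map _).congr QKa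
  have Kc : QComm q⁻¹ (base u w e (X Q r iK)) (base u w e (X Q r ic)) :=
    ((qcomm_X iK ic).map _).congr QKc
  have Kb : QComm q (base u w e (X Q r iK)) (y u w e) :=
    ((qcomm_y iK).symm (w iK).ne_zero).congr (by rw [wK, inv_inv])
  exact
  { a_ainv := ainv_a
    ainv_a := a_ainv
    K_Kinv := by rw [← map_mul, X_mul_Xinv, map_one]
    Kinv_K := by rw [← map_mul, Xinv_mul_X, map_one]
    b_binv := by rw [← map_mul, X_mul_Xinv, map_one]
    binv_b := by rw [← map_mul, Xinv_mul_X, map_one]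
    ab := ac.inv_left hq a_ainv ainv_a
    ac := ab.inv_left hq a_ainv ainv_a
    bc := ((qcomm_y ic).symm (w ic).ne_zero).congr (by rw [wc, inv_one])
    Ka := Ka.inv_right (inv_ne_zero hq) a_ainv ainv_a
    Kb := Kc
    Kc := Kb.congr (inv_inv q).symm
    KE := ((((qcomm_x iK).symm (u iK).ne_zero).mul_right (QComm.refl _)).smul_right _).congr
      (by rw [uK, mul_one, inv_pow])
    Ea := ((((qcomm_x ia).congr ua).inv_right hq a_ainv ainv_a |>.mul_left
      (Ka.inv_right (inv_ne_zero hq) a_ainv ainv_a)).smul_left _).congr (by simp [hq])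
    Eb := ((((qcomm_x ic).congr uc).mul_left Kc).smul_left _).congr (by simp [hq])
    Ec := by
      rw [smul_mul_assoc, mul_assoc, Kb.eq, mul_smul_comm, inv_smul_smul₀ hq, ← mul_assoc,
        x_mul_y, he, map_add, map_smul, ← y_mul_x, add_mul, smul_mul_assoc, mul_smul_comm,
        mul_assoc] }

end ScaleGGWA

namespace Dq

open QuantumPolynomial

variable {k : Type*} [Field k] {n : ℕ} {Q : Matrix (Fin n) (Fin n) k} {r : ℕ}
  {u w : Fin n → kˣ} {e P : QuantumPolynomial Q r} {q : kˣ} {ia ib ic iK : Fin n}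

/-- A factor algebra of `D_q` in which `φ = 0` is a GGWA with `x = E` and `y = c`. -/
theorem exists_equiv_of_phi (hq2 : (q : k) ^ 2 ≠ 1) {s : Set (Dq (q : k))}
    (hs : phi (q : k) ∈ s)
    (ha : ia.val < r) (hb : ib.val < r) (hK : iK.val < r)
    (Qab : Q ia ib = q) (QKa : Q iK ia = (q : k)⁻¹) (QKb : Q iK ib = q) (ua : (u ia : k) = 1)
    (ub : (u ib : k) = 1) (uK : (u iK : k) = (q : k) ^ (-2 : ℤ)) (wa : (w ia : k) = (q : k)⁻¹)
    (wb : (w ib : k) = 1) (wK : (w iK : k) = q)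
    (he : scale u e = e + Xinv Q r ia ha * X Q r iK)
    (hP : (1 - (q : k) ^ (-2 : ℤ)) • e + Xinv Q r ia ha * X Q r iK = P)
    (g : QuantumPolynomial Q r →ₐ[k] Factor s) (ga : g (X Q r ia) = proj s (a (q : k)))
    (gb : g (X Q r ib) = proj s (b (q : k))) (gK : g (X Q r iK) = proj s (K (q : k)))
    (gP : g P = proj s (psi (q : k)))
    (hkill : ∀ f : Dq (q : k) →ₐ[k] ScaleGGWA u w e,
      f (b (q : k)) = ScaleGGWA.base u w e (X Q r ib) → f (phi (q : k)) = 0 →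
      f (psi (q : k)) = ScaleGGWA.base u w e P → ∀ z ∈ s, f z = 0)
    (hE : ∀ i, QComm (u i : k) (proj s (E (q : k))) (g (X Q r i)))
    (hc : ∀ i, QComm (w i : k) (proj s (c (q : k))) (g (X Q r i)))
    (hX : ∀ f : Factor s →ₐ[k] ScaleGGWA u w e,
      f (proj s (a (q : k))) = ScaleGGWA.base u w e (X Q r ia) →
      f (proj s (b (q : k))) = ScaleGGWA.base u w e (X Q r ib) →
      f (proj s (K (q : k))) = ScaleGGWA.base u w e (X Q r iK) →
      f (proj s (psi (q : k))) = ScaleGGWA.base u w e P →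
      ∀ i, f (g (X Q r i)) = ScaleGGWA.base u w e (X Q r i)) :
    ∃ e' : Factor s ≃ₐ[k] ScaleGGWA u w e,
      e' (proj s (a (q : k))) = ScaleGGWA.base u w e (X Q r ia) ∧
      e' (proj s (b (q : k))) = ScaleGGWA.base u w e (X Q r ib) ∧
      e' (proj s (K (q : k))) = ScaleGGWA.base u w e (X Q r iK) ∧
      e' (proj s (psi (q : k))) = ScaleGGWA.base u w e P ∧
      e' (proj s (E (q : k))) = ScaleGGWA.x u w e ∧
      e' (proj s (c (q : k))) = ScaleGGWA.y u w e := by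
  have hq0 := q.ne_zero
  have hsys := ScaleGGWA.isPhiSystem (w := w) ha hb hK Qab QKa QKb ua ub uK wa wb wK he
  have hd := hsys.isDqSystem hq0 hq2
  have dphi : lift hd (phi (q : k)) = 0 := by
    rw [lift_phi, hsys.phiElt_eq_zero hq0 hq2]
  -- P is the base element standing for ψ. It may be an indeterminate or a multiple of b, so one
  -- argument serves both the generic and the specialized quotients.
  have dpsi : lift hd (psi (q : k)) = ScaleGGWA.base u w e P := by
    rw [lift_psi, hd.psiElt_eq, ScaleGGWA.y_mul_x, ← hP, map_add, map_smul, map_mul]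
  set f := factorLift s (lift hd) (hkill _ (lift_of hd .b) dphi dpsi)
  have fa : f (proj s (a (q : k))) = ScaleGGWA.base u w e (X Q r ia) := lift_of hd .a
  have fb : f (proj s (b (q : k))) = ScaleGGWA.base u w e (X Q r ib) := lift_of hd .b
  have fc : f (proj s (c (q : k))) = ScaleGGWA.y u w e := lift_of hd .c
  have fK : f (proj s (K (q : k))) = ScaleGGWA.base u w e (X Q r iK) := lift_of hd .K
  have fE : f (proj s (E (q : k))) = ScaleGGWA.x u w e := lift_of hd .E
  have fpsi : f (proj s (psi (q : k))) = ScaleGGWA.base u w e P := dpsi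
  have hF := isDqSystem_factor s
  have hphi : phiElt (q : k) (proj s (a (q : k))) (proj s (b (q : k))) (proj s (F (q : k))) = 0 := by
    rw [← proj_phi, proj_eq_zero hs]
  have gainv : g (Xinv Q r ia ha) = proj s (ainv (q : k)) := by
    refine left_inv_eq_right_inv (a := proj s (a (q : k))) ?_ hF.a_ainv
    rw [← ga, ← map_mul, Xinv_mul_X, map_one]
  -- Compare ψ = (1 - q⁻²)cE + a⁻¹K with g(P), where P = (1 - q⁻²)e + a⁻¹K, and cancel the nonzero
  -- scalar.
  have hcE : proj s (c (q : k)) * proj s (E (q : k)) = g e := by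
    have h1 := gP
    rw [← hP, map_add, map_smul, map_mul, gainv, gK, proj_psi, hF.psiElt_eq,
      add_left_inj] at h1
    exact (smul_right_injective _ (one_sub_zpow_neg_two_ne_zero hq2) h1).symm
  obtain ⟨e', he'⟩ := ScaleGGWA.exists_equiv f g (proj s (E (q : k))) (proj s (c (q : k))) hE hc hcE
    (by rw [hF.Ec, hcE, he, map_add, map_mul, gainv, gK]) (hX f fa fb fK fpsi) fE fc
    -- An endomorphism fixing a, b, K, E, c also fixes b⁻¹, and b⁻¹ replaces F as a generator.
    (fun f' h1 h2 h3 => (isPhiSystem_of_phiElt_eq_zero hq0 hq2 hF hphi).algHom_ext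
      (adjoin_binv_eq_top hq2 hF (adjoin_factor s))
      (by rw [← ga]; exact h1 ia) (by rw [← gb]; exact h1 ib) h3
      (by rw [← gK]; exact h1 iK) h2)
  exact ⟨e', by rw [he', fa], by rw [he', fb], by rw [he', fK], by rw [he', fpsi],
    by rw [he', fE], by rw [he', fc]⟩

/-- The mirrored φ times K equals ψ, which is 0 in the factor algebra, and K is invertible. -/
theorem phiElt_mirror_factor {s : Set (Dq (q : k))} (hs : psi (q : k) ∈ s) :
    phiElt (q : k)⁻¹ (proj s (ainv (q : k))) (proj s (c (q : k)))
      ((q : k)⁻¹ • (proj s (E (q : k)) * proj s (Kinv (q : k)))) = 0 := by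
  have hF := isDqSystem_factor s
  have h := hF.phiElt_mirror q.ne_zero
  rw [← proj_psi, proj_eq_zero hs] at h
  rw [← mul_one (phiElt _ _ _ _), ← hF.K_Kinv, ← mul_assoc, h, zero_mul]

/-- A factor algebra of `D_q` in which `ψ = 0` is a GGWA with `x = F` and `y = b`. -/
theorem exists_equiv_of_psi (hq2 : (q : k) ^ 2 ≠ 1) {s : Set (Dq (q : k))}
    (hs : psi (q : k) ∈ s)
    (ha : ia.val < r) (hc : ic.val < r) (hK : iK.val < r)
    (Qac : Q ia ic = q) (QKa : Q iK ia = (q : k)⁻¹) (QKc : Q iK ic = (q : k)⁻¹)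
    (ua : (u ia : k) = q) (uc : (u ic : k) = q) (uK : (u iK : k) = (q : k) ^ 2)
    (wa : (w ia : k) = (q : k)⁻¹) (wc : (w ic : k) = 1) (wK : (w iK : k) = (q : k)⁻¹)
    (he : scale u e = (q : k)⁻¹ • e + X Q r ia)
    (hP : ((q : k)⁻¹ - q) • e + X Q r ia = P)
    (g : QuantumPolynomial Q r →ₐ[k] Factor s) (ga : g (X Q r ia) = proj s (a (q : k)))
    (gc : g (X Q r ic) = proj s (c (q : k))) (gK : g (X Q r iK) = proj s (K (q : k)))
    (gP : g P = proj s (phi (q : k)))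
    (hkill : ∀ f : Dq (q : k) →ₐ[k] ScaleGGWA u w e,
      f (c (q : k)) = ScaleGGWA.base u w e (X Q r ic) →
      f (Kinv (q : k)) = ScaleGGWA.base u w e (Xinv Q r iK hK) → f (psi (q : k)) = 0 →
      f (phi (q : k)) = ScaleGGWA.base u w e P → ∀ z ∈ s, f z = 0)
    (hF : ∀ i, QComm (u i : k) (proj s (F (q : k))) (g (X Q r i)))
    (hb : ∀ i, QComm (w i : k) (proj s (b (q : k))) (g (X Q r i)))
    (hX : ∀ f : Factor s →ₐ[k] ScaleGGWA u w e,
      f (proj s (a (q : k))) = ScaleGGWA.base u w e (X Q r ia) →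
      f (proj s (c (q : k))) = ScaleGGWA.base u w e (X Q r ic) →
      f (proj s (K (q : k))) = ScaleGGWA.base u w e (X Q r iK) →
      f (proj s (phi (q : k))) = ScaleGGWA.base u w e P →
      ∀ i, f (g (X Q r i)) = ScaleGGWA.base u w e (X Q r i)) :
    ∃ e' : Factor s ≃ₐ[k] ScaleGGWA u w e,
      e' (proj s (a (q : k))) = ScaleGGWA.base u w e (X Q r ia) ∧
      e' (proj s (c (q : k))) = ScaleGGWA.base u w e (X Q r ic) ∧
      e' (proj s (K (q : k))) = ScaleGGWA.base u w e (X Q r iK) ∧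
      e' (proj s (phi (q : k))) = ScaleGGWA.base u w e P ∧
      e' (proj s (F (q : k))) = ScaleGGWA.x u w e ∧
      e' (proj s (b (q : k))) = ScaleGGWA.y u w e := by
  have hq0 := q.ne_zero
  have hsys := ScaleGGWA.isPhiSystem_mirror (w := w) hq0 ha hc hK Qac QKa QKc ua uc uK wa wc wK he
  -- The GGWA has no generator E. It is rebuilt from the inverse of c as the element forced by ψ =
  -- 0.
  obtain ⟨E', hd, hpsi⟩ := hsys.exists_isDqSystem_psi hq0 hq2
  have dpsi : lift hd (psi (q : k)) = 0 := by rw [lift_psi, hpsi]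
  have dphi : lift hd (phi (q : k)) = ScaleGGWA.base u w e P := by
    rw [lift_phi, hd.phiElt_eq hq0, ScaleGGWA.y_mul_x, ← hP, map_add, map_smul]
  set f := factorLift s (lift hd) (hkill _ (lift_of hd .c) (lift_of hd .Kinv) dpsi dphi)
  have fa : f (proj s (a (q : k))) = ScaleGGWA.base u w e (X Q r ia) := lift_of hd .a
  have fc : f (proj s (c (q : k))) = ScaleGGWA.base u w e (X Q r ic) := lift_of hd .c
  have fb : f (proj s (b (q : k))) = ScaleGGWA.y u w e := lift_of hd .b
  have fK : f (proj s (K (q : k))) = ScaleGGWA.base u w e (X Q r iK) := lift_of hd .K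
  have fF : f (proj s (F (q : k))) = ScaleGGWA.x u w e := lift_of hd .F
  have fphi : f (proj s (phi (q : k))) = ScaleGGWA.base u w e P := dphi
  have hFs := isDqSystem_factor s
  have hbF : proj s (b (q : k)) * proj s (F (q : k)) = g e := by
    have h1 := gP
    rw [← hP, map_add, map_smul, ga, proj_phi, hFs.phiElt_eq hq0, add_left_inj] at h1
    have hne : (q : k)⁻¹ - q ≠ 0 := by
      rw [← neg_sub]; exact neg_ne_zero.2 (sub_inv_ne_zero hq0 hq2)
    exact (smul_right_injective _ hne h1).symm
  have hq2' : ((q⁻¹ : kˣ) : k) ^ 2 ≠ 1 := by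
    rw [Units.val_inv_eq_inv_val, inv_pow, ne_eq, inv_eq_one]; exact hq2
  have hm := hFs.mirror hq0
  have hgen := adjoin_mirror_eq_top hFs (adjoin_factor s)
  have hphi := phiElt_mirror_factor hs
  -- The mirrored system is a system for the unit q⁻¹, so the results about φ apply to it directly.
  rw [← Units.val_inv_eq_inv_val] at hm hgen hphi
  obtain ⟨e', he'⟩ := ScaleGGWA.exists_equiv f g (proj s (F (q : k))) (proj s (b (q : k))) hF hb hbF
    (by rw [hFs.Fb, hbF, he, map_add, map_smul, ga]) (hX f fa fc fK fphi) fF fb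
    (fun f' h1 h2 h3 =>
      (isPhiSystem_of_phiElt_eq_zero q⁻¹.ne_zero hq2' hm hphi).algHom_ext
      (adjoin_binv_eq_top hq2' hm hgen)
      (AlgHom.eq_of_mul_eq_one hFs.a_ainv hFs.ainv_a (by rw [← ga]; exact h1 ia))
      (by rw [← gc]; exact h1 ic) h3 (by rw [← gK]; exact h1 iK)
      (by
        have h4 : f' (proj s (K (q : k))) = proj s (K (q : k)) := by rw [← gK]; exact h1 iK
        rw [map_smul, map_mul, h2, h4]; rfl))
  exact ⟨e', by rw [he', fa], by rw [he', fc], by rw [he', fK], by rw [he', fphi],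
    by rw [he', fF], by rw [he', fb]⟩

end Dq

/-! ### Homomorphisms to the quantum torus -/

namespace Dq

variable {k C : Type*} [Field k] [CommRing C] [Algebra k C] {q : kˣ}

theorem exists_hom_torus (hq2 : (q : k) ^ 2 ≠ 1) (α : C) :
    ∃ g : Dq (q : k) →ₐ[k] QTorus q C, g (a (q : k)) = QTorus.single (1, 0, 0, 0) 1 ∧
      g (b (q : k)) = QTorus.single (0, 1, 0, 0) 1 ∧
      g (c (q : k)) = QTorus.single (0, 0, 1, 0) 1 ∧
      g (K (q : k)) = QTorus.single (0, 0, 0, 1) 1 ∧ g (phi (q : k)) = 0 ∧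
      g (psi (q : k)) = algebraMap C _ α * QTorus.single (0, 1, 0, 0) 1 := by
  obtain ⟨ainv', Kinv', E', F', h, hphi, hpsi⟩ := QTorus.exists_isDqSystem q hq2 α
  exact ⟨lift h, lift_of h .a, lift_of h .b, lift_of h .c, lift_of h .K,
    by rw [lift_phi, hphi], by rw [lift_psi, hpsi]⟩

/-- The torus for q⁻¹ is used with a⁻¹, c, b, K as its variables in this order. Its element αc is
then the image of φK, which is why the central element is φKc⁻¹. -/
theorem exists_hom_torus_mirror (hq2 : (q : k) ^ 2 ≠ 1) (α : C) :
    ∃ g : Dq (q : k) →ₐ[k] QTorus q⁻¹ C, g (ainv (q : k)) = QTorus.single (1, 0, 0, 0) 1 ∧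
      g (c (q : k)) = QTorus.single (0, 1, 0, 0) 1 ∧
      g (b (q : k)) = QTorus.single (0, 0, 1, 0) 1 ∧
      g (K (q : k)) = QTorus.single (0, 0, 0, 1) 1 ∧ g (psi (q : k)) = 0 ∧
      g (phi (q : k) * K (q : k)) = algebraMap C _ α * QTorus.single (0, 1, 0, 0) 1 := by
  have hq2' : ((q⁻¹ : kˣ) : k) ^ 2 ≠ 1 := by
    rw [Units.val_inv_eq_inv_val, inv_pow, ne_eq, inv_eq_one]; exact hq2
  obtain ⟨ainv', Kinv', E', F', h, hphi, hpsi⟩ := QTorus.exists_isDqSystem q⁻¹ hq2' α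
  have e : ((q⁻¹ : kˣ) : k)⁻¹ = q := by rw [Units.val_inv_eq_inv_val, inv_inv]
  have h' := h.mirror q⁻¹.ne_zero
  have e1 := psiElt_mirror (a := QTorus.single (1, 0, 0, 0) 1) (F := F') q⁻¹.ne_zero h.Kb
  have e2 := h.phiElt_mirror q⁻¹.ne_zero
  rw [e] at h' e1 e2
  refine ⟨lift h', lift_of h' .ainv, lift_of h' .c, lift_of h' .b, lift_of h' .K, ?_, ?_⟩
  · rw [lift_psi, e1, hphi, zero_mul]
  · rw [map_mul, lift_phi, lift_of h' .K]
    exact e2.trans hpsi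

/-! ### Domains, centres and simplicity -/

variable (hq : ∀ n : ℕ, 0 < n → (q : k) ^ n ≠ 1)
include hq

theorem inv_pow_ne_one (n : ℕ) (hn : 0 < n) : ((q⁻¹ : kˣ) : k) ^ n ≠ 1 := by
  rw [Units.val_inv_eq_inv_val, inv_pow, ne_eq, inv_eq_one]; exact hq n hn

open Polynomial in
theorem factor_phi : IsDomain (Factor {phi (q : k)}) ∧
    ∃ (u : (Factor {phi (q : k)})ˣ) (Θ : Factor {phi (q : k)}),
      (u : Factor {phi (q : k)}) = proj _ (b (q : k)) ∧
      Θ = proj {phi (q : k)} (psi (q : k)) * ↑u⁻¹ ∧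
      Subalgebra.center k (Factor {phi (q : k)}) = Algebra.adjoin k {Θ} ∧
      Transcendental k Θ := by
  obtain ⟨g, ga, gb, gc, gK, gphi, gpsi⟩ := exists_hom_torus (hq 2 two_pos) (X : k[X])
  rw [proj_psi]
  refine isDomain_and_center hq (isDqSystem_factor _) (adjoin_factor _) ?_
    (factorLift _ g fun z hz => by rw [Set.mem_singleton_iff.1 hz, gphi]) ga gb gc gK ?_
  · rw [← proj_phi, proj_eq_zero (Set.mem_singleton _)]
  · rw [← proj_psi, factorLift_proj, gpsi]

-- In the mirrored system φK takes the role of ψ and c that of b, so Θ turns into φKc⁻¹.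
open Polynomial in
theorem factor_psi : IsDomain (Factor {psi (q : k)}) ∧
    ∃ (u : (Factor {psi (q : k)})ˣ) (Θ : Factor {psi (q : k)}),
      (u : Factor {psi (q : k)}) = proj _ (c (q : k)) ∧
      Θ = proj {psi (q : k)} (phi (q : k) * K (q : k)) * ↑u⁻¹ ∧
      Subalgebra.center k (Factor {psi (q : k)}) = Algebra.adjoin k {Θ} ∧
      Transcendental k Θ := by
  obtain ⟨g, ga, gc, gb, gK, gpsi, gphi⟩ := exists_hom_torus_mirror (hq 2 two_pos) (X : k[X])
  have hF := isDqSystem_factor {psi (q : k)}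
  have hm := hF.mirror q.ne_zero
  have hgen := adjoin_mirror_eq_top hF (adjoin_factor _)
  have hphi := phiElt_mirror_factor (Set.mem_singleton (psi (q : k)))
  have e := psiElt_mirror (a := proj {psi (q : k)} (a (q : k)))
    (F := proj {psi (q : k)} (F (q : k))) q.ne_zero hF.Kb
  rw [← proj_phi, ← map_mul (proj {psi (q : k)}) (phi (q : k))] at e
  rw [← Units.val_inv_eq_inv_val] at hm hgen hphi e
  rw [← e]
  refine isDomain_and_center (inv_pow_ne_one hq) hm hgen hphi
    (factorLift _ g fun z hz => by rw [Set.mem_singleton_iff.1 hz, gpsi]) ga gc gb gK ?_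
  rw [e, factorLift_proj, gphi]

theorem factor_phi_psi (α : k) :
    IsDomain (Factor {phi (q : k), psi (q : k) - α • b (q : k)}) ∧
      IsSimpleRing (Factor {phi (q : k), psi (q : k) - α • b (q : k)}) := by
  obtain ⟨g, ga, gb, gc, gK, gphi, gpsi⟩ := exists_hom_torus (hq 2 two_pos) α
  refine isDomain_and_isSimpleRing hq (isDqSystem_factor _) (adjoin_factor _) ?_ (α := α) ?_
    (factorLift _ g fun z hz => ?_) ga gb gc gK
  · rw [← proj_phi, proj_eq_zero (by simp)]
  · rw [← proj_psi, ← map_smul, ← sub_eq_zero, ← map_sub, proj_eq_zero (by simp)]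
  · rcases hz with rfl | rfl
    · exact gphi
    · rw [map_sub, gpsi, map_smul, gb, ← Algebra.smul_def, sub_eq_zero]

/-- Since K is invertible, φ = βcK⁻¹ means φK = βc, which is the mirrored form of ψ = αb. -/
theorem factor_psi_phi (β : k) :
    IsDomain (Factor {phi (q : k) - β • (c (q : k) * Kinv (q : k)), psi (q : k)}) ∧
      IsSimpleRing (Factor {phi (q : k) - β • (c (q : k) * Kinv (q : k)), psi (q : k)}) := by
  obtain ⟨g, ga, gc, gb, gK, gpsi, gphi⟩ := exists_hom_torus_mirror (hq 2 two_pos) β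
  set s : Set (Dq (q : k)) :=
    {phi (q : k) - β • (c (q : k) * Kinv (q : k)), psi (q : k)} with hs
  have hF := isDqSystem_factor s
  have hD := isDqSystem (q : k)
  have hm := hF.mirror q.ne_zero
  have hgen := adjoin_mirror_eq_top hF (adjoin_factor _)
  have hphi := phiElt_mirror_factor (s := s) (by simp [hs])
  have e := psiElt_mirror (a := proj s (a (q : k))) (F := proj s (F (q : k))) q.ne_zero hF.Kb
  have e' : proj s (phi (q : k)) = β • (proj s (c (q : k)) * proj s (Kinv (q : k))) := by
    rw [← map_mul, ← map_smul, ← sub_eq_zero, ← map_sub, proj_eq_zero (by simp [hs])]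
  rw [← proj_phi, e', smul_mul_assoc, mul_assoc, hF.Kinv_K, mul_one] at e
  rw [← Units.val_inv_eq_inv_val] at hm hgen hphi e
  refine isDomain_and_isSimpleRing (inv_pow_ne_one hq) hm hgen hphi e
    (factorLift _ g fun z hz => ?_) ga gc gb gK
  rcases hz with rfl | rfl
  · have h1 : phi (q : k) = phi (q : k) * K (q : k) * Kinv (q : k) := by
      rw [mul_assoc, hD.K_Kinv, mul_one]
    rw [map_sub, sub_eq_zero, h1, map_mul, gphi, ← gc, ← Algebra.smul_def, map_smul, map_mul,
      smul_mul_assoc]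
  · exact gpsi

omit hq

/-! ### Normality of `φ` and `ψ` -/

/-- Moving x to the right is compatible with sums and products, so normality can be tested on
generators. -/
theorem exists_mul_eq_of_of {x : Dq (q : k)} (h : ∀ g, ∃ d, x * of (q : k) g = d * x)
    (z : Dq (q : k)) : ∃ d, x * z = d * x := by
  have hz : z ∈ Algebra.adjoin k (Set.range (of (q : k))) :=
    adjoin_range_of (q : k) ▸ Algebra.mem_top
  induction hz using Algebra.adjoin_induction with
  | mem z hz => obtain ⟨g, rfl⟩ := hz; exact h g
  | algebraMap s => exact ⟨algebraMap k _ s, (Algebra.commutes s x).symm⟩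
  | add y z _ _ hy hz =>
    obtain ⟨d, hd⟩ := hy
    obtain ⟨d', hd'⟩ := hz
    exact ⟨d + d', by rw [mul_add, add_mul, hd, hd']⟩
  | mul y z _ _ hy hz =>
    obtain ⟨d, hd⟩ := hy
    obtain ⟨d', hd'⟩ := hz
    exact ⟨d * d', by rw [← mul_assoc, hd, mul_assoc, hd', mul_assoc]⟩

theorem exists_phi_mul_eq (z : Dq (q : k)) : ∃ d, phi (q : k) * z = d * phi (q : k) := by
  refine exists_mul_eq_of_of (fun g => ?_) z
  have key : ∀ {s : k} {y : Dq (q : k)}, s ≠ 0 → QComm s y (phi (q : k)) →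
      ∃ d, phi (q : k) * y = d * phi (q : k) :=
    fun hs h => ⟨_, (h.symm hs).eq.trans (smul_mul_assoc _ _ _).symm⟩
  have h := isDqSystem (q : k)
  have hq0 := q.ne_zero
  cases g
  exacts [key one_ne_zero (h.a_phiElt hq0),
    key (inv_ne_zero one_ne_zero) ((h.a_phiElt hq0).inv_left one_ne_zero h.a_ainv h.ainv_a),
    key hq0 (h.b_phiElt hq0), key (inv_ne_zero hq0) (h.c_phiElt hq0),
    key (inv_ne_zero hq0) (h.K_phiElt hq0),
    key (inv_ne_zero (inv_ne_zero hq0))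
      ((h.K_phiElt hq0).inv_left (inv_ne_zero hq0) h.K_Kinv h.Kinv_K),
    key one_ne_zero (h.E_phiElt hq0), key (inv_ne_zero hq0) (h.F_phiElt hq0)]

theorem exists_psi_mul_eq (z : Dq (q : k)) : ∃ d, psi (q : k) * z = d * psi (q : k) := by
  refine exists_mul_eq_of_of (fun g => ?_) z
  have key : ∀ {s : k} {y : Dq (q : k)}, s ≠ 0 → QComm s y (psi (q : k)) →
      ∃ d, psi (q : k) * y = d * psi (q : k) :=
    fun hs h => ⟨_, (h.symm hs).eq.trans (smul_mul_assoc _ _ _).symm⟩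
  have h := isDqSystem (q : k)
  have hq0 := q.ne_zero
  cases g
  exacts [key hq0 (h.a_psiElt hq0),
    key (inv_ne_zero hq0) ((h.a_psiElt hq0).inv_left hq0 h.a_ainv h.ainv_a),
    key one_ne_zero (h.b_psiElt hq0), key one_ne_zero (h.c_psiElt hq0),
    key hq0 (h.K_psiElt hq0),
    key (inv_ne_zero hq0) ((h.K_psiElt hq0).inv_left hq0 h.K_Kinv h.Kinv_K),
    key one_ne_zero (h.E_psiElt hq0), key hq0 (h.F_psiElt hq0)]

end Dq

/-! ### Ideals generated by normal elements -/

/-- The two-sided ideal generated by a normal element is a principal left ideal. -/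
theorem TwoSidedIdeal.mem_span_singleton_of_normal {R : Type*} [Ring R] {x : R}
    (hx : ∀ z, ∃ d, x * z = d * x) (z : R) :
    z ∈ TwoSidedIdeal.span {x} ↔ ∃ d, z = d * x := by
  constructor
  · intro hz
    let I : TwoSidedIdeal R := TwoSidedIdeal.mk' {z | ∃ d, z = d * x} ⟨0, (zero_mul x).symm⟩
      (by rintro _ _ ⟨d, rfl⟩ ⟨d', rfl⟩; exact ⟨d + d', (add_mul _ _ _).symm⟩)
      (by rintro _ ⟨d, rfl⟩; exact ⟨-d, (neg_mul _ _).symm⟩)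
      (by rintro y _ ⟨d, rfl⟩; exact ⟨y * d, (mul_assoc _ _ _).symm⟩)
      (by
        rintro _ y ⟨d, rfl⟩
        obtain ⟨d', hd'⟩ := hx y
        exact ⟨d * d', by rw [mul_assoc, hd', mul_assoc]⟩)
    have hI : ∀ y, y ∈ I ↔ ∃ d, y = d * x := fun y => TwoSidedIdeal.mem_mk' _ _ _ _ _ _ y
    exact (hI z).1 (TwoSidedIdeal.mem_span_iff.1 hz I
      (Set.singleton_subset_iff.2 ((hI x).2 ⟨1, (one_mul x).symm⟩)))
  · rintro ⟨d, rfl⟩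
    exact TwoSidedIdeal.mul_mem_left _ _ _ (TwoSidedIdeal.subset_span (Set.mem_singleton x))

/-- The two-sided ideal generated by two normal elements is a sum of principal left ideals. -/
theorem TwoSidedIdeal.mem_span_pair_of_normal {R : Type*} [Ring R] {x y : R}
    (hx : ∀ z, ∃ d, x * z = d * x) (hy : ∀ z, ∃ d, y * z = d * y) (z : R) :
    z ∈ TwoSidedIdeal.span {x, y} ↔ ∃ d d', z = d * x + d' * y := by
  constructor
  · intro hz
    let I : TwoSidedIdeal R := TwoSidedIdeal.mk' {z | ∃ d d', z = d * x + d' * y}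
      ⟨0, 0, by simp⟩
      (by rintro _ _ ⟨d, d', rfl⟩ ⟨c, c', rfl⟩; exact ⟨d + c, d' + c', by noncomm_ring⟩)
      (by rintro _ ⟨d, d', rfl⟩; exact ⟨-d, -d', by noncomm_ring⟩)
      (by rintro w _ ⟨d, d', rfl⟩; exact ⟨w * d, w * d', by noncomm_ring⟩)
      (by
        rintro _ w ⟨d, d', rfl⟩
        obtain ⟨c, hc⟩ := hx w
        obtain ⟨c', hc'⟩ := hy w
        exact ⟨d * c, d' * c', by
          rw [add_mul, mul_assoc, hc, mul_assoc, mul_assoc, hc', mul_assoc]⟩)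
    have hI : ∀ w, w ∈ I ↔ ∃ d d', w = d * x + d' * y :=
      fun w => TwoSidedIdeal.mem_mk' _ _ _ _ _ _ w
    refine (hI z).1 (TwoSidedIdeal.mem_span_iff.1 hz I ?_)
    rintro w (rfl | rfl)
    · exact (hI _).2 ⟨1, 0, by simp⟩
    · exact (hI _).2 ⟨0, 1, by simp⟩
  · rintro ⟨d, d', rfl⟩
    exact TwoSidedIdeal.add_mem _
      (TwoSidedIdeal.mul_mem_left _ _ _ (TwoSidedIdeal.subset_span (by simp)))
      (TwoSidedIdeal.mul_mem_left _ _ _ (TwoSidedIdeal.subset_span (by simp)))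

/-! ### The presentations -/

namespace Dq

open QuantumPolynomial

section Lift

variable {k A : Type*} [Field k] [Ring A] [Algebra k A] {n : ℕ} {q : k}

theorem expMatrix_antisymm : ∀ i j, expMatrix i j = -expMatrix j i := by
  intro i j
  fin_cases i <;> fin_cases j <;> rfl

/-- The exponent matrix is antisymmetric, so the relations below the diagonal follow from those
above it and the diagonal ones are trivial. -/
theorem qcomm_of_lt (hq : q ≠ 0) {v : Fin n → Fin 6} {t : Fin n → A}
    (h : ∀ i j, i < j → QComm (q ^ expMatrix (v i) (v j)) (t i) (t j)) (i j : Fin n) :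
    QComm ((qMatrix q).submatrix v v i j) (t i) (t j) := by
  change QComm (q ^ expMatrix (v i) (v j)) (t i) (t j)
  rcases lt_trichotomy i j with hij | rfl | hij
  · exact h i j hij
  · refine (QComm.refl _).congr ?_
    have := expMatrix_antisymm (v i) (v i)
    rw [show expMatrix (v i) (v i) = 0 by omega, zpow_zero]
  · refine ((h j i hij).symm (zpow_ne_zero _ hq)).congr ?_
    rw [expMatrix_antisymm (v i) (v j), zpow_neg]

theorem qcomm_X_of_eq {v : Fin n → Fin 6} {r : ℕ} {i j : Fin n} (m : ℤ)
    (h : expMatrix (v i) (v j) = m) :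
    QComm (q ^ m) (X ((qMatrix q).submatrix v v) r i) (X ((qMatrix q).submatrix v v) r j) :=
  h ▸ qcomm_X i j

theorem qcomm_Xinv_of_eq (hq : q ≠ 0) {v : Fin n → Fin 6} {r : ℕ} {i j : Fin n} (hi : i.val < r)
    (m : ℤ) (h : expMatrix (v i) (v j) = -m) :
    QComm (q ^ m) (Xinv ((qMatrix q).submatrix v v) r i hi)
      (X ((qMatrix q).submatrix v v) r j) :=
  ((qcomm_X_of_eq (-m) h).inv_left (zpow_ne_zero _ hq) (X_mul_Xinv i hi) (Xinv_mul_X i hi)).congr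
    (by rw [zpow_neg, inv_inv])

theorem qMatrix_submatrix {v : Fin n → Fin 6} {i j : Fin n} {m : ℤ}
    (h : expMatrix (v i) (v j) = m) : (qMatrix q).submatrix v v i j = q ^ m := h ▸ rfl

end Lift

variable {k : Type*} [Field k] {q : kˣ}

theorem exists_binv (hq2 : (q : k) ^ 2 ≠ 1) {s : Set (Dq (q : k))} (hs : phi (q : k) ∈ s) :
    ∃ x, proj s (b (q : k)) * x = 1 ∧ x * proj s (b (q : k)) = 1 :=
  have h := isPhiSystem_of_phiElt_eq_zero q.ne_zero hq2 (isDqSystem_factor s)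
    (by rw [← proj_phi, proj_eq_zero hs])
  ⟨_, h.b_binv, h.binv_b⟩

theorem exists_cinv (hq2 : (q : k) ^ 2 ≠ 1) {s : Set (Dq (q : k))} (hs : psi (q : k) ∈ s) :
    ∃ x, proj s (c (q : k)) * x = 1 ∧ x * proj s (c (q : k)) = 1 :=
  have h := isPhiSystem_of_phiElt_eq_zero (inv_ne_zero q.ne_zero)
    (by rwa [inv_pow, ne_eq, inv_eq_one]) ((isDqSystem_factor s).mirror q.ne_zero)
    (phiElt_mirror_factor hs)
  ⟨_, h.b_binv, h.binv_b⟩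

/-! #### `φ = 0`, `ψ` generic -/

theorem R36.scale_elt (u : Fin 4 → kˣ) : scale u (R36.elt (q : k)) =
    (1 - (q : k) ^ (-2 : ℤ))⁻¹ • ((u 3 : k) • R36.psi (q : k) -
      ((u 0 : k)⁻¹ * u 2) • (R36.ainv (q : k) * R36.K (q : k))) := by
  rw [R36.elt, map_smul, map_sub, map_mul, scale_X, scale_X, scale_Xinv, smul_mul_smul_comm]

/-- Both terms ψ and a⁻¹K of the element are fixed by τσ, and they q-commute with each variable by
the same scalar, namely the factor by which τσ scales that variable. -/
theorem R36.isGGWADatum : IsGGWADatum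
    (scale ![1, 1, q ^ (-2 : ℤ), 1] : R36 (q : k) ≃ₐ[k] R36 (q : k)).toAlgHom
    (scale ![q⁻¹, 1, q, 1] : R36 (q : k) ≃ₐ[k] R36 (q : k)).toAlgHom (R36.elt (q : k)) := by
  have hq0 := q.ne_zero
  refine isGGWADatum_scale ?_ fun i => ?_
  · rw [R36.scale_elt, map_smul, map_sub, map_smul, map_smul, map_mul, scale_X, scale_X,
      scale_Xinv, smul_mul_smul_comm, smul_smul, smul_smul, R36.elt]
    congr 2
    · simp
    · convert one_smul k _ using 2
      simp [zpow_neg]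
      field_simp
  · refine QComm.smul_left _ ?_
    fin_cases i
    · exact ((qcomm_X_of_eq (-1) rfl).congr (by simp)).sub_left
        (((qcomm_Xinv_of_eq hq0 (by decide) 0 rfl).mul_left
          (qcomm_X_of_eq (-1) rfl)).congr (by simp))
    · exact ((qcomm_X_of_eq 0 rfl).congr (by simp)).sub_left
        (((qcomm_Xinv_of_eq hq0 (by decide) (-1) rfl).mul_left
          (qcomm_X_of_eq 1 rfl)).congr (by simp))
    · exact ((qcomm_X_of_eq (-1) rfl).congr (by simp [zpow_neg]; field_simp)).sub_left
        (((qcomm_Xinv_of_eq hq0 (by decide) (-1) rfl).mul_left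
          (qcomm_X_of_eq 0 rfl)).congr (by simp [zpow_neg]; field_simp))
    · exact ((qcomm_X_of_eq 0 rfl).congr (by simp)).sub_left
        (((qcomm_Xinv_of_eq hq0 (by decide) (-1) rfl).mul_left
          (qcomm_X_of_eq 1 rfl)).congr (by simp))

/-- For s = q⁻² and y = a⁻¹K the left side is σ(e), since σ scales K by q⁻². The identity is thus
the condition σ(e) = e + a⁻¹K. -/
theorem inv_smul_sub_smul {k M : Type*} [Field k] [AddCommGroup M] [Module k M] {s : k}
    (hne : 1 - s ≠ 0) (x y : M) :
    (1 - s)⁻¹ • (x - s • y) = (1 - s)⁻¹ • (x - y) + y := by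
  apply smul_right_injective M hne
  simp only [smul_add, smul_inv_smul₀ hne, sub_smul, one_smul]
  abel

theorem exists_equiv_R36 (hq2 : (q : k) ^ 2 ≠ 1) : ∃ e : Factor {phi (q : k)} ≃ₐ[k]
    ScaleGGWA ![1, 1, q ^ (-2 : ℤ), 1] ![q⁻¹, 1, q, 1] (R36.elt (q : k)),
      e (proj _ (a (q : k))) = GGWA.of _ _ _ (R36.a (q : k)) ∧
      e (proj _ (b (q : k))) = GGWA.of _ _ _ (R36.b (q : k)) ∧
      e (proj _ (K (q : k))) = GGWA.of _ _ _ (R36.K (q : k)) ∧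
      e (proj _ (psi (q : k))) = GGWA.of _ _ _ (R36.psi (q : k)) ∧
      e (proj _ (E (q : k))) = GGWA.x _ _ _ ∧
      e (proj _ (c (q : k))) = GGWA.y _ _ _ := by
  set s : Set (Dq (q : k)) := {phi (q : k)} with hs
  have hq0 := q.ne_zero
  have hF := isDqSystem_factor s
  obtain ⟨binv, b_binv, binv_b⟩ := exists_binv hq2 (s := s) (by simp [hs])
  have hne := one_sub_zpow_neg_two_ne_zero hq2
  have hψ := proj_psi s
  set ψ := proj s (psi (q : k))
  set t : Fin 4 → Factor s := ![proj s (a (q : k)), proj s (b (q : k)), proj s (K (q : k)), ψ]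
  set g : R36 (q : k) →ₐ[k] Factor s := QuantumPolynomial.lift t
    ![proj s (ainv (q : k)), binv, proj s (Kinv (q : k)), 0]
    (qcomm_of_lt hq0 (by
      intro i j hij
      fin_cases i <;> fin_cases j <;> first | (exfalso; revert hij; decide) | skip
      exacts [hF.ab.congr (zpow_one _).symm,
        (hF.Ka.symm (inv_ne_zero hq0)).congr ((inv_inv _).trans (zpow_one _).symm),
        (hψ ▸ hF.a_psiElt hq0 : QComm _ _ ψ).congr (zpow_one _).symm,
        (hF.Kb.symm hq0).congr (zpow_neg_one _).symm,
        (hψ ▸ hF.b_psiElt hq0 : QComm _ _ ψ).congr (zpow_zero _).symm,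
        (hψ ▸ hF.K_psiElt hq0 : QComm _ _ ψ).congr (zpow_one _).symm]))
    (by
      intro i hi
      fin_cases i
      exacts [hF.a_ainv, b_binv, hF.K_Kinv, absurd hi (by decide)])
    (by
      intro i hi
      fin_cases i
      exacts [hF.ainv_a, binv_b, hF.Kinv_K, absurd hi (by decide)])
  have gX : ∀ i, g (X _ _ i) = t i := lift_X _ _ _ _ _
  refine exists_equiv_of_phi (ia := 0) (ib := 1) (iK := 2) (P := R36.psi (q : k)) hq2
    (by simp [hs]) (by decide) (by decide) (by decide)
    ((qMatrix_submatrix (m := 1) rfl).trans (zpow_one _))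
    ((qMatrix_submatrix (m := -1) rfl).trans (zpow_neg_one _))
    ((qMatrix_submatrix (m := 1) rfl).trans (zpow_one _))
    rfl rfl (by simp) (by simp) rfl rfl ?_ ?_ g (gX 0) (gX 1) (gX 2) (gX 3) ?_ ?_ ?_ ?_
  · exact Eq.trans (by rw [R36.scale_elt]; simp) (inv_smul_sub_smul hne (R36.psi (q : k))
      (R36.ainv (q : k) * R36.K (q : k)))
  · rw [R36.elt, smul_inv_smul₀ hne, sub_add_cancel]
  · rintro f - h - z rfl
    exact h
  · intro i
    rw [gX]
    fin_cases i
    exacts [hF.Ea, hF.Eb, (hF.KE.symm (pow_ne_zero 2 hq0)).congr (by simp [zpow_neg]),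
      (hψ ▸ hF.E_psiElt hq0 : QComm _ _ ψ)]
  · intro i
    rw [gX]
    fin_cases i
    exacts [(hF.ac.symm hq0).congr (by simp), (hF.bc.symm one_ne_zero).congr (by simp),
      (hF.Kc.symm (inv_ne_zero hq0)).congr (by simp), (hψ ▸ hF.c_psiElt hq0 : QComm _ _ ψ)]
  · intro f h1 h2 h3 h4 i
    rw [gX]
    fin_cases i
    exacts [h1, h2, h3, h4]

/-! #### `ψ = 0`, `φ` generic -/

theorem R25.scale_elt (u : Fin 4 → kˣ) : scale u (R25.elt (q : k)) =
    ((q : k)⁻¹ - q)⁻¹ • ((u 3 : k) • R25.phi (q : k) - (u 0 : k) • R25.a (q : k)) := by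
  rw [R25.elt, map_smul, map_sub, scale_X, scale_X]

/-- The terms φ and a are fixed by τσ and have equal commutation scalars with every variable. -/
theorem R25.isGGWADatum : IsGGWADatum
    (scale ![q, q, q ^ 2, q⁻¹] : R25 (q : k) ≃ₐ[k] R25 (q : k)).toAlgHom
    (scale ![q⁻¹, 1, q⁻¹, q] : R25 (q : k) ≃ₐ[k] R25 (q : k)).toAlgHom (R25.elt (q : k)) := by
  have hq0 := q.ne_zero
  refine isGGWADatum_scale ?_ fun i => ?_
  · rw [R25.scale_elt, map_smul, map_sub, map_smul, map_smul, scale_X, scale_X, smul_smul,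
      smul_smul, R25.elt]
    congr 2 <;> simp
  · refine QComm.smul_left _ ?_
    fin_cases i
    · exact ((qcomm_X_of_eq 0 rfl).congr (by simp)).sub_left
        ((qcomm_X_of_eq 0 rfl).congr (by simp))
    · exact ((qcomm_X_of_eq 1 rfl).congr (by simp)).sub_left
        ((qcomm_X_of_eq 1 rfl).congr (by simp))
    · exact ((qcomm_X_of_eq 1 rfl).congr (by simp; field_simp)).sub_left
        ((qcomm_X_of_eq 1 rfl).congr (by simp; field_simp))
    · exact ((qcomm_X_of_eq 0 rfl).congr (by simp)).sub_left
        ((qcomm_X_of_eq 0 rfl).congr (by simp))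

theorem exists_equiv_R25 (hq2 : (q : k) ^ 2 ≠ 1) : ∃ e : Factor {psi (q : k)} ≃ₐ[k]
    ScaleGGWA ![q, q, q ^ 2, q⁻¹] ![q⁻¹, 1, q⁻¹, q] (R25.elt (q : k)),
      e (proj _ (a (q : k))) = GGWA.of _ _ _ (R25.a (q : k)) ∧
      e (proj _ (c (q : k))) = GGWA.of _ _ _ (R25.c (q : k)) ∧
      e (proj _ (K (q : k))) = GGWA.of _ _ _ (R25.K (q : k)) ∧
      e (proj _ (phi (q : k))) = GGWA.of _ _ _ (R25.phi (q : k)) ∧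
      e (proj _ (F (q : k))) = GGWA.x _ _ _ ∧
      e (proj _ (b (q : k))) = GGWA.y _ _ _ := by
  set s : Set (Dq (q : k)) := {psi (q : k)} with hs
  have hq0 := q.ne_zero
  have hF := isDqSystem_factor s
  obtain ⟨cinv, c_cinv, cinv_c⟩ := exists_cinv hq2 (s := s) (by simp [hs])
  have hne : (q : k)⁻¹ - q ≠ 0 := by
    rw [← neg_sub]; exact neg_ne_zero.2 (sub_inv_ne_zero hq0 hq2)
  have hφ := proj_phi s
  set φ := proj s (phi (q : k))
  set t : Fin 4 → Factor s := ![proj s (a (q : k)), proj s (c (q : k)), proj s (K (q : k)), φ]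
  set g : R25 (q : k) →ₐ[k] Factor s := QuantumPolynomial.lift t
    ![proj s (ainv (q : k)), cinv, proj s (Kinv (q : k)), 0]
    (qcomm_of_lt hq0 (by
      intro i j hij
      fin_cases i <;> fin_cases j <;> first | (exfalso; revert hij; decide) | skip
      exacts [hF.ac.congr (zpow_one _).symm,
        (hF.Ka.symm (inv_ne_zero hq0)).congr ((inv_inv _).trans (zpow_one _).symm),
        (hφ ▸ hF.a_phiElt hq0 : QComm _ _ φ).congr (zpow_zero _).symm,
        (hF.Kc.symm (inv_ne_zero hq0)).congr ((inv_inv _).trans (zpow_one _).symm),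
        (hφ ▸ hF.c_phiElt hq0 : QComm _ _ φ).congr (zpow_neg_one _).symm,
        (hφ ▸ hF.K_phiElt hq0 : QComm _ _ φ).congr (zpow_neg_one _).symm]))
    (by
      intro i hi
      fin_cases i
      exacts [hF.a_ainv, c_cinv, hF.K_Kinv, absurd hi (by decide)])
    (by
      intro i hi
      fin_cases i
      exacts [hF.ainv_a, cinv_c, hF.Kinv_K, absurd hi (by decide)])
  have gX : ∀ i, g (X _ _ i) = t i := lift_X _ _ _ _ _
  refine exists_equiv_of_psi (ia := 0) (ic := 1) (iK := 2) (P := R25.phi (q : k)) hq2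
    (by simp [hs]) (by decide) (by decide) (by decide)
    ((qMatrix_submatrix (m := 1) rfl).trans (zpow_one _))
    ((qMatrix_submatrix (m := -1) rfl).trans (zpow_neg_one _))
    ((qMatrix_submatrix (m := -1) rfl).trans (zpow_neg_one _))
    rfl rfl (by simp) (by simp) rfl (by simp) ?_ ?_ g (gX 0) (gX 1) (gX 2) (gX 3) ?_ ?_ ?_ ?_
  · rw [R25.scale_elt, R25.elt, ← inv_smul_smul₀ hne (X _ _ 0), smul_comm (q : k)⁻¹,
      ← smul_add]
    congr 1
    simp only [smul_sub, sub_smul]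
    simp
  · rw [R25.elt, smul_inv_smul₀ hne, sub_add_cancel]
  · rintro f - - h - z rfl
    exact h
  · intro i
    rw [gX]
    fin_cases i
    exacts [hF.Fa, hF.Fc, (hF.KF.symm (zpow_ne_zero _ hq0)).congr (by simp [zpow_neg]),
      (hφ ▸ hF.F_phiElt hq0 : QComm _ _ φ).congr (by simp)]
  · intro i
    rw [gX]
    fin_cases i
    exacts [(hF.ab.symm hq0).congr (by simp), hF.bc,
      (hF.Kb.symm hq0).congr (by simp), (hφ ▸ hF.b_phiElt hq0 : QComm _ _ φ)]
  · intro f h1 h2 h3 h4 i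
    rw [gX]
    fin_cases i
    exacts [h1, h2, h3, h4]

/-! #### `φ = 0` and `ψ = α b` -/

theorem R356.scale_elt (α : k) (u : Fin 3 → kˣ) : scale u (R356.elt (q : k) α) =
    (1 - (q : k) ^ (-2 : ℤ))⁻¹ • ((u 1 : k) • α • R356.b (q : k) -
      ((u 0 : k)⁻¹ * u 2) • (R356.ainv (q : k) * R356.K (q : k))) := by
  rw [R356.elt, map_smul, map_sub, map_mul, map_smul, scale_X, scale_X, scale_Xinv,
    smul_mul_smul_comm, smul_comm α]

/-- The element αb replaces ψ: both are fixed by σ and τ and commute with a, b, K by the same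
scalars. -/
theorem R356.isGGWADatum (α : k) : IsGGWADatum
    (scale ![1, 1, q ^ (-2 : ℤ)] : R356 (q : k) ≃ₐ[k] R356 (q : k)).toAlgHom
    (scale ![q⁻¹, 1, q] : R356 (q : k) ≃ₐ[k] R356 (q : k)).toAlgHom (R356.elt (q : k) α) := by
  have hq0 := q.ne_zero
  refine isGGWADatum_scale ?_ fun i => ?_
  · rw [R356.scale_elt, map_smul, map_sub, map_smul, map_smul, map_smul, map_mul, scale_X, scale_X,
      scale_Xinv, smul_mul_smul_comm, smul_smul ((_ : k)⁻¹ * _), R356.elt]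
    congr 2
    · simp
    · convert one_smul k _ using 2
      simp [zpow_neg]
      field_simp
  · refine QComm.smul_left _ ?_
    fin_cases i
    · exact (((qcomm_X_of_eq (-1) rfl).congr (by simp)).smul_left _).sub_left
        (((qcomm_Xinv_of_eq hq0 (by decide) 0 rfl).mul_left
          (qcomm_X_of_eq (-1) rfl)).congr (by simp))
    · exact (((qcomm_X_of_eq 0 rfl).congr (by simp)).smul_left _).sub_left
        (((qcomm_Xinv_of_eq hq0 (by decide) (-1) rfl).mul_left
          (qcomm_X_of_eq 1 rfl)).congr (by simp))
    · exact (((qcomm_X_of_eq (-1) rfl).congr (by simp [zpow_neg]; field_simp)).smul_left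
        _).sub_left (((qcomm_Xinv_of_eq hq0 (by decide) (-1) rfl).mul_left
          (qcomm_X_of_eq 0 rfl)).congr (by simp [zpow_neg]; field_simp))

theorem exists_equiv_R356 (hq2 : (q : k) ^ 2 ≠ 1) (α : k) :
    ∃ e : Factor {phi (q : k), psi (q : k) - α • b (q : k)} ≃ₐ[k]
      ScaleGGWA ![1, 1, q ^ (-2 : ℤ)] ![q⁻¹, 1, q] (R356.elt (q : k) α),
      e (proj _ (a (q : k))) = GGWA.of _ _ _ (R356.a (q : k)) ∧
      e (proj _ (b (q : k))) = GGWA.of _ _ _ (R356.b (q : k)) ∧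
      e (proj _ (K (q : k))) = GGWA.of _ _ _ (R356.K (q : k)) ∧
      e (proj _ (E (q : k))) = GGWA.x _ _ _ ∧
      e (proj _ (c (q : k))) = GGWA.y _ _ _ := by
  set s : Set (Dq (q : k)) := {phi (q : k), psi (q : k) - α • b (q : k)} with hs
  have hq0 := q.ne_zero
  have hF := isDqSystem_factor s
  obtain ⟨binv, b_binv, binv_b⟩ := exists_binv hq2 (s := s) (by simp [hs])
  have hne := one_sub_zpow_neg_two_ne_zero hq2
  set t : Fin 3 → Factor s := ![proj s (a (q : k)), proj s (b (q : k)), proj s (K (q : k))]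
  set g : R356 (q : k) →ₐ[k] Factor s := QuantumPolynomial.lift t
    ![proj s (ainv (q : k)), binv, proj s (Kinv (q : k))]
    (qcomm_of_lt hq0 (by
      intro i j hij
      fin_cases i <;> fin_cases j <;> first | (exfalso; revert hij; decide) | skip
      exacts [hF.ab.congr (zpow_one _).symm,
        (hF.Ka.symm (inv_ne_zero hq0)).congr ((inv_inv _).trans (zpow_one _).symm),
        (hF.Kb.symm hq0).congr (zpow_neg_one _).symm]))
    (by
      intro i hi
      fin_cases i
      exacts [hF.a_ainv, b_binv, hF.K_Kinv])
    (by
      intro i hi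
      fin_cases i
      exacts [hF.ainv_a, binv_b, hF.Kinv_K])
  have gX : ∀ i, g (X _ _ i) = t i := lift_X _ _ _ _ _
  -- The base element standing for ψ is now αb instead of a separate variable.
  obtain ⟨e, h1, h2, h3, -, h4, h5⟩ := exists_equiv_of_phi (ia := 0) (ib := 1) (iK := 2)
    (u := ![1, 1, q ^ (-2 : ℤ)]) (w := ![q⁻¹, 1, q]) (e := R356.elt (q : k) α)
    (P := α • R356.b (q : k)) hq2
    (s := s) (by simp [hs]) (by decide) (by decide) (by decide)
    ((qMatrix_submatrix (m := 1) rfl).trans (zpow_one _))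
    ((qMatrix_submatrix (m := -1) rfl).trans (zpow_neg_one _))
    ((qMatrix_submatrix (m := 1) rfl).trans (zpow_one _))
    rfl rfl (by simp) (by simp) rfl rfl
    (by
      exact Eq.trans (by rw [R356.scale_elt]; simp) (inv_smul_sub_smul hne (α • R356.b (q : k))
        (R356.ainv (q : k) * R356.K (q : k))))
    (by rw [R356.elt, smul_inv_smul₀ hne, sub_add_cancel]) g (gX 0) (gX 1) (gX 2)
    (by
      rw [map_smul, gX]
      change α • proj s (b (q : k)) = _
      rw [eq_comm, ← map_smul, ← sub_eq_zero, ← map_sub, proj_eq_zero (by simp [hs])])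
    (by
      rintro f hb h1 h2 z (rfl | rfl)
      · exact h1
      · rw [map_sub, h2, map_smul, map_smul, hb, sub_self])
    (by
      intro i
      rw [gX]
      fin_cases i
      exacts [hF.Ea, hF.Eb, (hF.KE.symm (pow_ne_zero 2 hq0)).congr (by simp [zpow_neg])])
    (by
      intro i
      rw [gX]
      fin_cases i
      exacts [(hF.ac.symm hq0).congr (by simp), (hF.bc.symm one_ne_zero).congr (by simp),
        (hF.Kc.symm (inv_ne_zero hq0)).congr (by simp)])
    (by
      intro f h1 h2 h3 _ i
      rw [gX]
      fin_cases i
      exacts [h1, h2, h3])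
  exact ⟨e, h1, h2, h3, h4, h5⟩

/-! #### `ψ = 0` and `φ = β c K⁻¹` -/

theorem R256.scale_elt (β : k) (u : Fin 3 → kˣ) : scale u (R256.elt (q : k) β) =
    ((q : k)⁻¹ - q)⁻¹ • ((u 1 * (u 2 : k)⁻¹) • β • (R256.c (q : k) * R256.Kinv (q : k)) -
      (u 0 : k) • R256.a (q : k)) := by
  rw [R256.elt, map_smul, map_sub, map_smul, map_mul, scale_X, scale_X, scale_Xinv,
    smul_mul_smul_comm, smul_comm β]

/-- The element cK⁻¹ replaces φ: it is fixed by τσ and has the same commutation scalars as a. -/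
theorem R256.isGGWADatum (β : k) : IsGGWADatum
    (scale ![q, q, q ^ 2] : R256 (q : k) ≃ₐ[k] R256 (q : k)).toAlgHom
    (scale ![q⁻¹, 1, q⁻¹] : R256 (q : k) ≃ₐ[k] R256 (q : k)).toAlgHom
    (R256.elt (q : k) β) := by
  have hq0 := q.ne_zero
  refine isGGWADatum_scale ?_ fun i => ?_
  · rw [R256.scale_elt, map_smul, map_sub, map_smul, map_smul, map_smul, map_mul, scale_X, scale_X,
      scale_Xinv, smul_mul_smul_comm, smul_comm β, smul_smul, smul_smul, R256.elt]
    congr 2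
    · congr 1
      simp
      field_simp
    · simp
  · refine QComm.smul_left _ ?_
    fin_cases i
    · exact ((((qcomm_X_of_eq (-1) rfl).mul_left (qcomm_Xinv_of_eq hq0 (by decide) 1 rfl)).congr
        (by simp)).smul_left _).sub_left ((qcomm_X_of_eq 0 rfl).congr (by simp))
    · exact ((((qcomm_X_of_eq 0 rfl).mul_left (qcomm_Xinv_of_eq hq0 (by decide) 1 rfl)).congr
        (by simp)).smul_left _).sub_left ((qcomm_X_of_eq 1 rfl).congr (by simp))
    · exact ((((qcomm_X_of_eq 1 rfl).mul_left (qcomm_Xinv_of_eq hq0 (by decide) 0 rfl)).congr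
        (by simp; field_simp)).smul_left _).sub_left
          ((qcomm_X_of_eq 1 rfl).congr (by simp; field_simp))

theorem exists_equiv_R256 (hq2 : (q : k) ^ 2 ≠ 1) (β : k) :
    ∃ e : Factor {phi (q : k) - β • (c (q : k) * Kinv (q : k)), psi (q : k)} ≃ₐ[k]
      ScaleGGWA ![q, q, q ^ 2] ![q⁻¹, 1, q⁻¹] (R256.elt (q : k) β),
      e (proj _ (a (q : k))) = GGWA.of _ _ _ (R256.a (q : k)) ∧
      e (proj _ (c (q : k))) = GGWA.of _ _ _ (R256.c (q : k)) ∧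
      e (proj _ (K (q : k))) = GGWA.of _ _ _ (R256.K (q : k)) ∧
      e (proj _ (F (q : k))) = GGWA.x _ _ _ ∧
      e (proj _ (b (q : k))) = GGWA.y _ _ _ := by
  set s : Set (Dq (q : k)) :=
    {phi (q : k) - β • (c (q : k) * Kinv (q : k)), psi (q : k)} with hs
  have hq0 := q.ne_zero
  have hF := isDqSystem_factor s
  obtain ⟨cinv, c_cinv, cinv_c⟩ := exists_cinv hq2 (s := s) (by simp [hs])
  have hne : (q : k)⁻¹ - q ≠ 0 := by
    rw [← neg_sub]; exact neg_ne_zero.2 (sub_inv_ne_zero hq0 hq2)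
  set t : Fin 3 → Factor s := ![proj s (a (q : k)), proj s (c (q : k)), proj s (K (q : k))]
  set tinv : Fin 3 → Factor s := ![proj s (ainv (q : k)), cinv, proj s (Kinv (q : k))]
  set g : R256 (q : k) →ₐ[k] Factor s := QuantumPolynomial.lift t tinv
    (qcomm_of_lt hq0 (by
      intro i j hij
      fin_cases i <;> fin_cases j <;> first | (exfalso; revert hij; decide) | skip
      exacts [hF.ac.congr (zpow_one _).symm,
        (hF.Ka.symm (inv_ne_zero hq0)).congr ((inv_inv _).trans (zpow_one _).symm),
        (hF.Kc.symm (inv_ne_zero hq0)).congr ((inv_inv _).trans (zpow_one _).symm)]))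
    (by
      intro i hi
      fin_cases i
      exacts [hF.a_ainv, c_cinv, hF.K_Kinv])
    (by
      intro i hi
      fin_cases i
      exacts [hF.ainv_a, cinv_c, hF.Kinv_K])
  have gX : ∀ i, g (X _ _ i) = t i := lift_X _ _ _ _ _
  have gXinv : g (R256.Kinv (q : k)) = tinv 2 := lift_Xinv _ _ _ _ _ _ _
  obtain ⟨e, h1, h2, h3, -, h4, h5⟩ := exists_equiv_of_psi (ia := 0) (ic := 1) (iK := 2)
    (u := ![q, q, q ^ 2]) (w := ![q⁻¹, 1, q⁻¹]) (e := R256.elt (q : k) β)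
    (P := β • (R256.c (q : k) * R256.Kinv (q : k))) hq2
    (s := s) (by simp [hs]) (by decide) (by decide) (by decide)
    ((qMatrix_submatrix (m := 1) rfl).trans (zpow_one _))
    ((qMatrix_submatrix (m := -1) rfl).trans (zpow_neg_one _))
    ((qMatrix_submatrix (m := -1) rfl).trans (zpow_neg_one _))
    rfl rfl (by simp) (by simp) rfl (by simp)
    (by
      rw [R256.scale_elt, R256.elt, ← inv_smul_smul₀ hne (X _ _ 0), smul_comm (q : k)⁻¹,
        ← smul_add]
      congr 1
      simp only [smul_sub, sub_smul]
      simp [sq])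
    (by rw [R256.elt, smul_inv_smul₀ hne, sub_add_cancel]) g (gX 0) (gX 1) (gX 2)
    (by
      rw [map_smul, map_mul, gX, gXinv]
      change β • (proj s (c (q : k)) * proj s (Kinv (q : k))) = _
      rw [eq_comm, ← map_mul, ← map_smul, ← sub_eq_zero, ← map_sub, proj_eq_zero (by simp [hs])])
    (by
      rintro f hc hK h1 h2 z (rfl | rfl)
      · rw [map_sub, h2, map_smul, map_smul, map_mul, map_mul, hc, hK, sub_self]
      · exact h1)
    (by
      intro i
      rw [gX]
      fin_cases i
      exacts [hF.Fa, hF.Fc, (hF.KF.symm (zpow_ne_zero _ hq0)).congr (by simp [zpow_neg])])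
    (by
      intro i
      rw [gX]
      fin_cases i
      exacts [(hF.ab.symm hq0).congr (by simp), hF.bc, (hF.Kb.symm hq0).congr (by simp)])
    (by
      intro f h1 h2 h3 _ i
      rw [gX]
      fin_cases i
      exacts [h1, h2, h3])
  exact ⟨e, h1, h2, h3, h4, h5⟩

/-! #### `φ = ψ = 0` -/

/-- When both φ and ψ vanish, b and c are both invertible, and F and E are scalar multiples of b⁻¹a
and c⁻¹a⁻¹K. Only the torus generators are left, so the inverse maps can be written down without a
GGWA. -/
theorem exists_equiv_T (hq2 : (q : k) ^ 2 ≠ 1) :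
    ∃ e : Factor {phi (q : k), psi (q : k)} ≃ₐ[k] T (q : k),
      e (proj _ (a (q : k))) = T.a (q : k) ∧ e (proj _ (b (q : k))) = T.b (q : k) ∧
      e (proj _ (c (q : k))) = T.c (q : k) ∧ e (proj _ (K (q : k))) = T.K (q : k) := by
  set s : Set (Dq (q : k)) := {phi (q : k), psi (q : k)} with hs
  have hq0 := q.ne_zero
  have hF := isDqSystem_factor s
  obtain ⟨cinv, c_cinv, cinv_c⟩ := exists_cinv hq2 (s := s) (by simp [hs])
  have hphi : phiElt (q : k) (proj s (a (q : k))) (proj s (b (q : k)))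
      (proj s (F (q : k))) = 0 := by
    rw [← proj_phi, proj_eq_zero (by simp [hs])]
  have hsys := isPhiSystem_of_phiElt_eq_zero hq0 hq2 hF hphi
  set t : Fin 4 → Factor s :=
    ![proj s (a (q : k)), proj s (b (q : k)), proj s (c (q : k)), proj s (K (q : k))]
  set g : T (q : k) →ₐ[k] Factor s := QuantumPolynomial.lift t
    ![proj s (ainv (q : k)), ((q : k) - (q : k)⁻¹) • (proj s (F (q : k)) * proj s (ainv (q : k))),
      cinv, proj s (Kinv (q : k))]
    (qcomm_of_lt hq0 (by
      intro i j hij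
      fin_cases i <;> fin_cases j <;> first | (exfalso; revert hij; decide) | skip
      exacts [hF.ab.congr (zpow_one _).symm, hF.ac.congr (zpow_one _).symm,
        (hF.Ka.symm (inv_ne_zero hq0)).congr ((inv_inv _).trans (zpow_one _).symm),
        hF.bc.congr (zpow_zero _).symm, (hF.Kb.symm hq0).congr (zpow_neg_one _).symm,
        (hF.Kc.symm (inv_ne_zero hq0)).congr ((inv_inv _).trans (zpow_one _).symm)]))
    (by
      intro i hi
      fin_cases i
      exacts [hF.a_ainv, hsys.b_binv, c_cinv, hF.K_Kinv])
    (by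
      intro i hi
      fin_cases i
      exacts [hF.ainv_a, hsys.binv_b, cinv_c, hF.Kinv_K])
  have gX : ∀ i, g (X _ _ i) = t i := lift_X _ _ _ _ _
  -- The central parameter t = 0 makes ψ = tb vanish.
  have hT := isPhiSystem_of_torus (A := T (q : k)) (t := 0) hq0 hq2
    (X_mul_Xinv 0 (by decide)) (Xinv_mul_X 0 (by decide)) (X_mul_Xinv 1 (by decide))
    (Xinv_mul_X 1 (by decide)) (X_mul_Xinv 2 (by decide)) (Xinv_mul_X 2 (by decide))
    (X_mul_Xinv 3 (by decide)) (Xinv_mul_X 3 (by decide))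
    ((qcomm_X_of_eq 1 rfl).congr (zpow_one _)) ((qcomm_X_of_eq 1 rfl).congr (zpow_one _))
    ((qcomm_X_of_eq 0 rfl).congr (zpow_zero _)) ((qcomm_X_of_eq (-1) rfl).congr (zpow_neg_one _))
    ((qcomm_X_of_eq 1 rfl).congr (zpow_one _)) ((qcomm_X_of_eq (-1) rfl).congr (zpow_neg_one _))
    (fun x => Commute.zero_right x)
  have hpsi := psiElt_of_torus hq0 hq2 (X_mul_Xinv 2 (by decide)) hT.toIsEcSystem
  have hd := hT.isDqSystem hq0 hq2
  set f : Factor s →ₐ[k] T (q : k) := factorLift s (lift hd) (by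
    rintro z (rfl | rfl)
    · rw [lift_phi, hT.phiElt_eq_zero hq0 hq2]
    · rw [lift_psi, hpsi, zero_mul])
  have fa : f (proj s (a (q : k))) = T.a (q : k) := lift_of hd .a
  have fb : f (proj s (b (q : k))) = T.b (q : k) := lift_of hd .b
  have fc : f (proj s (c (q : k))) = T.c (q : k) := lift_of hd .c
  have fK : f (proj s (K (q : k))) = T.K (q : k) := lift_of hd .K
  -- Because ψ = 0, cE is a scalar multiple of a⁻¹K. Left multiplication by c⁻¹ shows that an
  -- endomorphism fixing a, c, K fixes E.
  have hcE : ∀ h : Factor s →ₐ[k] Factor s, h (proj s (a (q : k))) = proj s (a (q : k)) →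
      h (proj s (c (q : k))) = proj s (c (q : k)) →
      h (proj s (K (q : k))) = proj s (K (q : k)) →
      h (proj s (E (q : k))) = proj s (E (q : k)) := by
    intro h ha hc hK
    have hainv : h (proj s (ainv (q : k))) = proj s (ainv (q : k)) :=
      AlgHom.eq_of_mul_eq_one (g := AlgHom.id k _) hF.a_ainv hF.ainv_a ha
    have h0 : (1 - (q : k) ^ (-2 : ℤ)) • (proj s (c (q : k)) * proj s (E (q : k))) =
        -(proj s (ainv (q : k)) * proj s (K (q : k))) := by
      rw [eq_neg_iff_add_eq_zero, ← hF.psiElt_eq, ← proj_psi, proj_eq_zero (by simp [hs])]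
    have h1 := congrArg h h0
    rw [map_smul, map_mul, map_neg, map_mul, hainv, hc, hK, ← h0] at h1
    have h2 := smul_right_injective _ (one_sub_zpow_neg_two_ne_zero hq2) h1
    have h3 := congrArg (fun x => cinv * x) h2
    simpa only [← mul_assoc, cinv_c, one_mul] using h3
  refine ⟨AlgEquiv.ofAlgHom f g ?_ ?_, fa, fb, fc, fK⟩
  · refine QuantumPolynomial.algHom_ext fun i => ?_
    rw [AlgHom.comp_apply, gX]
    fin_cases i
    exacts [fa, fb, fc, fK]
  · have ha : (g.comp f) (proj s (a (q : k))) = proj s (a (q : k)) := by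
      rw [AlgHom.comp_apply, fa]; exact gX 0
    have hb : (g.comp f) (proj s (b (q : k))) = proj s (b (q : k)) := by
      rw [AlgHom.comp_apply, fb]; exact gX 1
    have hc : (g.comp f) (proj s (c (q : k))) = proj s (c (q : k)) := by
      rw [AlgHom.comp_apply, fc]; exact gX 2
    have hK : (g.comp f) (proj s (K (q : k))) = proj s (K (q : k)) := by
      rw [AlgHom.comp_apply, fK]; exact gX 3
    exact hsys.algHom_ext (adjoin_binv_eq_top hq2 hF (adjoin_factor s)) ha hb hc hK
      (hcE _ ha hc hK)

end Dq

/-! ### Assembly of the four statements -/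

theorem mainTheorem4 {k : Type*} [Field k] [IsAlgClosed k] [CharZero k] (q : k) (hq0 : q ≠ 0)
    (hq : ∀ n : ℕ, 0 < n → q ^ n ≠ 1) :
    -- 1. the factor algebra by `φ`
    ((∀ z : Dq q, z ∈ TwoSidedIdeal.span {Dq.phi q} ↔ ∃ d : Dq q, z = d * Dq.phi q) ∧
      IsDomain (Dq.Factor {Dq.phi q}) ∧
      (∃ σ τ : Dq.R36 q ≃ₐ[k] Dq.R36 q,
        (σ (Dq.R36.a q) = Dq.R36.a q ∧ σ (Dq.R36.b q) = Dq.R36.b q ∧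
          σ (Dq.R36.K q) = q ^ (-2 : ℤ) • Dq.R36.K q ∧ σ (Dq.R36.psi q) = Dq.R36.psi q) ∧
        (τ (Dq.R36.a q) = q⁻¹ • Dq.R36.a q ∧ τ (Dq.R36.b q) = Dq.R36.b q ∧
          τ (Dq.R36.K q) = q • Dq.R36.K q ∧ τ (Dq.R36.psi q) = Dq.R36.psi q) ∧
        IsGGWADatum (σ : Dq.R36 q →ₐ[k] Dq.R36 q) τ (Dq.R36.elt q) ∧
        ∃ e : Dq.Factor {Dq.phi q} ≃ₐ[k] GGWA (σ : Dq.R36 q →ₐ[k] Dq.R36 q) τ (Dq.R36.elt q),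
          e (Dq.cl _ (Dq.a q)) = GGWA.of _ _ _ (Dq.R36.a q) ∧
          e (Dq.cl _ (Dq.b q)) = GGWA.of _ _ _ (Dq.R36.b q) ∧
          e (Dq.cl _ (Dq.K q)) = GGWA.of _ _ _ (Dq.R36.K q) ∧
          e (Dq.cl _ (Dq.psi q)) = GGWA.of _ _ _ (Dq.R36.psi q) ∧
          e (Dq.cl _ (Dq.E q)) = GGWA.x _ _ _ ∧
          e (Dq.cl _ (Dq.c q)) = GGWA.y _ _ _) ∧
      (∃ (u : (Dq.Factor {Dq.phi q})ˣ) (Θ : Dq.Factor {Dq.phi q}),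
        (u : Dq.Factor {Dq.phi q}) = Dq.cl {Dq.phi q} (Dq.b q) ∧
        Θ = Dq.cl {Dq.phi q} (Dq.psi q) * ↑u⁻¹ ∧
        Subalgebra.center k (Dq.Factor {Dq.phi q}) = Algebra.adjoin k {Θ} ∧
        Transcendental k Θ)) ∧
    -- 2. the factor algebra by `ψ`
    ((∀ z : Dq q, z ∈ TwoSidedIdeal.span {Dq.psi q} ↔ ∃ d : Dq q, z = d * Dq.psi q) ∧
      IsDomain (Dq.Factor {Dq.psi q}) ∧
      (∃ σ τ : Dq.R25 q ≃ₐ[k] Dq.R25 q,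
        (σ (Dq.R25.a q) = q • Dq.R25.a q ∧ σ (Dq.R25.c q) = q • Dq.R25.c q ∧
          σ (Dq.R25.K q) = q ^ 2 • Dq.R25.K q ∧ σ (Dq.R25.phi q) = q⁻¹ • Dq.R25.phi q) ∧
        (τ (Dq.R25.a q) = q⁻¹ • Dq.R25.a q ∧ τ (Dq.R25.c q) = Dq.R25.c q ∧
          τ (Dq.R25.K q) = q⁻¹ • Dq.R25.K q ∧ τ (Dq.R25.phi q) = q • Dq.R25.phi q) ∧
        IsGGWADatum (σ : Dq.R25 q →ₐ[k] Dq.R25 q) τ (Dq.R25.elt q) ∧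
        ∃ e : Dq.Factor {Dq.psi q} ≃ₐ[k] GGWA (σ : Dq.R25 q →ₐ[k] Dq.R25 q) τ (Dq.R25.elt q),
          e (Dq.cl _ (Dq.a q)) = GGWA.of _ _ _ (Dq.R25.a q) ∧
          e (Dq.cl _ (Dq.c q)) = GGWA.of _ _ _ (Dq.R25.c q) ∧
          e (Dq.cl _ (Dq.K q)) = GGWA.of _ _ _ (Dq.R25.K q) ∧
          e (Dq.cl _ (Dq.phi q)) = GGWA.of _ _ _ (Dq.R25.phi q) ∧
          e (Dq.cl _ (Dq.F q)) = GGWA.x _ _ _ ∧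
          e (Dq.cl _ (Dq.b q)) = GGWA.y _ _ _) ∧
      (∃ (u : (Dq.Factor {Dq.psi q})ˣ) (Ω : Dq.Factor {Dq.psi q}),
        (u : Dq.Factor {Dq.psi q}) = Dq.cl {Dq.psi q} (Dq.c q) ∧
        Ω = Dq.cl {Dq.psi q} (Dq.phi q * Dq.K q) * ↑u⁻¹ ∧
        Subalgebra.center k (Dq.Factor {Dq.psi q}) = Algebra.adjoin k {Ω} ∧
        Transcendental k Ω)) ∧
    -- 3. the factor algebras by `φ` and `ψ - α b`
    (∀ α : k,
      IsDomain (Dq.Factor {Dq.phi q, Dq.psi q - α • Dq.b q}) ∧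
      IsSimpleRing (Dq.Factor {Dq.phi q, Dq.psi q - α • Dq.b q}) ∧
      ∃ σ τ : Dq.R356 q ≃ₐ[k] Dq.R356 q,
        (σ (Dq.R356.a q) = Dq.R356.a q ∧ σ (Dq.R356.b q) = Dq.R356.b q ∧
          σ (Dq.R356.K q) = q ^ (-2 : ℤ) • Dq.R356.K q) ∧
        (τ (Dq.R356.a q) = q⁻¹ • Dq.R356.a q ∧ τ (Dq.R356.b q) = Dq.R356.b q ∧
          τ (Dq.R356.K q) = q • Dq.R356.K q) ∧
        IsGGWADatum (σ : Dq.R356 q →ₐ[k] Dq.R356 q) τ (Dq.R356.elt q α) ∧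
        ∃ e : Dq.Factor {Dq.phi q, Dq.psi q - α • Dq.b q} ≃ₐ[k]
            GGWA (σ : Dq.R356 q →ₐ[k] Dq.R356 q) τ (Dq.R356.elt q α),
          e (Dq.cl _ (Dq.a q)) = GGWA.of _ _ _ (Dq.R356.a q) ∧
          e (Dq.cl _ (Dq.b q)) = GGWA.of _ _ _ (Dq.R356.b q) ∧
          e (Dq.cl _ (Dq.K q)) = GGWA.of _ _ _ (Dq.R356.K q) ∧
          e (Dq.cl _ (Dq.E q)) = GGWA.x _ _ _ ∧
          e (Dq.cl _ (Dq.c q)) = GGWA.y _ _ _) ∧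
    -- in particular, the factor algebra by `φ` and `ψ` is a simple quantum torus
    ((∀ z : Dq q, z ∈ TwoSidedIdeal.span {Dq.phi q, Dq.psi q} ↔
        ∃ d d' : Dq q, z = d * Dq.phi q + d' * Dq.psi q) ∧
      IsSimpleRing (Dq.Factor {Dq.phi q, Dq.psi q}) ∧
      ∃ e : Dq.Factor {Dq.phi q, Dq.psi q} ≃ₐ[k] Dq.T q,
        e (Dq.cl _ (Dq.a q)) = Dq.T.a q ∧ e (Dq.cl _ (Dq.b q)) = Dq.T.b q ∧
        e (Dq.cl _ (Dq.c q)) = Dq.T.c q ∧ e (Dq.cl _ (Dq.K q)) = Dq.T.K q) ∧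
    -- 4. the factor algebras by `φ - β c K⁻¹` and `ψ`
    (∀ β : k,
      IsDomain (Dq.Factor {Dq.phi q - β • (Dq.c q * Dq.Kinv q), Dq.psi q}) ∧
      IsSimpleRing (Dq.Factor {Dq.phi q - β • (Dq.c q * Dq.Kinv q), Dq.psi q}) ∧
      ∃ σ τ : Dq.R256 q ≃ₐ[k] Dq.R256 q,
        (σ (Dq.R256.a q) = q • Dq.R256.a q ∧ σ (Dq.R256.c q) = q • Dq.R256.c q ∧
          σ (Dq.R256.K q) = q ^ 2 • Dq.R256.K q) ∧
        (τ (Dq.R256.a q) = q⁻¹ • Dq.R256.a q ∧ τ (Dq.R256.c q) = Dq.R256.c q ∧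
          τ (Dq.R256.K q) = q⁻¹ • Dq.R256.K q) ∧
        IsGGWADatum (σ : Dq.R256 q →ₐ[k] Dq.R256 q) τ (Dq.R256.elt q β) ∧
        ∃ e : Dq.Factor {Dq.phi q - β • (Dq.c q * Dq.Kinv q), Dq.psi q} ≃ₐ[k]
            GGWA (σ : Dq.R256 q →ₐ[k] Dq.R256 q) τ (Dq.R256.elt q β),
          e (Dq.cl _ (Dq.a q)) = GGWA.of _ _ _ (Dq.R256.a q) ∧
          e (Dq.cl _ (Dq.c q)) = GGWA.of _ _ _ (Dq.R256.c q) ∧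
          e (Dq.cl _ (Dq.K q)) = GGWA.of _ _ _ (Dq.R256.K q) ∧
          e (Dq.cl _ (Dq.F q)) = GGWA.x _ _ _ ∧
          e (Dq.cl _ (Dq.b q)) = GGWA.y _ _ _) := by
  lift q to kˣ using isUnit_iff_ne_zero.2 hq0
  have hq2 := hq 2 two_pos
  refine ⟨⟨TwoSidedIdeal.mem_span_singleton_of_normal Dq.exists_phi_mul_eq,
      (Dq.factor_phi hq).1, ?_, (Dq.factor_phi hq).2⟩,
    ⟨TwoSidedIdeal.mem_span_singleton_of_normal Dq.exists_psi_mul_eq,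
      (Dq.factor_psi hq).1, ?_, (Dq.factor_psi hq).2⟩,
    fun α => ⟨(Dq.factor_phi_psi hq α).1, (Dq.factor_phi_psi hq α).2, ?_⟩,
    ⟨TwoSidedIdeal.mem_span_pair_of_normal Dq.exists_phi_mul_eq Dq.exists_psi_mul_eq, ?_,
      Dq.exists_equiv_T hq2⟩,
    fun β => ⟨(Dq.factor_psi_phi hq β).1, (Dq.factor_psi_phi hq β).2, ?_⟩⟩
  · refine ⟨QuantumPolynomial.scale ![1, 1, q ^ (-2 : ℤ), 1],
      QuantumPolynomial.scale ![q⁻¹, 1, q, 1], ?_, ?_, Dq.R36.isGGWADatum,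
      Dq.exists_equiv_R36 hq2⟩ <;>
    simp [QuantumPolynomial.scale_X]
  · refine ⟨QuantumPolynomial.scale ![q, q, q ^ 2, q⁻¹],
      QuantumPolynomial.scale ![q⁻¹, 1, q⁻¹, q], ?_, ?_, Dq.R25.isGGWADatum,
      Dq.exists_equiv_R25 hq2⟩ <;>
    simp [QuantumPolynomial.scale_X]
  · refine ⟨QuantumPolynomial.scale ![1, 1, q ^ (-2 : ℤ)],
      QuantumPolynomial.scale ![q⁻¹, 1, q], ?_, ?_, Dq.R356.isGGWADatum α,
      Dq.exists_equiv_R356 hq2 α⟩ <;>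
    simp [QuantumPolynomial.scale_X]
  -- Simplicity of the quantum torus is the member α = 0 of the family.
  · have := (Dq.factor_phi_psi hq 0).2
    rwa [zero_smul, sub_zero] at this
  · refine ⟨QuantumPolynomial.scale ![q, q, q ^ 2],
      QuantumPolynomial.scale ![q⁻¹, 1, q⁻¹], ?_, ?_, Dq.R256.isGGWADatum β,
      Dq.exists_equiv_R256 hq2 β⟩ <;>
    simp [QuantumPolynomial.scale_X]
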